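/- Let $A$ be a ring (unital, not necessarily commutative; modules are left modules), let $\sigma',\sigma$ be automorphisms of $A$ and $\xi\in A$ an invertible element with $\sigma'\sigma(a)=\xi\,\sigma\sigma'(a)\,\xi^{-1}$ for all $a\in A$ (so $(\sigma',\sigma;\xi)$ is a *type*). Let $(\omega',\omega)$ be a regular sequence of type $(\sigma',\sigma;\xi)$ in $A$: that is, $\omega'$ is regular and normal in $A$ (multiplication by $\omega'$ on either side is injective and $A\omega'=\omega'A$), the class of $\omega$ is regular and normal in $A/(\omega')$, and - $\omega' a=\sigma'(a)\omega'$ for all $a\in A$, and $\sigma'(\omega')=\omega'$; - $\omega a=\sigma(a)\omega$ for all $a\in A$, and $\sigma(\omega)=\omega$; - $\sigma'(\omega)=\xi\omega$ and $\sigma(\omega')=\xi^{-1}\omega'$. Put $B=A/(\omega,\omega')$. *Factorizations.* Let $T={}^{\sigma}(-)$ and $T'={}^{\sigma'}(-)$ be the twisting functors on $A$-modules ($a$ acts on ${}^{\sigma}M$ as $\sigma(a)$ on $M$). Multiplication by $\omega$, $\omega'$ and $\xi$ gives natural transformations $\omega\colon \mathrm{Id}\to T$, $\omega'\colon\mathrm{Id}\to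 T'$ and a natural isomorphism $\xi\colon T'T\to TT'$. An $\omega$-factorization consists of morphisms $X^0\xrightarrow{d^0}X^1\xrightarrow{d^1}T(X^0)$ with $d^1d^0=\omega_{X^0}$ and $T(d^0)d^1=\omega_{X^1}$; a morphism is a pair of morphisms commuting with the $d$'s; $\omega'$-factorizations are defined likewise. On the category of $\omega$-factorizations, $T'$ lifts to $\tilde T'(X)=(T'X^0,T'X^1;T'd^0,\xi_{X^0}\circ T'd^1)$ and $\omega'$ lifts to $\tilde\omega'\colon\mathrm{Id}\to\tilde T'$. A two-dimensional factorization $X=X^{\bullet,\bullet}$ is an $\tilde\omega'$-factorization in the category of $\omega$-factorizations. It has components $X^{i,j}$ ($i,j\in\{0,1\}$), rows $(X^{0,j},X^{1,j})$ which are $\omega$-factorizations with morphisms $d_h$, and columns $(X^{i,0},X^{i,1})$ which are $\omega'$-factorizations with morphisms $d_v$ (up to $\xi$). A module $G$ over a ring is *Gorenstein projective* if it is isomorphic to a cocycle module $Z^1(P^\bullet)$ of an acyclic complex $P^\bullet$ of projective modules such that $\mathrm{Hom}(P^\bullet,Q)$ is acyclic for every projective module $Q$. Let $\mathcal A$ be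 the category of Gorenstein projective $A$-modules, respectively that of finitely generated projective $A$-modules. All categories of factorizations with components in $\mathcal A$ are given the exact structure of componentwise short exact sequences. Let $\mathbf{GF}^{0,0}(A;\omega,\omega')$, respectively $\mathbf{MF}^{0,0}(A;\omega,\omega')$, be the category of two-dimensional factorizations $X$ with all components in $\mathcal A$ such that the row $(X^{0,1},X^{1,1})$ is a projective object in the category of $\omega$-factorizations with components in $\mathcal A$, and the column $(X^{1,0},X^{1,1})$ is a projective object in the category of $\omega'$-factorizations with components in $\mathcal A$. The *total-cokernel* $\mathrm{TCok}(X)$ is the cokernel of $(d_v^{1,0},\,d_h^{0,1})\colon X^{1,0}\oplus X^{0,1}\to X^{1,1}$; it is a $B$-module, functorially in $X$. Let $B\text{-}\mathrm{GProj}$ be the category of Gorenstein projective $B$-modules, and $B\text{-}\mathrm{Gproj}^{<+\infty}$ that of finitely generated Gorenstein projective $B$-modules which have finite projective dimension as $A$-modules, both with the short exact sequences as conflations. For a Frobenius exact category $\mathcal E$, let $\underline{\mathcal E}$ be its stable category (morphisms modulo those factoring through projective objects) with its canonical triangulated structure. **Theorem.** The categories $\mathbf{GF}^{0,0}(A;\omega,\omega')$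 and $B\text{-}\mathrm{GProj}$ are Frobenius exact categories, $\mathrm{TCok}$ restricts to an exact functor $\mathbf{GF}^{0,0}(A;\omega,\omega')\to B\text{-}\mathrm{GProj}$ preserving projective objects, and the induced triangle functor is a triangle equivalence $$\mathrm{TCok}\colon \underline{\mathbf{GF}}^{0,0}(A;\omega,\omega')\xrightarrow{\ \sim\ } B\text{-}\underline{\mathrm{GProj}}.$$ If $A$ is left noetherian, then likewise $\mathbf{MF}^{0,0}(A;\omega,\omega')$ and $B\text{-}\mathrm{Gproj}^{<+\infty}$ are Frobenius exact categories, $\mathrm{TCok}$ restricts to an exact functor between them preserving projective objects, and the induced triangle functor is a triangle equivalence $$\mathrm{TCok}\colon \underline{\mathbf{MF}}^{0,0}(A;\omega,\omega')\xrightarrow{\ \sim\ } B\text{-}\underline{\mathrm{Gproj}}^{<+\infty}.$$ -/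

import Mathlib

open CategoryTheory CategoryTheory.Limits

universe v v' u u'

namespace ModFac

/-! ### Exact categories, Frobenius categories -/

section Exact

variable {C : Type u} [Category.{v} C] [Preadditive C]

/-- A composable pair `(i, d)` with `i ≫ d = 0` is a kernel-cokernel pair. -/
def IsKernelCokernelPair (S : ShortComplex C) : Prop :=
  Nonempty (IsLimit (KernelFork.ofι S.f S.zero)) ∧
    Nonempty (IsColimit (CokernelCofork.ofπ S.g S.zero))

/-- `i` is an inflation with respect to the class `E` of conflations. -/
def IsInflation (E : ObjectProperty (ShortComplex C)) {X Y : C} (i : X ⟶ Y) : Prop :=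
  ∃ (Z : C) (d : Y ⟶ Z) (w : i ≫ d = 0), E (ShortComplex.mk i d w)

/-- `d` is a deflation with respect to the class `E` of conflations. -/
def IsDeflation (E : ObjectProperty (ShortComplex C)) {Y Z : C} (d : Y ⟶ Z) : Prop :=
  ∃ (X : C) (i : X ⟶ Y) (w : i ≫ d = 0), E (ShortComplex.mk i d w)

/-- The class `E` of conflations is a Quillen exact structure on the additive category `C`. -/
structure IsExactCategory (E : ObjectProperty (ShortComplex C)) : Prop where
  hasFiniteBiproducts : HasFiniteBiproducts C
  isoClosed : E.IsClosedUnderIsomorphisms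
  kernelCokernel : ∀ S : ShortComplex C, E S → IsKernelCokernelPair S
  ex0 : ∀ Z : C, IsZero Z → IsDeflation E (𝟙 Z)
  ex1 : ∀ {X Y Z : C} (d : X ⟶ Y) (e : Y ⟶ Z),
    IsDeflation E d → IsDeflation E e → IsDeflation E (d ≫ e)
  ex1_op : ∀ {X Y Z : C} (i : X ⟶ Y) (j : Y ⟶ Z),
    IsInflation E i → IsInflation E j → IsInflation E (i ≫ j)
  ex2 : ∀ {Y Z Z₁ : C} (d : Y ⟶ Z) (f : Z₁ ⟶ Z), IsDeflation E d →
    ∃ (Y₁ : C) (f₁ : Y₁ ⟶ Y) (d₁ : Y₁ ⟶ Z₁), IsPullback f₁ d₁ d f ∧ IsDeflation E d₁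
  ex2_op : ∀ {X Y X₁ : C} (i : X ⟶ Y) (f : X ⟶ X₁), IsInflation E i →
    ∃ (Y₁ : C) (f₁ : Y ⟶ Y₁) (i₁ : X₁ ⟶ Y₁), IsPushout i f f₁ i₁ ∧ IsInflation E i₁

/-- Projective objects: every morphism to the end of a conflation lifts. -/
def IsProj (E : ObjectProperty (ShortComplex C)) (P : C) : Prop :=
  ∀ S : ShortComplex C, E S → ∀ h : P ⟶ S.X₃, ∃ k : P ⟶ S.X₂, k ≫ S.g = h

/-- Injective objects: every morphism from the start of a conflation extends. -/
def IsInj (E : ObjectProperty (ShortComplex C)) (I : C) : Prop :=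
  ∀ S : ShortComplex C, E S → ∀ h : S.X₁ ⟶ I, ∃ k : S.X₂ ⟶ I, S.f ≫ k = h

/-- A conflation `X ⟶ I ⟶ Z` with `I` injective. -/
structure InjectiveConflation (E : ObjectProperty (ShortComplex C)) (X : C) where
  I : C
  Z : C
  i : X ⟶ I
  p : I ⟶ Z
  w : i ≫ p = 0
  conflation : E (ShortComplex.mk i p w)
  inj : IsInj E I

/-- Frobenius exact categories. -/
structure IsFrobenius (E : ObjectProperty (ShortComplex C)) : Prop where
  exact : IsExactCategory E
  enoughProj : ∀ X : C, ∃ (P : C) (d : P ⟶ X), IsProj E P ∧ IsDeflation E d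
  enoughInj : ∀ X : C, Nonempty (InjectiveConflation E X)
  proj_iff_inj : ∀ X : C, IsProj E X ↔ IsInj E X

/-! ### The stable category -/

/-- The subgroup of morphisms factoring through projective objects. (Such morphisms already form
a subgroup as soon as `C` has binary biproducts.) -/
def projIdeal (E : ObjectProperty (ShortComplex C)) (X Y : C) : AddSubgroup (X ⟶ Y) :=
  AddSubgroup.closure {f | ∃ (P : C) (a : X ⟶ P) (b : P ⟶ Y), IsProj E P ∧ a ≫ b = f}

lemma comp_mem_projIdeal (E : ObjectProperty (ShortComplex C)) {X Y Z : C} (f : X ⟶ Y) {g : Y ⟶ Z}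
    (hg : g ∈ projIdeal E Y Z) : f ≫ g ∈ projIdeal E X Z := by
  induction hg using AddSubgroup.closure_induction with
  | mem g hg =>
    obtain ⟨P, a, b, hP, rfl⟩ := hg
    exact AddSubgroup.subset_closure ⟨P, f ≫ a, b, hP, by simp⟩
  | zero => simp [zero_mem]
  | add g₁ g₂ _ _ h₁ h₂ => simpa using add_mem h₁ h₂
  | neg g _ h => simpa using neg_mem h

lemma mem_projIdeal_comp (E : ObjectProperty (ShortComplex C)) {X Y Z : C} {f : X ⟶ Y} (g : Y ⟶ Z)
    (hf : f ∈ projIdeal E X Y) : f ≫ g ∈ projIdeal E X Z := by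
  induction hf using AddSubgroup.closure_induction with
  | mem f hf =>
    obtain ⟨P, a, b, hP, rfl⟩ := hf
    exact AddSubgroup.subset_closure ⟨P, a, b ≫ g, hP, by simp⟩
  | zero => simp [zero_mem]
  | add g₁ g₂ _ _ h₁ h₂ => simpa using add_mem h₁ h₂
  | neg g _ h => simpa using neg_mem h

/-- Two morphisms are identified in the stable category when their difference factors through
a projective object. -/
def stableRel (E : ObjectProperty (ShortComplex C)) : HomRel C :=
  fun X Y f g => f - g ∈ projIdeal E X Y

instance (E : ObjectProperty (ShortComplex C)) : Congruence (stableRel E) where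
  equivalence := {
    refl := fun f => by simp [stableRel, zero_mem]
    symm := fun {f g} h => by
      have := neg_mem (show f - g ∈ _ from h)
      rwa [neg_sub] at this
    trans := fun {f g k} h h' => by
      have := add_mem (show f - g ∈ _ from h) (show g - k ∈ _ from h')
      rwa [sub_add_sub_cancel] at this }
  comp_left f _ _ h := by
    have := comp_mem_projIdeal E f (show _ - _ ∈ _ from h)
    rwa [Preadditive.comp_sub] at this
  comp_right g h := by
    have := mem_projIdeal_comp E g (show _ - _ ∈ _ from h)
    rwa [Preadditive.sub_comp] at this

/-- The stable category of `(C, E)`: same objects, and morphisms modulo those factoring through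
projective objects. -/
abbrev Stable (E : ObjectProperty (ShortComplex C)) := CategoryTheory.Quotient (stableRel E)

/-- The canonical functor from `C` to its stable category. -/
abbrev toStable (E : ObjectProperty (ShortComplex C)) : C ⥤ Stable E := CategoryTheory.Quotient.functor _

noncomputable instance (E : ObjectProperty (ShortComplex C)) : Preadditive (Stable E) :=
  CategoryTheory.Quotient.preadditive (stableRel E) (fun X Y f₁ f₂ g₁ g₂ h h' => by
    have := add_mem (show f₁ - f₂ ∈ _ from h) (show g₁ - g₂ ∈ _ from h')
    rwa [sub_add_sub_comm] at this)

namespace IsFrobenius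

variable {E : ObjectProperty (ShortComplex C)} (hE : IsFrobenius E)

/-- A chosen conflation `X ⟶ I(X) ⟶ Σ(X)` with `I(X)` injective. -/
noncomputable def hull (X : C) : InjectiveConflation E X := (hE.enoughInj X).some

lemma exists_extension {X Y : C} (f : X ⟶ Y) :
    ∃ (g : (hE.hull X).I ⟶ (hE.hull Y).I) (h : (hE.hull X).Z ⟶ (hE.hull Y).Z),
      (hE.hull X).i ≫ g = f ≫ (hE.hull Y).i ∧ (hE.hull X).p ≫ h = g ≫ (hE.hull Y).p := by
  obtain ⟨g, hg⟩ := (hE.hull Y).inj _ (hE.hull X).conflation (f ≫ (hE.hull Y).i)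
  obtain ⟨-, ⟨hc⟩⟩ := hE.exact.kernelCokernel _ (hE.hull X).conflation
  obtain ⟨h, hh⟩ := CokernelCofork.IsColimit.desc' hc (g ≫ (hE.hull Y).p) (by
    simp only at hg ⊢
    rw [← Category.assoc, hg, Category.assoc, (hE.hull Y).w, comp_zero])
  exact ⟨g, h, hg, hh⟩

lemma stable_unique {X Y : C} {f f₁ : X ⟶ Y} {g g₁ : (hE.hull X).I ⟶ (hE.hull Y).I}
    {h h₁ : (hE.hull X).Z ⟶ (hE.hull Y).Z}
    (hg : (hE.hull X).i ≫ g = f ≫ (hE.hull Y).i) (hh : (hE.hull X).p ≫ h = g ≫ (hE.hull Y).p)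
    (hg₁ : (hE.hull X).i ≫ g₁ = f₁ ≫ (hE.hull Y).i)
    (hh₁ : (hE.hull X).p ≫ h₁ = g₁ ≫ (hE.hull Y).p)
    (hf : stableRel E f f₁) : stableRel E h h₁ := by
  obtain ⟨s, hs⟩ : ∃ s : (hE.hull X).I ⟶ Y, (hE.hull X).i ≫ s = f - f₁ := by
    have hf : f - f₁ ∈ projIdeal E X Y := hf
    generalize f - f₁ = e at hf
    induction hf using AddSubgroup.closure_induction with
    | mem f hf =>
      obtain ⟨P, a, b, hP, rfl⟩ := hf
      obtain ⟨k, hk⟩ := ((hE.proj_iff_inj P).1 hP) _ (hE.hull X).conflation a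
      refine ⟨k ≫ b, ?_⟩
      simp only at hk
      rw [← Category.assoc, hk]
    | zero => exact ⟨0, comp_zero⟩
    | add f₁ f₂ _ _ h₁ h₂ =>
      obtain ⟨s₁, h₁⟩ := h₁
      obtain ⟨s₂, h₂⟩ := h₂
      exact ⟨s₁ + s₂, by rw [Preadditive.comp_add, h₁, h₂]⟩
    | neg f _ h =>
      obtain ⟨s, h⟩ := h
      exact ⟨-s, by rw [Preadditive.comp_neg, h]⟩
  obtain ⟨-, ⟨hc⟩⟩ := hE.exact.kernelCokernel _ (hE.hull X).conflation
  obtain ⟨t, ht⟩ := CokernelCofork.IsColimit.desc' hc (g - g₁ - s ≫ (hE.hull Y).i) (by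
    simp only [Preadditive.comp_sub]
    rw [hg, hg₁, ← Category.assoc, hs, Preadditive.sub_comp, sub_self])
  have ht : (hE.hull X).p ≫ t = g - g₁ - s ≫ (hE.hull Y).i := ht
  have key : h - h₁ = t ≫ (hE.hull Y).p := by
    apply Cofork.IsColimit.hom_ext hc
    change (hE.hull X).p ≫ (h - h₁) = (hE.hull X).p ≫ t ≫ (hE.hull Y).p
    rw [← Category.assoc, ht, Preadditive.comp_sub, hh, hh₁]
    simp [(hE.hull Y).w]
  change h - h₁ ∈ projIdeal E _ _
  rw [key]
  exact AddSubgroup.subset_closure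
    ⟨(hE.hull Y).I, t, (hE.hull Y).p, (hE.proj_iff_inj _).2 (hE.hull Y).inj, rfl⟩

/-- A chosen morphism `Σ(f) : Σ(X) ⟶ Σ(Y)`, obtained from an extension `I(X) ⟶ I(Y)` of `f`. -/
noncomputable def suspMap {X Y : C} (f : X ⟶ Y) : (hE.hull X).Z ⟶ (hE.hull Y).Z :=
  (hE.exists_extension f).choose_spec.choose

lemma suspMap_spec {X Y : C} (f : X ⟶ Y) : ∃ g : (hE.hull X).I ⟶ (hE.hull Y).I,
    (hE.hull X).i ≫ g = f ≫ (hE.hull Y).i ∧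
      (hE.hull X).p ≫ hE.suspMap f = g ≫ (hE.hull Y).p :=
  ⟨_, (hE.exists_extension f).choose_spec.choose_spec⟩

/-- The functor `C ⥤ Stable E` sending `X` to `Σ(X)`. -/
noncomputable def preSuspension : C ⥤ Stable E where
  obj X := (toStable E).obj (hE.hull X).Z
  map f := (toStable E).map (hE.suspMap f)
  map_id X := by
    rw [← (toStable E).map_id]
    apply CategoryTheory.Quotient.sound
    obtain ⟨g, hg, hh⟩ := hE.suspMap_spec (𝟙 X)
    exact hE.stable_unique hg hh (f₁ := 𝟙 X) (g₁ := 𝟙 _) (by simp) (by simp)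
      (Congruence.equivalence.refl _)
  map_comp {X Y Z} f f₁ := by
    rw [← (toStable E).map_comp]
    apply CategoryTheory.Quotient.sound
    obtain ⟨g, hg, hh⟩ := hE.suspMap_spec f
    obtain ⟨g₁, hg₁, hh₁⟩ := hE.suspMap_spec f₁
    obtain ⟨g₂, hg₂, hh₂⟩ := hE.suspMap_spec (f ≫ f₁)
    refine hE.stable_unique hg₂ hh₂ (f₁ := f ≫ f₁) (g₁ := g ≫ g₁) ?_ ?_
      (Congruence.equivalence.refl _)
    · rw [← Category.assoc, hg, Category.assoc, hg₁, Category.assoc]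
    · rw [← Category.assoc, hh, Category.assoc, hh₁, Category.assoc]

/-- The suspension functor `Σ` of the stable category of a Frobenius category. -/
noncomputable def suspension : Stable E ⥤ Stable E :=
  CategoryTheory.Quotient.lift _ hE.preSuspension (fun X Y f f₁ hf => by
    apply CategoryTheory.Quotient.sound
    obtain ⟨g, hg, hh⟩ := hE.suspMap_spec f
    obtain ⟨g₁, hg₁, hh₁⟩ := hE.suspMap_spec f₁
    exact hE.stable_unique hg hh hg₁ hh₁ hf)

end IsFrobenius

end Exact

/-! ### Triangles -/

/-- A triangle `X ⟶ Y ⟶ Z ⟶ S(X)` in a category with an endofunctor `S`. -/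
structure Tri {D : Type u} [Category.{v} D] (S : D ⥤ D) where
  X : D
  Y : D
  Z : D
  f : X ⟶ Y
  g : Y ⟶ Z
  h : Z ⟶ S.obj X

/-- Two triangles are isomorphic. -/
def Tri.IsIsoTo {D : Type u} [Category.{v} D] {S : D ⥤ D} (t t₁ : Tri S) : Prop :=
  ∃ (a : t.X ≅ t₁.X) (b : t.Y ≅ t₁.Y) (c : t.Z ≅ t₁.Z),
    t.f ≫ b.hom = a.hom ≫ t₁.f ∧ t.g ≫ c.hom = b.hom ≫ t₁.g ∧
      t.h ≫ S.map a.hom = c.hom ≫ t₁.h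

/-- The image of a triangle under a functor `F` with a natural isomorphism `F S ≅ S₁ F`. -/
def Tri.map {D : Type u} [Category.{v} D] {D₁ : Type u'} [Category.{v'} D₁] {S : D ⥤ D}
    {S₁ : D₁ ⥤ D₁} (F : D ⥤ D₁) (α : S ⋙ F ≅ F ⋙ S₁) (t : Tri S) : Tri S₁ where
  X := F.obj t.X
  Y := F.obj t.Y
  Z := F.obj t.Z
  f := F.map t.f
  g := F.map t.g
  h := F.map t.h ≫ α.hom.app t.X

section Stable

variable {C : Type u} [Category.{v} C] [Preadditive C]

/-- The exact triangles of the stable category of a Frobenius category: those isomorphic to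
a standard triangle `X ⟶ Y ⟶ K ⟶ Σ(X)`, where `Y ⟶ K` is the pushout of `X ⟶ I(X)` along `f` and
`K ⟶ Σ(X)` is induced by `I(X) ⟶ Σ(X)` and the zero morphism on `Y`. -/
def IsFrobenius.Distinguished {E : ObjectProperty (ShortComplex C)} (hE : IsFrobenius E)
    (t : Tri hE.suspension) : Prop :=
  ∃ (X Y K : C) (f : X ⟶ Y) (k : Y ⟶ K) (c : (hE.hull X).I ⟶ K) (w : K ⟶ (hE.hull X).Z),
    IsPushout (hE.hull X).i f c k ∧ c ≫ w = (hE.hull X).p ∧ k ≫ w = 0 ∧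
      t.IsIsoTo
        { X := (toStable E).obj X
          Y := (toStable E).obj Y
          Z := (toStable E).obj K
          f := (toStable E).map f
          g := (toStable E).map k
          h := (toStable E).map w }

variable {D : Type u'} [Category.{v'} D] [Preadditive D]

/-- A functor is exact if it sends conflations to conflations. -/
def IsExactFunctor (F : C ⥤ D) [F.Additive] (E : ObjectProperty (ShortComplex C))
    (E₁ : ObjectProperty (ShortComplex D)) : Prop :=
  ∀ S : ShortComplex C, E S → E₁ (S.map F)

/-- The functor sends projective objects to projective objects. -/
def PreservesProj (F : C ⥤ D) (E : ObjectProperty (ShortComplex C))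
    (E₁ : ObjectProperty (ShortComplex D)) : Prop :=
  ∀ P : C, IsProj E P → IsProj E₁ (F.obj P)

/-- The functor between stable categories induced by an additive functor which preserves
projective objects. -/
def stableFunctor (F : C ⥤ D) [F.Additive] {E : ObjectProperty (ShortComplex C)}
    {E₁ : ObjectProperty (ShortComplex D)} (hF : PreservesProj F E E₁) : Stable E ⥤ Stable E₁ :=
  CategoryTheory.Quotient.lift _ (F ⋙ toStable E₁) (fun X Y f g h => by
    apply CategoryTheory.Quotient.sound
    change F.map f - F.map g ∈ projIdeal E₁ _ _
    rw [← F.map_sub]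
    have h : f - g ∈ projIdeal E X Y := h
    generalize f - g = e at h
    induction h using AddSubgroup.closure_induction with
    | mem f hf =>
      obtain ⟨P, a, b, hP, rfl⟩ := hf
      exact AddSubgroup.subset_closure ⟨_, F.map a, F.map b, hF P hP, by simp⟩
    | zero => simp [zero_mem]
    | add g₁ g₂ _ _ h₁ h₂ => simpa using add_mem h₁ h₂
    | neg g _ h => simpa using neg_mem h)

/-- The additive functor `F : (C, E) ⥤ (D, E₁)` is an exact functor between Frobenius categories
which preserves projective objects, and the induced triangle functor between the stable
categories is a triangle equivalence. The natural isomorphism `α : F Σ ≅ Σ F` is the canonical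
one: its value at `X` is represented by `b` for any morphism of conflations
`(𝟙, a, b)` from `F(X) ⟶ F(I(X)) ⟶ F(Σ(X))` to `F(X) ⟶ I(F(X)) ⟶ Σ(F(X))`. -/
def InducesTriangleEquivalence (F : C ⥤ D) [F.Additive] (E : ObjectProperty (ShortComplex C))
    (E₁ : ObjectProperty (ShortComplex D)) : Prop :=
  ∃ (hE : IsFrobenius E) (hE₁ : IsFrobenius E₁) (_ : IsExactFunctor F E E₁)
    (hF : PreservesProj F E E₁),
    (stableFunctor F hF).IsEquivalence ∧ (stableFunctor F hF).Additive ∧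
    ∃ α : hE.suspension ⋙ stableFunctor F hF ≅ stableFunctor F hF ⋙ hE₁.suspension,
      (∀ (X : C) (a : F.obj (hE.hull X).I ⟶ (hE₁.hull (F.obj X)).I)
        (b : F.obj (hE.hull X).Z ⟶ (hE₁.hull (F.obj X)).Z),
        F.map (hE.hull X).i ≫ a = (hE₁.hull (F.obj X)).i →
        F.map (hE.hull X).p ≫ b = a ≫ (hE₁.hull (F.obj X)).p →
        α.hom.app ((toStable E).obj X) = (toStable E₁).map b) ∧
      ∀ t : Tri hE.suspension, hE.Distinguished t →
        hE₁.Distinguished (t.map (stableFunctor F hF) α)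

/-- The conflations of the full subcategory on `P`: those of the ambient category, with all terms
in `P`. -/
def restrictConflations (E : ObjectProperty (ShortComplex C)) (P : ObjectProperty C) :
    ObjectProperty (@ShortComplex P.FullSubcategory _ Preadditive.preadditiveHasZeroMorphisms) :=
  fun S => E (S.map P.ι)

end Stable

/-! ### Factorizations -/

section Factorizations

variable {C : Type u} [Category.{v} C]

/-- `ω`-factorizations `X0 ⟶ X1 ⟶ T(X0)`. -/
structure Factorization (T : C ⥤ C) (ω : 𝟭 C ⟶ T) where
  X0 : C
  X1 : C
  d0 : X0 ⟶ X1
  d1 : X1 ⟶ T.obj X0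
  d0_d1 : d0 ≫ d1 = ω.app X0
  d1_d0 : d1 ≫ T.map d0 = ω.app X1

namespace Factorization

variable {T : C ⥤ C} {ω : 𝟭 C ⟶ T}

/-- Morphisms of `ω`-factorizations. -/
@[ext]
structure Hom (X Y : Factorization T ω) where
  f0 : X.X0 ⟶ Y.X0
  f1 : X.X1 ⟶ Y.X1
  comm0 : X.d0 ≫ f1 = f0 ≫ Y.d0
  comm1 : X.d1 ≫ T.map f0 = f1 ≫ Y.d1

instance : Category (Factorization T ω) where
  Hom := Hom
  id X := { f0 := 𝟙 _, f1 := 𝟙 _, comm0 := by simp, comm1 := by simp }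
  comp f g :=
    { f0 := f.f0 ≫ g.f0
      f1 := f.f1 ≫ g.f1
      comm0 := by rw [← Category.assoc, f.comm0, Category.assoc, g.comm0, Category.assoc]
      comm1 := by
        rw [T.map_comp, ← Category.assoc, f.comm1, Category.assoc, g.comm1, Category.assoc] }
  id_comp f := by apply Hom.ext <;> simp
  comp_id f := by apply Hom.ext <;> simp
  assoc f g h := by apply Hom.ext <;> simp

@[ext]
lemma hom_ext {X Y : Factorization T ω} {f g : X ⟶ Y} (h0 : f.f0 = g.f0) (h1 : f.f1 = g.f1) :
    f = g := Hom.ext h0 h1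

@[simp] lemma id_f0 (X : Factorization T ω) : Hom.f0 (𝟙 X) = 𝟙 X.X0 := rfl
@[simp] lemma id_f1 (X : Factorization T ω) : Hom.f1 (𝟙 X) = 𝟙 X.X1 := rfl
@[simp] lemma comp_f0 {X Y Z : Factorization T ω} (f : X ⟶ Y) (g : Y ⟶ Z) :
    (f ≫ g).f0 = f.f0 ≫ g.f0 := rfl
@[simp] lemma comp_f1 {X Y Z : Factorization T ω} (f : X ⟶ Y) (g : Y ⟶ Z) :
    (f ≫ g).f1 = f.f1 ≫ g.f1 := rfl

section Preadd

variable [Preadditive C] [T.Additive]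

instance (X Y : Factorization T ω) : Zero (X ⟶ Y) where
  zero := { f0 := 0, f1 := 0, comm0 := by simp, comm1 := by simp }

instance (X Y : Factorization T ω) : Add (X ⟶ Y) where
  add f g :=
    { f0 := f.f0 + g.f0
      f1 := f.f1 + g.f1
      comm0 := by simp [f.comm0, g.comm0]
      comm1 := by simp [T.map_add, f.comm1, g.comm1] }

instance (X Y : Factorization T ω) : Neg (X ⟶ Y) where
  neg f :=
    { f0 := -f.f0
      f1 := -f.f1
      comm0 := by simp [f.comm0]
      comm1 := by simp [T.map_neg, f.comm1] }

@[simp] lemma zero_f0 (X Y : Factorization T ω) : Hom.f0 (0 : X ⟶ Y) = 0 := rfl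
@[simp] lemma zero_f1 (X Y : Factorization T ω) : Hom.f1 (0 : X ⟶ Y) = 0 := rfl
@[simp] lemma add_f0 {X Y : Factorization T ω} (f g : X ⟶ Y) : (f + g).f0 = f.f0 + g.f0 := rfl
@[simp] lemma add_f1 {X Y : Factorization T ω} (f g : X ⟶ Y) : (f + g).f1 = f.f1 + g.f1 := rfl
@[simp] lemma neg_f0 {X Y : Factorization T ω} (f : X ⟶ Y) : (-f).f0 = -f.f0 := rfl
@[simp] lemma neg_f1 {X Y : Factorization T ω} (f : X ⟶ Y) : (-f).f1 = -f.f1 := rfl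

instance (X Y : Factorization T ω) : AddCommGroup (X ⟶ Y) where
  add_assoc f g h := by ext <;> simp [add_assoc]
  zero_add f := by ext <;> simp
  add_zero f := by ext <;> simp
  add_comm f g := by ext <;> simp [add_comm]
  neg_add_cancel f := by ext <;> simp
  nsmul := nsmulRec
  zsmul := zsmulRec

instance : Preadditive (Factorization T ω) where
  add_comp X Y Z f g h := by ext <;> simp
  comp_add X Y Z f g h := by ext <;> simp

end Preadd

/-- The projection functor `X ↦ X0`. -/
@[simps]
def pr0 (T : C ⥤ C) (ω : 𝟭 C ⟶ T) : Factorization T ω ⥤ C where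
  obj X := X.X0
  map f := f.f0

/-- The projection functor `X ↦ X1`. -/
@[simps]
def pr1 (T : C ⥤ C) (ω : 𝟭 C ⟶ T) : Factorization T ω ⥤ C where
  obj X := X.X1
  map f := f.f1

instance [Preadditive C] [T.Additive] : (pr0 T ω).Additive where
  map_add := rfl

instance [Preadditive C] [T.Additive] : (pr1 T ω).Additive where
  map_add := rfl

/-- The componentwise conflations of factorizations. -/
def conflations [Preadditive C] [T.Additive] (E : ObjectProperty (ShortComplex C)) :
    ObjectProperty (ShortComplex (Factorization T ω)) :=
  fun S => E (S.map (pr0 T ω)) ∧ E (S.map (pr1 T ω))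

/-- Factorizations whose components satisfy `P`. -/
def components (P : ObjectProperty C) : ObjectProperty (Factorization T ω) :=
  fun X => P X.X0 ∧ P X.X1

/-- `X` is a projective object of the exact category of factorizations with components in `P`,
where `P` carries the conflations induced by `E`. -/
def IsProjIn [Preadditive C] [T.Additive] (E : ObjectProperty (ShortComplex C))
    (P : ObjectProperty C) (X : Factorization T ω) : Prop :=
  ∃ hX : components P X,
    IsProj (restrictConflations (conflations E) (components P)) ⟨X, hX⟩

end Factorization

/-- Autoequivalences `T`, `T'` with natural transformations `ω : Id ⟶ T` and `ω' : Id ⟶ T'`, such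
that `ω'` commutes with `ω` via the natural isomorphism `ξ : T'T ≅ TT'`. (Composition of functors
is written diagrammatically.) -/
structure CommutingPair (C : Type u) [Category.{v} C] where
  T : C ⥤ C
  T' : C ⥤ C
  ω : 𝟭 C ⟶ T
  ω' : 𝟭 C ⟶ T'
  ξ : T ⋙ T' ≅ T' ⋙ T
  isEquivalence : T.IsEquivalence
  isEquivalence' : T'.IsEquivalence
  ω_T : ∀ X, ω.app (T.obj X) = T.map (ω.app X)
  ω'_T' : ∀ X, ω'.app (T'.obj X) = T'.map (ω'.app X)
  ω_T' : ∀ X, ω.app (T'.obj X) = T'.map (ω.app X) ≫ ξ.hom.app X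
  T_ω' : ∀ X, T.map (ω'.app X) = ω'.app (T.obj X) ≫ ξ.hom.app X

namespace CommutingPair

variable (K : CommutingPair C)

/-- The lift of `T'` to the category of `ω`-factorizations. -/
@[simps]
def liftT' : Factorization K.T K.ω ⥤ Factorization K.T K.ω where
  obj X :=
    { X0 := K.T'.obj X.X0
      X1 := K.T'.obj X.X1
      d0 := K.T'.map X.d0
      d1 := K.T'.map X.d1 ≫ K.ξ.hom.app X.X0
      d0_d1 := by
        rw [← Category.assoc, ← K.T'.map_comp, X.d0_d1, K.ω_T']
      d1_d0 := by
        have := K.ξ.hom.naturality X.d0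
        simp only [Functor.comp_map] at this
        rw [Category.assoc, ← this, ← Category.assoc, ← K.T'.map_comp, X.d1_d0, K.ω_T'] }
  map {X Y} f :=
    { f0 := K.T'.map f.f0
      f1 := K.T'.map f.f1
      comm0 := by
        change K.T'.map X.d0 ≫ K.T'.map f.f1 = K.T'.map f.f0 ≫ K.T'.map Y.d0
        rw [← K.T'.map_comp, f.comm0, K.T'.map_comp]
      comm1 := by
        have := K.ξ.hom.naturality f.f0
        simp only [Functor.comp_map] at this
        change (K.T'.map X.d1 ≫ K.ξ.hom.app X.X0) ≫ K.T.map (K.T'.map f.f0) =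
          K.T'.map f.f1 ≫ K.T'.map Y.d1 ≫ K.ξ.hom.app Y.X0
        rw [Category.assoc, ← this, ← Category.assoc, ← K.T'.map_comp, f.comm1,
          K.T'.map_comp, Category.assoc] }
  map_id X := by ext <;> simp
  map_comp f g := by ext <;> simp

/-- The lift of `ω'` to the category of `ω`-factorizations. -/
@[simps]
def liftω' : 𝟭 (Factorization K.T K.ω) ⟶ K.liftT' where
  app X :=
    { f0 := K.ω'.app X.X0
      f1 := K.ω'.app X.X1
      comm0 := K.ω'.naturality X.d0
      comm1 := by
        have := K.ω'.naturality X.d1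
        simp only [Functor.id_map] at this
        change X.d1 ≫ K.T.map (K.ω'.app X.X0) =
          K.ω'.app X.X1 ≫ K.T'.map X.d1 ≫ K.ξ.hom.app X.X0
        rw [K.T_ω', ← Category.assoc, ← Category.assoc, this] }
  naturality X Y f := by
    ext
    · exact K.ω'.naturality f.f0
    · exact K.ω'.naturality f.f1

/-- The category of two-dimensional factorizations, that is, of `ω'`-factorizations in
the category of `ω`-factorizations. For an object `X`, the components are
`X^{0,0} = X.X0.X0`, `X^{1,0} = X.X0.X1`, `X^{0,1} = X.X1.X0`, `X^{1,1} = X.X1.X1`; the lower row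
is `X.X0`, the upper row is `X.X1`, and the vertical morphisms are the components of
`X.d0` and `X.d1`. -/
abbrev Factorization₂ := Factorization K.liftT' K.liftω'

/-- The column `(X^{1,0}, X^{1,1})` of a two-dimensional factorization, as an
`ω'`-factorization. -/
def column1 (X : K.Factorization₂) : Factorization K.T' K.ω' where
  X0 := X.X0.X1
  X1 := X.X1.X1
  d0 := X.d0.f1
  d1 := X.d1.f1
  d0_d1 := congrArg Factorization.Hom.f1 X.d0_d1
  d1_d0 := congrArg Factorization.Hom.f1 X.d1_d0

section

variable [Preadditive C] [K.T.Additive] [K.T'.Additive]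

instance : K.liftT'.Additive where
  map_add {X Y f g} := by
    ext
    · exact K.T'.map_add
    · exact K.T'.map_add

/-- The two-dimensional factorizations `X` with components in `P` such that both one-dimensional
factorizations through `X^{1,1}`, namely the upper row `(X^{0,1}, X^{1,1})` and the column
`(X^{1,0}, X^{1,1})`, are projective objects in the exact categories of factorizations with
components in `P`. -/
def zeroZero (E : ObjectProperty (ShortComplex C)) (P : ObjectProperty C) :
    ObjectProperty K.Factorization₂ :=
  fun X => Factorization.components (Factorization.components P) X ∧
    Factorization.IsProjIn E P X.X1 ∧ Factorization.IsProjIn E P (K.column1 X)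

/-- The componentwise conflations of two-dimensional factorizations. -/
abbrev conflations₂ (E : ObjectProperty (ShortComplex C)) :
    ObjectProperty (ShortComplex K.Factorization₂) :=
  Factorization.conflations (Factorization.conflations E)

end

end CommutingPair

end Factorizations

/-! ### Gorenstein projective modules -/

section Modules

variable (R : Type u) [Ring R]

/-- The short exact sequences of `R`-modules. -/
def shortExact : ObjectProperty (ShortComplex (ModuleCat.{u} R)) := fun S => S.ShortExact

variable {R} in
/-- A totally acyclic complex of projective modules: it is acyclic, and so is its Hom complex to
any projective module. -/
structure IsTotallyAcyclic (P : CochainComplex (ModuleCat.{u} R) ℤ) : Prop where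
  projective : ∀ n, Projective (P.X n)
  acyclic : P.Acyclic
  hom_acyclic : ∀ (Q : ModuleCat.{u} R), Projective Q → ∀ (n : ℤ) (f : P.X n ⟶ Q),
    P.d (n - 1) n ≫ f = 0 → ∃ g : P.X (n + 1) ⟶ Q, P.d n (n + 1) ≫ g = f

/-- Gorenstein projective modules. -/
def GProj : ObjectProperty (ModuleCat.{u} R) := fun G =>
  ∃ P : CochainComplex (ModuleCat.{u} R) ℤ, IsTotallyAcyclic P ∧ Nonempty (G ≅ P.cycles 1)

/-- Finitely generated projective modules. -/
def fgProj : ObjectProperty (ModuleCat.{u} R) := fun M =>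
  Module.Finite R M ∧ Projective M

variable {R} in
/-- For a ring homomorphism `f : R → S`, the finitely generated Gorenstein projective `S`-modules
which have finite projective dimension as `R`-modules. -/
def fgGProjFinite {S : Type u} [Ring S] (f : R →+* S) : ObjectProperty (ModuleCat.{u} S) :=
  fun M => Module.Finite S M ∧ GProj S M ∧
    ∃ n : ℕ, HasProjectiveDimensionLT ((ModuleCat.restrictScalars.{u} f).obj M) n

end Modules

/-! ### Regular sequences of length two -/

section RegularSequences

/-- The element `w` is normal: `R w = w R`. -/
def IsNormalElement {R : Type u} [Ring R] (w : R) : Prop :=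
  Set.range (fun a : R => a * w) = Set.range (fun a : R => w * a)

variable {A : Type u} [Ring A]

/-- The two-sided ideal generated by a set, viewed as a left ideal. -/
abbrev twoSidedSpan (s : Set A) : Ideal A := (TwoSidedIdeal.span s).asIdeal

/-- `(ω', ω)` is a regular sequence: `ω'` is regular and normal in `A`, and the class of `ω` is
regular and normal in `A/(ω')`. -/
structure IsRegularSequence (ω' ω : A) : Prop where
  regular' : IsRegular ω'
  normal' : IsNormalElement ω'
  regular : IsRegular (Ideal.Quotient.mk (twoSidedSpan {ω'}) ω)
  normal : IsNormalElement (Ideal.Quotient.mk (twoSidedSpan {ω'}) ω)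

/-- The triple `(σ', σ; ξ)` is a type. -/
def IsType (σ' σ : A ≃+* A) (ξ : Aˣ) : Prop :=
  ∀ a : A, σ' (σ a) = ξ * σ (σ' a) * (ξ⁻¹ : Aˣ)

/-- The triple `(σ', σ; ξ)` is a type and `(ω', ω)` satisfies the compatibility conditions
of a sequence of this type. -/
structure IsOfType (ω' ω : A) (σ' σ : A ≃+* A) (ξ : Aˣ) : Prop where
  isType : IsType σ' σ ξ
  mul' : ∀ a, ω' * a = σ' a * ω'
  map' : σ' ω' = ω'
  mul : ∀ a, ω * a = σ a * ω
  map : σ ω = ω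
  map_ω : σ' ω = ξ * ω
  map_ω' : σ ω' = (ξ⁻¹ : Aˣ) * ω'

/-- The twisting functor: the module `^σ M` is `M` with `a` acting as `σ a`. -/
noncomputable abbrev twist (σ : A ≃+* A) : ModuleCat.{u} A ⥤ ModuleCat.{u} A :=
  ModuleCat.restrictScalars (σ : A →+* A)

/-- The natural transformation `Id ⟶ ^σ(-)`, `m ↦ w m`. -/
noncomputable def mulNat (w : A) (σ : A ≃+* A) (h : ∀ a, w * a = σ a * w) :
    𝟭 (ModuleCat.{u} A) ⟶ twist σ where
  app M := ModuleCat.ofHom (Y := (twist σ).obj M)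
    { toFun := fun m : M => (w • m : M)
      map_add' := fun m n => smul_add w m n
      map_smul' := fun a m => by
        change w • a • m = σ a • w • m
        rw [smul_smul, smul_smul, h] }
  naturality M N f := by
    ext m
    exact (f.hom.map_smul w m).symm

/-- The natural isomorphism from `^σ'(^σ(-))` to `^σ(^σ'(-))`, `m ↦ ξ m`. -/
noncomputable def xiIso {σ' σ : A ≃+* A} {ξ : Aˣ} (h : IsType σ' σ ξ) :
    twist σ ⋙ twist σ' ≅ twist σ' ⋙ twist σ where
  hom :=
    { app := fun M => ModuleCat.ofHom (X := (twist σ').obj ((twist σ).obj M))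
        (Y := (twist σ).obj ((twist σ').obj M))
        { toFun := fun m : M => ((ξ : A) • m : M)
          map_add' := fun m n => smul_add (M := A) (A := M) (ξ : A) m n
          map_smul' := fun a m => by
            have key : ∀ x : M, (ξ : A) • σ (σ' a) • x = σ' (σ a) • (ξ : A) • x := fun x => by
              rw [smul_smul, smul_smul, h a, mul_assoc, Units.inv_mul, mul_one]
            exact key m }
      naturality := fun M N f => by
        ext m
        exact (f.hom.map_smul (ξ : A) m).symm }
  inv :=
    { app := fun M => ModuleCat.ofHom (X := (twist σ).obj ((twist σ').obj M))
        (Y := (twist σ').obj ((twist σ).obj M))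
        { toFun := fun m : M => (((ξ⁻¹ : Aˣ) : A) • m : M)
          map_add' := fun m n => smul_add (M := A) (A := M) ((ξ⁻¹ : Aˣ) : A) m n
          map_smul' := fun a m => by
            have key : ∀ x : M, ((ξ⁻¹ : Aˣ) : A) • σ' (σ a) • x =
                σ (σ' a) • ((ξ⁻¹ : Aˣ) : A) • x := fun x => by
              rw [smul_smul, smul_smul, h a, ← mul_assoc, ← mul_assoc, Units.inv_mul, one_mul]
            exact key m }
      naturality := fun M N f => by
        ext m
        exact (f.hom.map_smul ((ξ⁻¹ : Aˣ) : A) m).symm }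
  hom_inv_id := by
    ext M m
    have key : ∀ x : M, ((ξ⁻¹ : Aˣ) : A) • (ξ : A) • x = x := fun x => by
      rw [smul_smul, Units.inv_mul, one_smul]
    exact key m
  inv_hom_id := by
    ext M m
    have key : ∀ x : M, (ξ : A) • ((ξ⁻¹ : Aˣ) : A) • x = x := fun x => by
      rw [smul_smul, Units.mul_inv, one_smul]
    exact key m

variable {ω' ω : A} {σ' σ : A ≃+* A} {ξ : Aˣ}

/-- The data on `A`-modules attached to a pair `(ω', ω)` of type `(σ', σ; ξ)`. -/
noncomputable def pairOfType (h : IsOfType ω' ω σ' σ ξ) : CommutingPair (ModuleCat.{u} A) where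
  T := twist σ
  T' := twist σ'
  ω := mulNat ω σ h.mul
  ω' := mulNat ω' σ' h.mul'
  ξ := xiIso h.isType
  isEquivalence := (ModuleCat.restrictScalarsEquivalenceOfRingEquiv σ).isEquivalence_functor
  isEquivalence' := (ModuleCat.restrictScalarsEquivalenceOfRingEquiv σ').isEquivalence_functor
  ω_T M := by
    ext m
    have key : ∀ x : M, σ ω • x = ω • x := fun x => by rw [h.map]
    exact key m
  ω'_T' M := by
    ext m
    have key : ∀ x : M, σ' ω' • x = ω' • x := fun x => by rw [h.map']
    exact key m
  ω_T' M := by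
    ext m
    have key : ∀ x : M, σ' ω • x = (ξ : A) • ω • x := fun x => by rw [h.map_ω, smul_smul]
    exact key m
  T_ω' M := by
    ext m
    have key : ∀ x : M, ω' • x = (ξ : A) • σ ω' • x := fun x => by
      rw [h.map_ω', smul_smul, ← mul_assoc, Units.mul_inv, one_mul]
    exact key m

instance (h : IsOfType ω' ω σ' σ ξ) : (pairOfType h).T.Additive :=
  inferInstanceAs (twist σ).Additive

instance (h : IsOfType ω' ω σ' σ ξ) : (pairOfType h).T'.Additive :=
  inferInstanceAs (twist σ').Additive

/-- The category of two-dimensional module factorizations. -/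
abbrev ModFactorization₂ (h : IsOfType ω' ω σ' σ ξ) := (pairOfType h).Factorization₂

/-- Two-dimensional module factorizations with Gorenstein projective components, such that
the factorizations through `X^{1,1}` are projective objects. -/
def GF00 (h : IsOfType ω' ω σ' σ ξ) : ObjectProperty (ModFactorization₂ h) :=
  (pairOfType h).zeroZero (shortExact A) (GProj A)

/-- Two-dimensional matrix factorizations (the components are finitely generated projective), such
that the factorizations through `X^{1,1}` are projective objects. -/
def MF00 (h : IsOfType ω' ω σ' σ ξ) : ObjectProperty (ModFactorization₂ h) :=
  (pairOfType h).zeroZero (shortExact A) (fgProj A)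

/-! ### The total cokernel -/

/-- The image of `(d_v^{1,0}, d_h^{0,1}) : X^{1,0} ⊕ X^{0,1} ⟶ X^{1,1}`. -/
def tcokRange (h : IsOfType ω' ω σ' σ ξ) (X : ModFactorization₂ h) : Submodule A X.X1.X1 :=
  LinearMap.range (LinearMap.coprod (ModuleCat.Hom.hom X.d0.f1) (ModuleCat.Hom.hom X.X1.d0))

lemma smul_mem_tcokRange (h : IsOfType ω' ω σ' σ ξ) (X : ModFactorization₂ h)
    (x : X.X1.X1) : ω • x ∈ tcokRange h X := by
  have h1 := congrArg (fun f => (ModuleCat.Hom.hom f) x) X.X1.d1_d0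
  refine ⟨(0, (X.X1.d1.hom x : X.X1.X0)), ?_⟩
  rw [LinearMap.coprod_apply, map_zero, zero_add]
  exact h1

lemma smul_mem_tcokRange' (h : IsOfType ω' ω σ' σ ξ) (X : ModFactorization₂ h)
    (x : X.X1.X1) : ω' • x ∈ tcokRange h X := by
  have h1 := congrArg (fun f => (ModuleCat.Hom.hom (Factorization.Hom.f1 f)) x) X.d1_d0
  refine ⟨((X.d1.f1.hom x : X.X0.X1), 0), ?_⟩
  rw [LinearMap.coprod_apply, map_zero, add_zero]
  exact h1

/-- A module annihilated by the generators is annihilated by the two-sided ideal. -/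
lemma isTorsionBySet_twoSidedSpan {M : Type u} [AddCommGroup M] [Module A M] (s : Set A)
    (hs : ∀ a ∈ s, ∀ x : M, a • x = 0) :
    Module.IsTorsionBySet A M (twoSidedSpan s) := by
  rintro x ⟨a, ha⟩
  have ha : a ∈ TwoSidedIdeal.span s := by simpa using ha
  rw [TwoSidedIdeal.mem_span_iff] at ha
  have := ha (TwoSidedIdeal.mk' {a : A | ∀ x : M, a • x = 0} (by simp)
    (fun {a b} ha hb x => by rw [add_smul, ha x, hb x, add_zero])
    (fun {a} ha x => by rw [neg_smul, ha x, neg_zero])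
    (fun {a b} hb x => by rw [mul_smul, hb x, smul_zero])
    (fun {a b} ha x => by rw [mul_smul, ha (b • x)])) (fun a ha => by
      simpa using hs a ha)
  have this : ∀ x : M, a • x = 0 := by simpa using this
  exact this x

lemma tcok_torsion (h : IsOfType ω' ω σ' σ ξ) (X : ModFactorization₂ h) :
    Module.IsTorsionBySet A (X.X1.X1 ⧸ tcokRange h X) (twoSidedSpan {ω, ω'}) := by
  apply isTorsionBySet_twoSidedSpan
  intro a ha x
  obtain ⟨x, rfl⟩ := Submodule.Quotient.mk_surjective _ x
  rw [← Submodule.Quotient.mk_smul, Submodule.Quotient.mk_eq_zero]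
  rcases ha with rfl | rfl
  · exact smul_mem_tcokRange h X x
  · exact smul_mem_tcokRange' h X x

/-- The total-cokernel as a module over `A/(ω, ω')`. -/
def tcokObj (h : IsOfType ω' ω σ' σ ξ) (X : ModFactorization₂ h) :
    ModuleCat.{u} (A ⧸ twoSidedSpan {ω, ω'}) :=
  letI := (tcok_torsion h X).module
  ModuleCat.of (A ⧸ twoSidedSpan {ω, ω'}) (X.X1.X1 ⧸ tcokRange h X)

lemma tcok_le (h : IsOfType ω' ω σ' σ ξ) {X Y : ModFactorization₂ h} (f : X ⟶ Y) :
    tcokRange h X ≤ (tcokRange h Y).comap (ModuleCat.Hom.hom f.f1.f1) := by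
  rintro _ ⟨⟨a, b⟩, rfl⟩
  have h1 := congrArg (fun g => (ModuleCat.Hom.hom (Factorization.Hom.f1 g)) a) f.comm0
  have h2 := congrArg (fun g => (ModuleCat.Hom.hom g) b) f.f1.comm0
  refine ⟨(f.f0.f1.hom a, f.f1.f0.hom b), ?_⟩
  simp only [LinearMap.coprod_apply, map_add]
  exact (congrArg₂ (· + ·) h1 h2).symm

/-- The map induced on total-cokernels. -/
def tcokMap (h : IsOfType ω' ω σ' σ ξ) {X Y : ModFactorization₂ h} (f : X ⟶ Y) :
    tcokObj h X ⟶ tcokObj h Y :=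
  letI := (tcok_torsion h X).module
  letI := (tcok_torsion h Y).module
  ModuleCat.ofHom
    { toFun := (tcokRange h X).mapQ (tcokRange h Y) (ModuleCat.Hom.hom f.f1.f1) (tcok_le h f)
      map_add' := fun x y => map_add _ x y
      map_smul' := fun b x => by
        obtain ⟨a, rfl⟩ := Ideal.Quotient.mk_surjective b
        exact map_smul ((tcokRange h X).mapQ (tcokRange h Y) (ModuleCat.Hom.hom f.f1.f1)
          (tcok_le h f)) a x }

/-- The total-cokernel functor. -/
def TCok (h : IsOfType ω' ω σ' σ ξ) :
    ModFactorization₂ h ⥤ ModuleCat.{u} (A ⧸ twoSidedSpan {ω, ω'}) where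
  obj X := tcokObj h X
  map f := tcokMap h f
  map_id X := by
    ext x
    obtain ⟨x, rfl⟩ := Submodule.Quotient.mk_surjective _ x
    rfl
  map_comp f g := by
    ext x
    obtain ⟨x, rfl⟩ := Submodule.Quotient.mk_surjective _ x
    rfl

instance (h : IsOfType ω' ω σ' σ ξ) : (TCok h).Additive where
  map_add {X Y f g} := by
    ext x
    obtain ⟨x, rfl⟩ := Submodule.Quotient.mk_surjective _ x
    rfl

instance {C : Type u} [Category.{v} C] [Preadditive C] {D : Type u'} [Category.{v'} D]
    [Preadditive D] (P : ObjectProperty C) (Q : ObjectProperty D) (F : C ⥤ D) [F.Additive]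
    (hF : ∀ X : P.FullSubcategory, Q ((P.ι ⋙ F).obj X)) : (Q.lift (P.ι ⋙ F) hF).Additive where
  map_add {X Y f g} := by
    ext
    exact (P.ι ⋙ F).map_add

end RegularSequences

end ModFac

/-!
The total-cokernel is the composite of two cokernels, one for each element of the regular sequence,
and the proof separates them. Write `A' = A/(ω')` and `B = A/(ω, ω')`.

*Exact structures.* All exact categories in question are full subcategories of weakly idempotent
complete exact categories. `IsFrobeniusClass` records closure properties of such a subcategory which
make it a Frobenius category whose projective objects are projective in the ambient category
(`IsFrobeniusClass.isFrobenius`). Frobenius classes pass from a category to its `ω`-factorizations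
(`Factorization.isFrobeniusClass`), the projective-injective objects being direct summands of sums
of the contractible factorizations `P = P ⟶ T(P)` and `P ⟶ T(P) = T(P)`. Applied twice, this
gives the two-dimensional factorizations. The condition on the row and the column through
`X^{1,1}` says that two exact functors take values in projective-injective objects, and such
a condition cuts out a Frobenius class again (`IsFrobeniusClass.inter_projInj`).

*Stable equivalence.* A full and dense exact functor between Frobenius categories which preserves
projective objects, and which kills only morphisms that factor through projective objects, induces
a triangle equivalence of stable categories (`inducesTriangleEquivalence_of_full`). The functor
`TCok` has all these properties already before stabilization.

*Full, and kernel.* Let `Q` be the cokernel of the lower row in the upper row. It is an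
`ω`-factorization of `A'`-modules `Q₀ ⟶ Q₁`, and `TCok(X)` is the cokernel of this monomorphism. As
the column through `X^{1,1}` is projective, `Q₁` is projective over `A'`, so that a morphism of
total-cokernels lifts to the `Q`'s, and it lifts further to two-dimensional factorizations because
the upper row is projective (`exists_hom_of_totalCokernel`). A morphism inducing zero on
total-cokernels factors through the sum of two factorizations, contractible in one direction each
(`exists_factor_of_totalCokernel_eq_zero`).

*Dense.* Conversely, let `Q₁ ⟶ N` be an epimorphism of `A'`-modules from a projective module to
a Gorenstein projective `B`-module, with kernel `Q₀`. Since `ω` annihilates `N`, the inclusion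
`Q₀ ⟶ Q₁` is part of an `ω`-factorization. A projective `ω`-factorization of `A`-modules covers it,
and since `ω'` annihilates `Q₀` and `Q₁`, the kernel of the covering is the lower row of
a two-dimensional factorization with total-cokernel `N` (`exists_tcok_iso`).

*Change of rings.* What remains is that these constructions respect Gorenstein projectivity. For
a regular normal element `w` of a ring `R` this is the statement that a cokernel of a monomorphism
of Gorenstein projective `R`-modules which is annihilated by `w` is Gorenstein projective over
`R/(w)` (`IsRegularQuotient.gproj_of_shortExact`), and that conversely the kernel of an epimorphism
from a Gorenstein projective `R`-module to a Gorenstein projective `R/(w)`-module is Gorenstein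
projective over `R` (`IsRegularQuotient.gproj_kernel`). The first one uses complete resolutions in
the Frobenius category of `w`-factorizations. For the second one, the vanishing of `Ext^1(Y, Q')`
for a syzygy `Y` of an `R/(w)`-module is proved by an explicit splitting
(`IsRegularQuotient.IsSyzygy.exists_retraction`). In the finitely generated case the components
are projective because a Gorenstein projective module of finite projective dimension is projective
(`GProj.projective`).
-/

namespace ModFac

/-! ### Exact categories -/

section ExactCategories

variable {C : Type u} [Category.{v} C] [Preadditive C]

/-- A kernel-cokernel pair, in terms of factorizations of morphisms. -/
lemma isKernelCokernelPair_of_lift_desc (S : ShortComplex C) (hf : Mono S.f) (hg : Epi S.g)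
    (lift : ∀ ⦃W : C⦄ (k : W ⟶ S.X₂), k ≫ S.g = 0 → ∃ l, l ≫ S.f = k)
    (desc : ∀ ⦃W : C⦄ (k : S.X₂ ⟶ W), S.f ≫ k = 0 → ∃ l, S.g ≫ l = k) :
    IsKernelCokernelPair S := by
  choose l hl using lift
  choose l' hl' using desc
  exact ⟨⟨KernelFork.IsLimit.ofι S.f S.zero (fun k hk => l k hk) (fun k hk => hl k hk)
      (fun k hk m hm => by rw [← cancel_mono S.f, hm, hl])⟩,
    ⟨CokernelCofork.IsColimit.ofπ S.g S.zero (fun k hk => l' k hk) (fun k hk => hl' k hk)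
      (fun k hk m hm => by rw [← cancel_epi S.g, hm, hl'])⟩⟩

namespace IsKernelCokernelPair

variable {S : ShortComplex C} (h : IsKernelCokernelPair S)
include h

lemma mono_f : Mono S.f := by
  obtain ⟨⟨hl⟩, -⟩ := h
  exact ⟨fun a b hab => Fork.IsLimit.hom_ext hl hab⟩

lemma epi_g : Epi S.g := by
  obtain ⟨-, ⟨hl⟩⟩ := h
  exact ⟨fun a b hab => Cofork.IsColimit.hom_ext hl hab⟩

lemma exists_lift {W : C} (k : W ⟶ S.X₂) (hk : k ≫ S.g = 0) : ∃ l, l ≫ S.f = k := by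
  obtain ⟨⟨hl⟩, -⟩ := h
  obtain ⟨l, h⟩ := KernelFork.IsLimit.lift' hl k hk
  exact ⟨l, h⟩

lemma exists_desc {W : C} (k : S.X₂ ⟶ W) (hk : S.f ≫ k = 0) : ∃ l, S.g ≫ l = k := by
  obtain ⟨-, ⟨hl⟩⟩ := h
  obtain ⟨l, h⟩ := CokernelCofork.IsColimit.desc' hl k hk
  exact ⟨l, h⟩

end IsKernelCokernelPair

namespace IsExactCategory

variable {E : ObjectProperty (ShortComplex C)} (hE : IsExactCategory E)
include hE

section

variable {X Y Z : C} {i : X ⟶ Y} {d : Y ⟶ Z} {w : i ≫ d = 0} (h : E (ShortComplex.mk i d w))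
include h

lemma mono_f : Mono i := (hE.kernelCokernel _ h).mono_f

lemma epi_g : Epi d := (hE.kernelCokernel _ h).epi_g

lemma exists_lift {W : C} (k : W ⟶ Y) (hk : k ≫ d = 0) : ∃ l, l ≫ i = k :=
  (hE.kernelCokernel _ h).exists_lift k hk

lemma exists_desc {W : C} (k : Y ⟶ W) (hk : i ≫ k = 0) : ∃ l, d ≫ l = k :=
  (hE.kernelCokernel _ h).exists_desc k hk

end

lemma epi_of_isDeflation {X Y : C} {i : X ⟶ Y} (h : IsDeflation E i) : Epi i := by
  obtain ⟨Z, d, w, h⟩ := h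
  exact hE.epi_g h

lemma of_iso {S S' : ShortComplex C} (e : S ≅ S') (h : E S) : E S' :=
  have := hE.isoClosed
  E.prop_of_iso e h

/-- Any kernel of a deflation completes it to a conflation. -/
lemma conflation_of_kernel {X Y Z : C} {i : X ⟶ Y} {d : Y ⟶ Z} (w : i ≫ d = 0)
    (hd : IsDeflation E d) (hi : Mono i)
    (lift : ∀ ⦃W : C⦄ (k : W ⟶ Y), k ≫ d = 0 → ∃ l, l ≫ i = k) : E (ShortComplex.mk i d w) := by
  obtain ⟨X', i', w', h⟩ := hd
  obtain ⟨a, ha⟩ := lift i' w'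
  obtain ⟨b, hb⟩ := hE.exists_lift h i w
  have := hE.mono_f h
  refine hE.of_iso (ShortComplex.isoMk (S₁ := ShortComplex.mk i' d w')
    ⟨a, b, ?_, ?_⟩ (Iso.refl _) (Iso.refl _) (by simpa using ha) (by simp)) h
  · rw [← cancel_mono i', Category.assoc, hb, ha, Category.id_comp]
  · rw [← cancel_mono i, Category.assoc, ha, hb, Category.id_comp]

/-- Any cokernel of an inflation completes it to a conflation. -/
lemma conflation_of_cokernel {X Y Z : C} {i : X ⟶ Y} {d : Y ⟶ Z} (w : i ≫ d = 0)
    (hi : IsInflation E i) (hd : Epi d)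
    (desc : ∀ ⦃W : C⦄ (k : Y ⟶ W), i ≫ k = 0 → ∃ l, d ≫ l = k) : E (ShortComplex.mk i d w) := by
  obtain ⟨Z', d', w', h⟩ := hi
  obtain ⟨a, ha⟩ := desc d' w'
  obtain ⟨b, hb⟩ := hE.exists_desc h d w
  have := hE.epi_g h
  refine hE.of_iso (ShortComplex.isoMk (S₁ := ShortComplex.mk i d' w')
    (Iso.refl _) (Iso.refl _) ⟨b, a, ?_, ?_⟩ (by simp) (by simpa using hb.symm)) h
  · rw [← cancel_epi d', ← Category.assoc, hb, ha, Category.comp_id]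
  · rw [← cancel_epi d, ← Category.assoc, ha, hb, Category.comp_id]

/-- A pullback of a deflation has the same kernel. -/
lemma conflation_of_isPullback {X Y Z Y₁ Z₁ : C} {i : X ⟶ Y} {d : Y ⟶ Z} {w : i ≫ d = 0}
    (h : E (ShortComplex.mk i d w)) {f₁ : Y₁ ⟶ Y} {d₁ : Y₁ ⟶ Z₁} {f : Z₁ ⟶ Z}
    (sq : IsPullback f₁ d₁ d f) (hd₁ : IsDeflation E d₁) :
    ∃ (i₁ : X ⟶ Y₁) (w₁ : i₁ ≫ d₁ = 0), i₁ ≫ f₁ = i ∧ E (ShortComplex.mk i₁ d₁ w₁) := by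
  refine ⟨sq.lift i 0 (by rw [w, zero_comp]), by simp, by simp, ?_⟩
  have hi := hE.mono_f h
  refine hE.conflation_of_kernel _ hd₁ ?_ ?_
  · have : Mono (sq.lift i 0 (by rw [w, zero_comp]) ≫ f₁) := by simpa using hi
    exact mono_of_mono _ f₁
  · intro W k hk
    obtain ⟨l, hl⟩ := hE.exists_lift h (k ≫ f₁) (by
      rw [Category.assoc, sq.w, ← Category.assoc, hk, zero_comp])
    exact ⟨l, sq.hom_ext (by simpa using hl) (by simp [hk])⟩

/-- A pushout of an inflation has the same cokernel. -/
lemma conflation_of_isPushout {X Y Z X₁ Y₁ : C} {i : X ⟶ Y} {d : Y ⟶ Z} {w : i ≫ d = 0}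
    (h : E (ShortComplex.mk i d w)) {f : X ⟶ X₁} {f₁ : Y ⟶ Y₁} {i₁ : X₁ ⟶ Y₁}
    (sq : IsPushout i f f₁ i₁) (hi₁ : IsInflation E i₁) :
    ∃ (d₁ : Y₁ ⟶ Z) (w₁ : i₁ ≫ d₁ = 0), f₁ ≫ d₁ = d ∧ E (ShortComplex.mk i₁ d₁ w₁) := by
  refine ⟨sq.desc d 0 (by rw [w, comp_zero]), by simp, by simp, ?_⟩
  have hi := hE.epi_g h
  refine hE.conflation_of_cokernel _ hi₁ ?_ ?_
  · have : Epi (f₁ ≫ sq.desc d 0 (by rw [w, comp_zero])) := by simpa using hi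
    exact epi_of_epi f₁ _
  · intro W k hk
    obtain ⟨l, hl⟩ := hE.exists_desc h (f₁ ≫ k) (by
      rw [← Category.assoc, sq.w, Category.assoc, hk, comp_zero])
    exact ⟨l, sq.hom_ext (by simpa using hl) (by simp [hk])⟩

/-- The inflation in any pushout square of an inflation is an inflation. -/
lemma isInflation_of_isPushout {X Y X₁ Y₁ : C} {i : X ⟶ Y} (h : IsInflation E i)
    {f : X ⟶ X₁} {f₁ : Y ⟶ Y₁} {i₁ : X₁ ⟶ Y₁} (sq : IsPushout i f f₁ i₁) : IsInflation E i₁ := by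
  obtain ⟨Y₂, f₂, i₂, sq₂, h₂⟩ := hE.ex2_op i f h
  obtain ⟨Z, d, w, h₂⟩ := h₂
  let e := sq₂.isoIsPushout _ _ sq
  have he : i₂ ≫ e.hom = i₁ := by simp [e]
  have he' : i₁ ≫ e.inv = i₂ := by simp [e]
  refine ⟨Z, e.inv ≫ d, by rw [← Category.assoc, he', w], ?_⟩
  exact hE.of_iso (ShortComplex.isoMk (S₁ := ShortComplex.mk i₂ d w) (Iso.refl _) e (Iso.refl _)
    (by simp [he]) (by simp)) h₂

/-- The short five lemma for morphisms of conflations with identity ends. -/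
lemma isIso_of_conflations {X Y Y' Z : C} {i : X ⟶ Y} {d : Y ⟶ Z} {w : i ≫ d = 0}
    (h : E (ShortComplex.mk i d w)) {i' : X ⟶ Y'} {d' : Y' ⟶ Z} {w' : i' ≫ d' = 0}
    (h' : E (ShortComplex.mk i' d' w')) (m : Y ⟶ Y') (hm : i ≫ m = i') (hm' : m ≫ d' = d) :
    IsIso m := by
  have mi := hE.mono_f h
  have mi' := hE.mono_f h'
  have hmono : Mono m := by
    refine Preadditive.mono_of_cancel_zero _ (fun {W} x hx => ?_)
    have hxd : x ≫ d = 0 := by rw [← hm', ← Category.assoc, hx, zero_comp]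
    obtain ⟨y, rfl⟩ := hE.exists_lift h x hxd
    rw [Category.assoc, hm] at hx
    rw [zero_of_comp_mono _ hx, zero_comp]
  -- `L` is the fibre product of `Y` and `Y'` over `Z`; the composite of the projection to `Y`
  -- with `m` differs from the projection to `Y'` by a morphism to the kernel `X`.
  obtain ⟨L, l, l₀, sq, hl₀⟩ := hE.ex2 d' d ⟨_, _, _, h'⟩
  obtain ⟨L', l', l₀', sq', hl'⟩ := hE.ex2 d d' ⟨_, _, _, h⟩
  let e := sq.flip.isoIsPullback _ _ sq'
  obtain ⟨j, wj, hj, hE'⟩ := hE.conflation_of_isPullback h sq' hl'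
  have he : e.inv ≫ l = l₀' := by simp [e]
  have he' : e.inv ≫ l₀ = l' := by simp [e]
  have epl : Epi l₀' := hE.epi_of_isDeflation hl'
  obtain ⟨y, hy⟩ := hE.exists_lift h' (l₀' - l' ≫ m) (by
    rw [Preadditive.sub_comp, Category.assoc, hm', sq'.w, sub_self])
  have hjy : j ≫ y = - 𝟙 X := by
    rw [← cancel_mono i', Category.assoc, hy, Preadditive.comp_sub, wj, ← Category.assoc, hj, hm]
    simp
  obtain ⟨r, hr⟩ := hE.exists_desc hE' (l' + y ≫ i) (by
    rw [Preadditive.comp_add, hj, ← Category.assoc, hjy]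
    simp)
  have hrm : r ≫ m = 𝟙 _ := by
    rw [← cancel_epi l₀', ← Category.assoc, hr, Preadditive.add_comp, Category.assoc, hm, hy]
    simp
  exact ⟨r, by rw [← cancel_mono m, Category.assoc, hrm]; simp, hrm⟩

/-- A morphism of conflations with identity right end is a pushout square. -/
lemma isPushout_of_conflations {X Y Z X' Y' : C} {i : X ⟶ Y} {d : Y ⟶ Z} {w : i ≫ d = 0}
    (h : E (ShortComplex.mk i d w)) {i' : X' ⟶ Y'} {d' : Y' ⟶ Z} {w' : i' ≫ d' = 0}
    (h' : E (ShortComplex.mk i' d' w')) (f : X ⟶ X') (g : Y ⟶ Y') (hf : i ≫ g = f ≫ i')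
    (hg : g ≫ d' = d) : IsPushout i f g i' := by
  obtain ⟨Y₂, f₂, i₂, sq₂, h₂⟩ := hE.ex2_op i f ⟨_, _, _, h⟩
  obtain ⟨d₂, w₂, hd₂, hE₂⟩ := hE.conflation_of_isPushout h sq₂ h₂
  have := hE.isIso_of_conflations hE₂ h' (sq₂.desc g i' hf) (by simp)
    (sq₂.hom_ext (by simp [hg, hd₂]) (by simp [w', w₂]))
  exact IsPushout.of_iso sq₂ (Iso.refl _) (Iso.refl _) (Iso.refl _)
    (asIso (sq₂.desc g i' hf)) (by simp) (by simp) (by simp) (by simp)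

end IsExactCategory

/-- The exact structure `E` is weakly idempotent complete: the second factor of a deflation is a
deflation, and the first factor of an inflation is an inflation. -/
structure IsWICExactCategory (E : ObjectProperty (ShortComplex C)) : Prop
    extends IsExactCategory E where
  deflation_of_comp : ∀ {X Y Z : C} (f : X ⟶ Y) (g : Y ⟶ Z),
    IsDeflation E (f ≫ g) → IsDeflation E g
  inflation_of_comp : ∀ {X Y Z : C} (f : X ⟶ Y) (g : Y ⟶ Z),
    IsInflation E (f ≫ g) → IsInflation E f

namespace IsWICExactCategory

variable {E : ObjectProperty (ShortComplex C)} (hE : IsWICExactCategory E)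
include hE

lemma isDeflation_id (X : C) : IsDeflation E (𝟙 X) := by
  have := hE.hasFiniteBiproducts
  have : HasZeroObject C := hasZeroObject_of_hasFiniteBiproducts C
  obtain ⟨Z, hZ⟩ := HasZeroObject.zero (C := C)
  obtain ⟨Y, f, d, -, hd⟩ := hE.ex2 (𝟙 Z) (0 : X ⟶ Z) (hE.ex0 Z hZ)
  exact hE.deflation_of_comp d (𝟙 X) (by rwa [Category.comp_id])

lemma isDeflation_of_split {X Y : C} (f : X ⟶ Y) (s : Y ⟶ X) (h : s ≫ f = 𝟙 Y) :
    IsDeflation E f :=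
  hE.deflation_of_comp s f (h ▸ hE.isDeflation_id Y)

lemma biprod_conflation [HasBinaryBiproducts C] (X Y : C) :
    E (ShortComplex.mk (biprod.inl : X ⟶ X ⊞ Y) biprod.snd biprod.inl_snd) :=
  hE.conflation_of_kernel (i := biprod.inl) (d := biprod.snd) biprod.inl_snd
    (hE.isDeflation_of_split _ biprod.inr biprod.inr_snd) inferInstance
    (fun W k hk => ⟨k ≫ biprod.fst, by apply biprod.hom_ext <;> simp [hk]⟩)

end IsWICExactCategory

/-! ### Extension-closed subcategories with enough projective-injective objects -/

/-- `Q` is injective with respect to the conflations with terms in `P`. -/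
def IsInjRel (E : ObjectProperty (ShortComplex C)) (P : ObjectProperty C) (Q : C) : Prop :=
  ∀ S : ShortComplex C, E S → P S.X₁ → P S.X₂ → P S.X₃ → ∀ h : S.X₁ ⟶ Q, ∃ k, S.f ≫ k = h

/-- The objects of `P` that are projective in the ambient exact category and injective relative
to the conflations with terms in `P`. -/
structure IsProjInj (E : ObjectProperty (ShortComplex C)) (P : ObjectProperty C) (Q : C) :
    Prop where
  mem : P Q
  proj : IsProj E Q
  inj : IsInjRel E P Q

/-- The class `P` is closed under extensions and kernels of deflations, it contains the cokernel
of an inflation `f` as soon as it contains that of some composite inflation `f ≫ g`, and it has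
enough projective-injective objects. These are required to be projective in the ambient category,
and not only relative to `P`, in order that coverings of arbitrary objects can be built from
them. -/
structure IsFrobeniusClass (E : ObjectProperty (ShortComplex C)) (P : ObjectProperty C) :
    Prop where
  zero : ∀ Z, IsZero Z → P Z
  iso : P.IsClosedUnderIsomorphisms
  ext : ∀ S, E S → P S.X₁ → P S.X₃ → P S.X₂
  ker : ∀ S, E S → P S.X₂ → P S.X₃ → P S.X₁
  coker : ∀ {X Y W Z Z' : C} (f : X ⟶ Y) (g : Y ⟶ W) (p : Y ⟶ Z) (q : W ⟶ Z') (w : f ≫ p = 0)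
    (w' : (f ≫ g) ≫ q = 0), E (ShortComplex.mk f p w) → E (ShortComplex.mk (f ≫ g) q w') →
    P X → P Y → P W → P Z' → P Z
  enoughProj : ∀ X, P X → ∃ (Q : C) (d : Q ⟶ X), IsDeflation E d ∧ IsProjInj E P Q
  enoughInj : ∀ X, P X → ∃ (Q Z : C) (i : X ⟶ Q) (p : Q ⟶ Z) (w : i ≫ p = 0),
    E (ShortComplex.mk i p w) ∧ P Z ∧ IsProjInj E P Q

lemma IsProj.lift {E : ObjectProperty (ShortComplex C)} {P : C} (hP : IsProj E P) {X Y Z : C}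
    {i : X ⟶ Y} {d : Y ⟶ Z} {w : i ≫ d = 0} (h : E (ShortComplex.mk i d w)) (f : P ⟶ Z) :
    ∃ k, k ≫ d = f := hP _ h f

lemma IsInj.extend {E : ObjectProperty (ShortComplex C)} {I : C} (hI : IsInj E I) {X Y Z : C}
    {i : X ⟶ Y} {d : Y ⟶ Z} {w : i ≫ d = 0} (h : E (ShortComplex.mk i d w)) (f : X ⟶ I) :
    ∃ k, i ≫ k = f := hI _ h f

lemma IsInjRel.extend {E : ObjectProperty (ShortComplex C)} {P : ObjectProperty C} {I : C}
    (hI : IsInjRel E P I) {X Y Z : C} {i : X ⟶ Y} {d : Y ⟶ Z} {w : i ≫ d = 0}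
    (h : E (ShortComplex.mk i d w)) (hX : P X) (hY : P Y) (hZ : P Z) (f : X ⟶ I) :
    ∃ k, i ≫ k = f := hI _ h hX hY hZ f

lemma IsProj.of_retract {E : ObjectProperty (ShortComplex C)} {P Q : C} (hQ : IsProj E Q)
    (i : P ⟶ Q) (r : Q ⟶ P) (h : i ≫ r = 𝟙 P) : IsProj E P := by
  intro S hS f
  obtain ⟨k, hk⟩ := hQ S hS (r ≫ f)
  exact ⟨i ≫ k, by rw [Category.assoc, hk, ← Category.assoc, h, Category.id_comp]⟩

lemma IsInjRel.of_retract {E : ObjectProperty (ShortComplex C)} {P : ObjectProperty C} {I Q : C}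
    (hQ : IsInjRel E P Q) (i : I ⟶ Q) (r : Q ⟶ I) (h : i ≫ r = 𝟙 I) : IsInjRel E P I := by
  intro S hS h₁ h₂ h₃ f
  obtain ⟨k, hk⟩ := hQ S hS h₁ h₂ h₃ (f ≫ i)
  exact ⟨k ≫ r, by rw [← Category.assoc, hk, Category.assoc, h, Category.comp_id]⟩

lemma IsProj.exists_lift {E : ObjectProperty (ShortComplex C)} {P X Y : C} (hP : IsProj E P)
    {d : X ⟶ Y} (hd : IsDeflation E d) (f : P ⟶ Y) : ∃ k, k ≫ d = f := by
  obtain ⟨Z, i, w, h⟩ := hd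
  exact hP _ h f

lemma hasFiniteBiproducts_of_total (Z : C) (hZ : IsZero Z)
    (h : ∀ X Y : C, ∃ b : BinaryBicone X Y, b.fst ≫ b.inl + b.snd ≫ b.inr = 𝟙 b.pt) :
    HasFiniteBiproducts C := by
  have : HasBinaryBiproducts C := ⟨fun X Y => by
    obtain ⟨b, hb⟩ := h X Y
    exact hasBinaryBiproduct_of_total b hb⟩
  have : HasTerminal C := IsTerminal.hasTerminal hZ.isTerminal
  have := hasFiniteProducts_of_has_binary_and_terminal (C := C)
  exact HasFiniteBiproducts.of_hasFiniteProducts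

namespace IsFrobeniusClass

variable {E : ObjectProperty (ShortComplex C)} {P : ObjectProperty C}

lemma of_iso (hP : IsFrobeniusClass E P) {X Y : C} (e : X ≅ Y) (h : P X) : P Y :=
  have := hP.iso
  P.prop_of_iso e h

lemma isDeflation_restrict_iff (hP : IsFrobeniusClass E P) {X Y : P.FullSubcategory} (d : X ⟶ Y) :
    IsDeflation (restrictConflations E P) d ↔ IsDeflation E d.hom := by
  constructor
  · rintro ⟨Z, i, w, h⟩
    exact ⟨Z.obj, i.hom, _, h⟩
  · rintro ⟨Z, i, w, h⟩
    exact ⟨⟨Z, hP.ker _ h X.property Y.property⟩, ObjectProperty.homMk i,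
      P.hom_ext w, h⟩

lemma isInflation_restrict_iff {X Y : P.FullSubcategory} (i : X ⟶ Y) :
    IsInflation (restrictConflations E P) i ↔
      ∃ (Z : C) (d : Y.obj ⟶ Z) (w : i.hom ≫ d = 0), E (ShortComplex.mk i.hom d w) ∧ P Z := by
  constructor
  · rintro ⟨Z, d, w, h⟩
    exact ⟨Z.obj, d.hom, _, h, Z.property⟩
  · rintro ⟨Z, d, w, h, hZ⟩
    exact ⟨⟨Z, hZ⟩, ObjectProperty.homMk d, P.hom_ext w, h⟩

lemma isProj_restrict {Q : C} (hQ : IsProj E Q) (h : P Q) :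
    IsProj (restrictConflations E P) ⟨Q, h⟩ := by
  intro S hS f
  obtain ⟨k, hk⟩ := hQ _ hS f.hom
  exact ⟨ObjectProperty.homMk k, P.hom_ext hk⟩

lemma isInj_restrict {Q : C} (hQ : IsInjRel E P Q) (h : P Q) :
    IsInj (restrictConflations E P) ⟨Q, h⟩ := by
  intro S hS f
  obtain ⟨k, hk⟩ := hQ _ hS S.X₁.property S.X₂.property S.X₃.property f.hom
  exact ⟨ObjectProperty.homMk k, P.hom_ext hk⟩

/-- The projective objects of the subcategory `P` are the objects that are projective in
the ambient category; they are also injective in `P`. -/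
lemma isProjInj_of_isProj (hP : IsFrobeniusClass E P) {Q : P.FullSubcategory}
    (hQ : IsProj (restrictConflations E P) Q) :
    IsProjInj E P Q.obj := by
  obtain ⟨Q', d, hd, h⟩ := hP.enoughProj _ Q.property
  obtain ⟨s, hs⟩ := hQ.exists_lift (X := ⟨Q', h.mem⟩)
    ((hP.isDeflation_restrict_iff (X := ⟨Q', h.mem⟩) (ObjectProperty.homMk d)).2 hd) (𝟙 Q)
  have hs : s.hom ≫ d = 𝟙 _ := congrArg InducedCategory.Hom.hom hs
  exact ⟨Q.property, h.proj.of_retract _ _ hs, h.inj.of_retract _ _ hs⟩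

lemma isProjInj_of_isInj (hP : IsFrobeniusClass E P) {Q : P.FullSubcategory}
    (hQ : IsInj (restrictConflations E P) Q) :
    IsProjInj E P Q.obj := by
  obtain ⟨Q', Z, i, p, w, hi, hZ, h⟩ := hP.enoughInj _ Q.property
  obtain ⟨s, hs⟩ := hQ (ShortComplex.mk (X₂ := ⟨Q', h.mem⟩) (X₃ := ⟨Z, hZ⟩)
    (ObjectProperty.homMk i) (ObjectProperty.homMk p) (P.hom_ext w)) hi (𝟙 Q)
  have hs : i ≫ s.hom = 𝟙 _ := congrArg InducedCategory.Hom.hom hs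
  exact ⟨Q.property, h.proj.of_retract _ _ hs, h.inj.of_retract _ _ hs⟩

variable (hE : IsWICExactCategory E) (hP : IsFrobeniusClass E P)
include hE hP

lemma biprod_mem [HasBinaryBiproducts C] {X Y : C} (hX : P X) (hY : P Y) : P (X ⊞ Y) :=
  hP.ext _ (hE.biprod_conflation X Y) hX hY

lemma hasFiniteBiproducts : HasFiniteBiproducts P.FullSubcategory := by
  have := hE.hasFiniteBiproducts
  have : HasZeroObject C := hasZeroObject_of_hasFiniteBiproducts C
  have := hasBinaryBiproducts_of_finite_biproducts C
  obtain ⟨Z, hZ⟩ := HasZeroObject.zero (C := C)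
  refine hasFiniteBiproducts_of_total (⟨Z, hP.zero Z hZ⟩ : P.FullSubcategory)
    ((IsZero.iff_id_eq_zero _).2 (P.hom_ext (hZ.eq_of_src _ _))) (fun X Y => ?_)
  refine ⟨{ pt := ⟨X.obj ⊞ Y.obj, biprod_mem hE hP X.property Y.property⟩
            fst := ObjectProperty.homMk biprod.fst
            snd := ObjectProperty.homMk biprod.snd
            inl := ObjectProperty.homMk biprod.inl
            inr := ObjectProperty.homMk biprod.inr
            inl_fst := P.hom_ext (by simp)
            inl_snd := P.hom_ext (by simp)
            inr_fst := P.hom_ext (by simp)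
            inr_snd := P.hom_ext (by simp) }, P.hom_ext ?_⟩
  exact biprod.total

/-- An extension-closed subcategory of an exact category is exact. -/
lemma isExactCategory : IsExactCategory (restrictConflations E P) where
  hasFiniteBiproducts := hasFiniteBiproducts hE hP
  isoClosed := ⟨fun e h => hE.of_iso (P.ι.mapShortComplex.mapIso e) h⟩
  kernelCokernel S hS := by
    refine isKernelCokernelPair_of_lift_desc S (P.ι.mono_of_mono_map (hE.mono_f hS))
      (P.ι.epi_of_epi_map (hE.epi_g hS)) (fun W k hk => ?_) (fun W k hk => ?_)
    · obtain ⟨l, hl⟩ := hE.exists_lift hS k.hom (congrArg InducedCategory.Hom.hom hk)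
      exact ⟨ObjectProperty.homMk l, P.hom_ext hl⟩
    · obtain ⟨l, hl⟩ := hE.exists_desc hS k.hom (congrArg InducedCategory.Hom.hom hk)
      exact ⟨ObjectProperty.homMk l, P.hom_ext hl⟩
  ex0 Z _ := (hP.isDeflation_restrict_iff _).2 (hE.isDeflation_id _)
  ex1 d e hd he := (hP.isDeflation_restrict_iff _).2
    (hE.ex1 d.hom e.hom ((hP.isDeflation_restrict_iff _).1 hd)
      ((hP.isDeflation_restrict_iff _).1 he))
  ex1_op {X Y Z} i j hi hj := by
    obtain ⟨A, p, w, hA, hPA⟩ := (isInflation_restrict_iff i).1 hi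
    obtain ⟨B, q, w', hB, hPB⟩ := (isInflation_restrict_iff j).1 hj
    -- The cokernel of `i ≫ j` is the pushout of `j` along the cokernel of `i`, so it is
    -- an extension of the cokernel of `j` by that of `i`.
    obtain ⟨K, f, i', sq, hi'⟩ := hE.ex2_op j.hom p ⟨_, _, _, hB⟩
    obtain ⟨q', w'', -, hK⟩ := hE.conflation_of_isPushout hB sq hi'
    have hp : Epi p := hE.epi_g hA
    have w₁ : (i.hom ≫ j.hom) ≫ f = 0 := by
      rw [Category.assoc, sq.w, ← Category.assoc, w, zero_comp]
    refine (isInflation_restrict_iff _).2 ⟨K, f, w₁, ?_, hP.ext _ hK hPA hPB⟩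
    refine hE.conflation_of_cokernel _ (hE.ex1_op _ _ ⟨_, _, _, hA⟩ ⟨_, _, _, hB⟩) ?_ ?_
    · refine ⟨fun {W} a b hab => sq.hom_ext hab ?_⟩
      have hab : f ≫ a = f ≫ b := hab
      rw [← cancel_epi p, ← Category.assoc, ← sq.w, Category.assoc, hab, ← Category.assoc, sq.w,
        Category.assoc]
    · intro W k hk
      dsimp at k hk
      obtain ⟨l, hl⟩ := hE.exists_desc hA (j.hom ≫ k) (by simpa using hk)
      exact ⟨sq.desc k l hl.symm, by simp⟩
  ex2 {Y Z Z₁} d f hd := by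
    obtain ⟨X, i, w, h⟩ := (hP.isDeflation_restrict_iff _).1 hd
    obtain ⟨Y₁, f₁, d₁, sq, hd₁⟩ := hE.ex2 d.hom f.hom ⟨_, _, _, h⟩
    obtain ⟨i₁, w₁, -, h₁⟩ := hE.conflation_of_isPullback h sq hd₁
    have hX : P X := hP.ker _ h Y.property Z.property
    have hY₁ : P Y₁ := hP.ext _ h₁ hX Z₁.property
    exact ⟨⟨Y₁, hY₁⟩, ObjectProperty.homMk f₁, ObjectProperty.homMk d₁, IsPullback.of_map P.ι
      (P.hom_ext sq.w) sq, (hP.isDeflation_restrict_iff _).2 hd₁⟩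
  ex2_op {X Y X₁} i f hi := by
    obtain ⟨Z, d, w, h, hZ⟩ := (isInflation_restrict_iff _).1 hi
    obtain ⟨Y₁, f₁, i₁, sq, hi₁⟩ := hE.ex2_op i.hom f.hom ⟨_, _, _, h⟩
    obtain ⟨d₁, w₁, -, h₁⟩ := hE.conflation_of_isPushout h sq hi₁
    have hY₁ : P Y₁ := hP.ext _ h₁ X₁.property hZ
    exact ⟨⟨Y₁, hY₁⟩, ObjectProperty.homMk f₁, ObjectProperty.homMk i₁, IsPushout.of_map P.ι
      (P.hom_ext sq.w) sq, (isInflation_restrict_iff _).2 ⟨Z, d₁, w₁, h₁, hZ⟩⟩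

/-- The exact category defined by a Frobenius class is a Frobenius category. -/
theorem isFrobenius : IsFrobenius (restrictConflations E P) where
  exact := isExactCategory hE hP
  enoughProj X := by
    obtain ⟨Q, d, hd, h⟩ := hP.enoughProj _ X.property
    exact ⟨⟨Q, h.mem⟩, ObjectProperty.homMk d, isProj_restrict h.proj h.mem,
      (hP.isDeflation_restrict_iff _).2 hd⟩
  enoughInj X := by
    obtain ⟨Q, Z, i, p, w, hi, hZ, h⟩ := hP.enoughInj _ X.property
    exact ⟨{
      I := ⟨Q, h.mem⟩
      Z := ⟨Z, hZ⟩
      i := ObjectProperty.homMk i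
      p := ObjectProperty.homMk p
      w := P.hom_ext w
      conflation := hi
      inj := isInj_restrict h.inj h.mem }⟩
  proj_iff_inj X := by
    constructor
    · intro h
      have := hP.isProjInj_of_isProj h
      exact isInj_restrict this.inj this.mem
    · intro h
      have := hP.isProjInj_of_isInj h
      exact isProj_restrict this.proj this.mem

end IsFrobeniusClass

end ExactCategories

/-! ### Stable equivalences induced by full and dense exact functors -/

section StableEquivalence

variable {C : Type u} [Category.{v} C] [Preadditive C] {E : ObjectProperty (ShortComplex C)}

lemma mem_projIdeal_of_factor {X Y P : C} (a : X ⟶ P) (b : P ⟶ Y) (hP : IsProj E P) :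
    a ≫ b ∈ projIdeal E X Y :=
  AddSubgroup.subset_closure ⟨P, a, b, hP, rfl⟩

lemma toStable_map_eq_iff {X Y : C} (f g : X ⟶ Y) :
    (toStable E).map f = (toStable E).map g ↔ f - g ∈ projIdeal E X Y :=
  CategoryTheory.Quotient.functor_map_eq_iff (stableRel E) f g

/-- Two morphisms of conflations with the same left component have right components that agree
in the stable category as soon as the middle term of the target is projective. -/
lemma IsExactCategory.toStable_map_eq (hE : IsExactCategory E) {X Y Z X' Y' Z' : C} {i : X ⟶ Y}
    {d : Y ⟶ Z} {w : i ≫ d = 0} (h : E (ShortComplex.mk i d w)) {i' : X' ⟶ Y'} {d' : Y' ⟶ Z'}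
    (hI : IsProj E Y') {φ : X ⟶ X'} {a a₁ : Y ⟶ Y'} {b b₁ : Z ⟶ Z'}
    (ha : i ≫ a = φ ≫ i') (hb : d ≫ b = a ≫ d') (ha₁ : i ≫ a₁ = φ ≫ i') (hb₁ : d ≫ b₁ = a₁ ≫ d') :
    (toStable E).map b = (toStable E).map b₁ := by
  rw [toStable_map_eq_iff]
  obtain ⟨t, ht⟩ := hE.exists_desc h (a - a₁) (by rw [Preadditive.comp_sub, ha, ha₁, sub_self])
  have := hE.epi_g h
  have key : b - b₁ = t ≫ d' := by
    rw [← cancel_epi d, ← Category.assoc, ht, Preadditive.comp_sub, Preadditive.sub_comp, hb, hb₁]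
  rw [key]
  exact mem_projIdeal_of_factor _ _ hI

lemma IsExactFunctor.map_conflation {D : Type u'} [Category.{v'} D] [Preadditive D]
    {E₁ : ObjectProperty (ShortComplex D)} {F : C ⥤ D} [F.Additive] (hF : IsExactFunctor F E E₁)
    {X Y Z : C} {i : X ⟶ Y} {d : Y ⟶ Z} {w : i ≫ d = 0} (h : E (ShortComplex.mk i d w)) :
    ∃ w' : F.map i ≫ F.map d = 0, E₁ (ShortComplex.mk (F.map i) (F.map d) w') :=
  ⟨_, hF _ h⟩

variable {D : Type u'} [Category.{v'} D] [Preadditive D] {E₁ : ObjectProperty (ShortComplex D)}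
  (F : C ⥤ D) [F.Additive]

variable (hE : IsFrobenius E) (hE₁ : IsFrobenius E₁) (hex : IsExactFunctor F E E₁)
  (hpr : PreservesProj F E E₁)

include hex in
lemma exists_hull_comparison (X : C) :
    ∃ (a : F.obj (hE.hull X).I ⟶ (hE₁.hull (F.obj X)).I)
      (b : F.obj (hE.hull X).Z ⟶ (hE₁.hull (F.obj X)).Z),
      F.map (hE.hull X).i ≫ a = (hE₁.hull (F.obj X)).i ∧
      F.map (hE.hull X).p ≫ b = a ≫ (hE₁.hull (F.obj X)).p := by
  obtain ⟨w, hS⟩ := hex.map_conflation (hE.hull X).conflation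
  obtain ⟨a, ha⟩ := (hE₁.hull (F.obj X)).inj.extend hS (hE₁.hull (F.obj X)).i
  obtain ⟨b, hb⟩ := hE₁.exact.exists_desc hS (a ≫ (hE₁.hull (F.obj X)).p) (by
    rw [← Category.assoc, ha, (hE₁.hull (F.obj X)).w])
  exact ⟨a, b, ha, hb⟩

include hpr in
lemma exists_hull_comparison_inv (X : C) :
    ∃ (a : (hE₁.hull (F.obj X)).I ⟶ F.obj (hE.hull X).I)
      (b : (hE₁.hull (F.obj X)).Z ⟶ F.obj (hE.hull X).Z),
      (hE₁.hull (F.obj X)).i ≫ a = F.map (hE.hull X).i ∧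
      (hE₁.hull (F.obj X)).p ≫ b = a ≫ F.map (hE.hull X).p := by
  obtain ⟨a, ha⟩ := ((hE₁.proj_iff_inj _).1 (hpr _ ((hE.proj_iff_inj _).2 (hE.hull X).inj))).extend
    (hE₁.hull (F.obj X)).conflation
    (F.map (hE.hull X).i)
  obtain ⟨b, hb⟩ := hE₁.exact.exists_desc (hE₁.hull (F.obj X)).conflation
    (a ≫ F.map (hE.hull X).p) (by
      rw [← Category.assoc, ha, ← F.map_comp, (hE.hull X).w, F.map_zero])
  exact ⟨a, b, ha, hb⟩

/-- The canonical isomorphism `F(Σ(X)) ≅ Σ(F(X))` in the stable category. -/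
noncomputable def suspensionCompIso (X : C) :
    (toStable E₁).obj (F.obj (hE.hull X).Z) ≅ (toStable E₁).obj (hE₁.hull (F.obj X)).Z where
  hom := (toStable E₁).map (exists_hull_comparison F hE hE₁ hex X).choose_spec.choose
  inv := (toStable E₁).map (exists_hull_comparison_inv F hE hE₁ hpr X).choose_spec.choose
  hom_inv_id := by
    have h := (exists_hull_comparison F hE hE₁ hex X).choose_spec.choose_spec
    have h' := (exists_hull_comparison_inv F hE hE₁ hpr X).choose_spec.choose_spec
    rw [← Functor.map_comp, ← (toStable E₁).map_id]
    refine hE₁.exact.toStable_map_eq 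
      (hex.map_conflation (hE.hull X).conflation).choose_spec
        (hpr _ ((hE.proj_iff_inj _).2 (hE.hull X).inj))
      (i' := F.map (hE.hull X).i) (d' := F.map (hE.hull X).p) (φ := 𝟙 _)
      (a := (exists_hull_comparison F hE hE₁ hex X).choose ≫
        (exists_hull_comparison_inv F hE hE₁ hpr X).choose)
      (a₁ := 𝟙 _) ?_ ?_ (by simp) (by simp)
    · rw [← Category.assoc, h.1, h'.1, Category.id_comp]
    · rw [← Category.assoc, h.2, Category.assoc, h'.2, Category.assoc]
  inv_hom_id := by
    have h := (exists_hull_comparison F hE hE₁ hex X).choose_spec.choose_spec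
    have h' := (exists_hull_comparison_inv F hE hE₁ hpr X).choose_spec.choose_spec
    rw [← Functor.map_comp, ← (toStable E₁).map_id]
    refine hE₁.exact.toStable_map_eq (hE₁.hull (F.obj X)).conflation
      ((hE₁.proj_iff_inj _).2 (hE₁.hull (F.obj X)).inj)
      (i' := (hE₁.hull (F.obj X)).i) (d' := (hE₁.hull (F.obj X)).p) (φ := 𝟙 _)
      (a := (exists_hull_comparison_inv F hE hE₁ hpr X).choose ≫
        (exists_hull_comparison F hE hE₁ hex X).choose)
      (a₁ := 𝟙 _) ?_ ?_ (by simp) (by simp)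
    · rw [← Category.assoc, h'.1, h.1, Category.id_comp]
    · rw [← Category.assoc, h'.2, Category.assoc, h.2, Category.assoc]

lemma suspensionCompIso_hom (X : C) (a : F.obj (hE.hull X).I ⟶ (hE₁.hull (F.obj X)).I)
    (b : F.obj (hE.hull X).Z ⟶ (hE₁.hull (F.obj X)).Z)
    (ha : F.map (hE.hull X).i ≫ a = (hE₁.hull (F.obj X)).i)
    (hb : F.map (hE.hull X).p ≫ b = a ≫ (hE₁.hull (F.obj X)).p) :
    (suspensionCompIso F hE hE₁ hex hpr X).hom = (toStable E₁).map b := by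
  have h := (exists_hull_comparison F hE hE₁ hex X).choose_spec.choose_spec
  exact hE₁.exact.toStable_map_eq
    (hex.map_conflation (hE.hull X).conflation).choose_spec
    ((hE₁.proj_iff_inj _).2 (hE₁.hull (F.obj X)).inj)
    (i' := (hE₁.hull (F.obj X)).i) (d' := (hE₁.hull (F.obj X)).p) (φ := 𝟙 _)
    (by simpa using h.1) h.2 (by simpa using ha) hb

/-- The canonical natural isomorphism `F Σ ≅ Σ F` between stable categories. -/
noncomputable def suspensionCompNatIso :
    hE.suspension ⋙ stableFunctor F hpr ≅ stableFunctor F hpr ⋙ hE₁.suspension :=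
  NatIso.ofComponents (fun X => suspensionCompIso F hE hE₁ hex hpr X.as) (by
    rintro ⟨X⟩ ⟨Y⟩ f
    obtain ⟨f, rfl⟩ := (toStable E).map_surjective f
    obtain ⟨a, b, ha, hb⟩ := exists_hull_comparison F hE hE₁ hex X
    obtain ⟨a', b', ha', hb'⟩ := exists_hull_comparison F hE hE₁ hex Y
    obtain ⟨g, hg, hh⟩ := hE.suspMap_spec f
    obtain ⟨g₁, hg₁, hh₁⟩ := hE₁.suspMap_spec (F.map f)
    change (toStable E₁).map (F.map (hE.suspMap f)) ≫ (suspensionCompIso F hE hE₁ hex hpr Y).hom =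
      (suspensionCompIso F hE hE₁ hex hpr X).hom ≫ (toStable E₁).map (hE₁.suspMap (F.map f))
    rw [suspensionCompIso_hom F hE hE₁ hex hpr X a b ha hb,
      suspensionCompIso_hom F hE hE₁ hex hpr Y a' b' ha' hb', ← Functor.map_comp,
      ← Functor.map_comp]
    refine hE₁.exact.toStable_map_eq
      (hex.map_conflation (hE.hull X).conflation).choose_spec
      ((hE₁.proj_iff_inj _).2 (hE₁.hull (F.obj Y)).inj)
      (i' := (hE₁.hull (F.obj Y)).i) (d' := (hE₁.hull (F.obj Y)).p) (φ := F.map f)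
        (a := F.map g ≫ a') (a₁ := a ≫ g₁) ?_ ?_ ?_ ?_
    · rw [← Category.assoc, ← F.map_comp, hg, F.map_comp, Category.assoc, ha']
    · rw [← Category.assoc, ← F.map_comp, hh, F.map_comp, Category.assoc, hb', Category.assoc]
    · rw [← Category.assoc, ha, hg₁]
    · rw [← Category.assoc, hb, Category.assoc, hh₁, Category.assoc])

/-- In the stable category of a Frobenius category, a morphism between two pushouts of injective
hulls of the same object is invertible if it is the identity on the common part. -/
lemma isIso_toStable_of_pushouts {X Y I I' Z Z' K K' : D} {i : X ⟶ I} {p : I ⟶ Z} {w : i ≫ p = 0}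
    (hi : E₁ (ShortComplex.mk i p w)) {i' : X ⟶ I'} {p' : I' ⟶ Z'} {w' : i' ≫ p' = 0}
    (hi' : E₁ (ShortComplex.mk i' p' w')) (hI : IsProj E₁ I) (hI' : IsProj E₁ I')
    {f : X ⟶ Y} {c : I ⟶ K} {k : Y ⟶ K} (sq : IsPushout i f c k)
    {c' : I' ⟶ K'} {k' : Y ⟶ K'} (sq' : IsPushout i' f c' k') (hE₁ : IsFrobenius E₁)
    (a : I ⟶ I') (ha : i ≫ a = i') (m : K ⟶ K') (hm : c ≫ m = a ≫ c') (hm' : k ≫ m = k') :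
    IsIso ((toStable E₁).map m) := by
  obtain ⟨a', ha'⟩ := ((hE₁.proj_iff_inj _).1 hI).extend hi' i
  let m' : K' ⟶ K := sq'.desc (a' ≫ c) k (by rw [← Category.assoc, ha', sq.w])
  -- A loop on one of the pushouts which is the identity on `Y` differs from the identity by
  -- a morphism through the injective hull.
  have key : ∀ {I Z K : D} {i : X ⟶ I} {p : I ⟶ Z} {w : i ≫ p = 0}
      (hi : E₁ (ShortComplex.mk i p w)) (hI : IsProj E₁ I) {c : I ⟶ K} {k : Y ⟶ K}
      (sq : IsPushout i f c k) (e : I ⟶ I) (he : i ≫ e = i) (n : K ⟶ K) (hn : c ≫ n = e ≫ c)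
      (hn' : k ≫ n = k), (toStable E₁).map n = 𝟙 _ := by
    intro I Z K i p w hi hI c k sq e he n hn hn'
    rw [← (toStable E₁).map_id, toStable_map_eq_iff]
    obtain ⟨r, hr⟩ := hE₁.exact.exists_desc hi (e - 𝟙 _) (by
      rw [Preadditive.comp_sub, he, Category.comp_id, sub_self])
    have : n - 𝟙 K = sq.desc p 0 (by rw [w, comp_zero]) ≫ r ≫ c := by
      apply sq.hom_ext
      · rw [← Category.assoc, sq.inl_desc, ← Category.assoc, hr, Preadditive.comp_sub,
          Preadditive.sub_comp, hn]
        simp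
      · rw [← Category.assoc, sq.inr_desc, Preadditive.comp_sub, hn']
        simp
    rw [this, ← Category.assoc]
    exact mem_projIdeal_of_factor _ _ hI
  refine ⟨(toStable E₁).map m', ?_, ?_⟩
  · rw [← Functor.map_comp]
    refine key hi hI sq (a ≫ a') (by rw [← Category.assoc, ha, ha']) _ ?_ ?_
    · rw [← Category.assoc, hm, Category.assoc, sq'.inl_desc, Category.assoc]
    · rw [← Category.assoc, hm', sq'.inr_desc]
  · rw [← Functor.map_comp]
    refine key hi' hI' sq' (a' ≫ a) (by rw [← Category.assoc, ha', ha]) _ ?_ ?_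
    · rw [← Category.assoc, sq'.inl_desc, Category.assoc, hm, Category.assoc]
    · rw [← Category.assoc, sq'.inr_desc, hm']

lemma Tri.IsIsoTo.trans {C : Type u} [Category.{v} C] {S : C ⥤ C} {t t₁ t₂ : Tri S}
    (h : t.IsIsoTo t₁) (h' : t₁.IsIsoTo t₂) : t.IsIsoTo t₂ := by
  obtain ⟨a, b, c, h₁, h₂, h₃⟩ := h
  obtain ⟨a', b', c', h₁', h₂', h₃'⟩ := h'
  refine ⟨a ≪≫ a', b ≪≫ b', c ≪≫ c', ?_, ?_, ?_⟩
  · rw [Iso.trans_hom, ← Category.assoc, h₁, Category.assoc, h₁', Iso.trans_hom, Category.assoc]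
  · rw [Iso.trans_hom, ← Category.assoc, h₂, Category.assoc, h₂', Iso.trans_hom, Category.assoc]
  · rw [Iso.trans_hom, S.map_comp, ← Category.assoc, h₃, Category.assoc, h₃', Iso.trans_hom,
      Category.assoc]

lemma Tri.IsIsoTo.map {C : Type u} [Category.{v} C] {D : Type u'} [Category.{v'} D] {S : C ⥤ C}
    {S₁ : D ⥤ D} (F : C ⥤ D) (α : S ⋙ F ≅ F ⋙ S₁) {t t₁ : Tri S} (h : t.IsIsoTo t₁) :
    (t.map F α).IsIsoTo (t₁.map F α) := by
  obtain ⟨a, b, c, h₁, h₂, h₃⟩ := h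
  refine ⟨F.mapIso a, F.mapIso b, F.mapIso c, ?_, ?_, ?_⟩
  · exact (F.map_comp _ _).symm.trans ((congrArg F.map h₁).trans (F.map_comp _ _))
  · exact (F.map_comp _ _).symm.trans ((congrArg F.map h₂).trans (F.map_comp _ _))
  · have := α.hom.naturality a.hom
    dsimp at this
    simp only [Tri.map, Functor.mapIso_hom, Category.assoc]
    rw [← this, ← Category.assoc, ← F.map_comp, h₃, F.map_comp, Category.assoc]

lemma distinguished_map (t : Tri hE.suspension) (ht : hE.Distinguished t) :
    hE₁.Distinguished (t.map (stableFunctor F hpr) (suspensionCompNatIso F hE hE₁ hex hpr)) := by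
  obtain ⟨X, Y, K, f, k, c, w, sq, hw, hw', ht⟩ := ht
  -- The image of the pushout square is again a pushout square.
  obtain ⟨w₀, hkw₀, hw₀, hK⟩ := hE.exact.conflation_of_isPushout (hE.hull X).conflation sq
    (hE.exact.isInflation_of_isPushout ⟨_, _, _, (hE.hull X).conflation⟩ sq)
  obtain rfl : w = w₀ := sq.hom_ext (hw.trans hw₀.symm) (hw'.trans hkw₀.symm)
  have sqF : IsPushout (F.map (hE.hull X).i) (F.map f) (F.map c) (F.map k) :=
    hE₁.exact.isPushout_of_conflations (hex.map_conflation (hE.hull X).conflation).choose_spec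
      (hex.map_conflation hK).choose_spec _ _
      (by rw [← F.map_comp, sq.w, F.map_comp]) (by rw [← F.map_comp, hw])
  obtain ⟨K', c', k', sq', -⟩ := hE₁.exact.ex2_op (hE₁.hull (F.obj X)).i (F.map f)
    ⟨_, _, _, (hE₁.hull (F.obj X)).conflation⟩
  obtain ⟨a, b, ha, hb⟩ := exists_hull_comparison F hE hE₁ hex X
  let w' : K' ⟶ (hE₁.hull (F.obj X)).Z := sq'.desc (hE₁.hull (F.obj X)).p 0 (by
    rw [(hE₁.hull (F.obj X)).w, comp_zero])
  let m : F.obj K ⟶ K' := sqF.desc (a ≫ c') k' (by rw [← Category.assoc, ha, sq'.w])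
  have hm : IsIso ((toStable E₁).map m) :=
    isIso_toStable_of_pushouts (hex.map_conflation (hE.hull X).conflation).choose_spec
      (hE₁.hull (F.obj X)).conflation
      (hpr _ ((hE.proj_iff_inj _).2 (hE.hull X).inj))
      ((hE₁.proj_iff_inj _).2 (hE₁.hull (F.obj X)).inj) sqF sq' hE₁ a ha m
      (sqF.inl_desc _ _ _) (sqF.inr_desc _ _ _)
  refine ⟨F.obj X, F.obj Y, K', F.map f, k', c', w', sq', sq'.inl_desc _ _ _, sq'.inr_desc _ _ _,
    (ht.map _ _).trans ⟨Iso.refl _, Iso.refl _, @asIso _ _ _ _ _ hm, ?_, ?_, ?_⟩⟩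
  · exact (Category.comp_id _).trans (Category.id_comp _).symm
  · refine Eq.trans ?_ (Category.id_comp _).symm
    change (toStable E₁).map (F.map k) ≫ (toStable E₁).map m = (toStable E₁).map k'
    rw [← Functor.map_comp, sqF.inr_desc]
  · change ((toStable E₁).map (F.map w) ≫ (suspensionCompIso F hE hE₁ hex hpr X).hom) ≫
      hE₁.suspension.map (𝟙 _) = (toStable E₁).map m ≫ (toStable E₁).map w'
    refine (congrArg _ (hE₁.suspension.map_id _)).trans ((Category.comp_id _).trans ?_)
    rw [suspensionCompIso_hom F hE hE₁ hex hpr X a b ha hb, ← Functor.map_comp, ← Functor.map_comp]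
    congr 1
    apply sqF.hom_ext
    · rw [← Category.assoc, ← F.map_comp, hw, hb, ← Category.assoc, sqF.inl_desc, Category.assoc,
        sq'.inl_desc]
    · rw [← Category.assoc, ← F.map_comp, hw', F.map_zero, zero_comp, ← Category.assoc,
        sqF.inr_desc, sq'.inr_desc]

include hex hE in
/-- If `F` is full and dense, every morphism `F(X) ⟶ F(Y)` which factors through a projective
object is the image of a morphism which factors through a projective object. -/
lemma exists_preimage_mem_projIdeal (hfull : F.Full) (hdense : F.EssSurj) {X Y : C}
    {e : F.obj X ⟶ F.obj Y} (he : e ∈ projIdeal E₁ (F.obj X) (F.obj Y)) :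
    ∃ f ∈ projIdeal E X Y, F.map f = e := by
  induction he using AddSubgroup.closure_induction with
  | mem e he =>
    obtain ⟨P, a, b, hP, rfl⟩ := he
    obtain ⟨Q, d, hQ, K, i, w, hd⟩ := hE.enoughProj (F.objPreimage P)
    obtain ⟨s, hs⟩ := hP.lift (hex.map_conflation hd).choose_spec (F.objObjPreimageIso P).inv
    obtain ⟨a', ha'⟩ := F.map_surjective (a ≫ s)
    obtain ⟨b', hb'⟩ := F.map_surjective (F.map d ≫ (F.objObjPreimageIso P).hom ≫ b)
    refine ⟨a' ≫ b', mem_projIdeal_of_factor _ _ hQ, ?_⟩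
    rw [F.map_comp, ha', hb', Category.assoc, reassoc_of% hs]
    simp
  | zero => exact ⟨0, zero_mem _, F.map_zero _ _⟩
  | add e₁ e₂ _ _ h₁ h₂ =>
    obtain ⟨f₁, hf₁, rfl⟩ := h₁
    obtain ⟨f₂, hf₂, rfl⟩ := h₂
    exact ⟨f₁ + f₂, add_mem hf₁ hf₂, F.map_add⟩
  | neg e _ h =>
    obtain ⟨f, hf, rfl⟩ := h
    exact ⟨-f, neg_mem hf, F.map_neg⟩

include hE hE₁ hex hpr in
/-- A full and dense exact functor between Frobenius categories, which preserves projective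
objects and only kills morphisms factoring through projective objects, induces an equivalence of
triangulated categories between the stable categories. -/
theorem inducesTriangleEquivalence_of_full (hfull : F.Full) (hdense : F.EssSurj)
    (hker : ∀ {X Y : C} (f : X ⟶ Y), F.map f = 0 → f ∈ projIdeal E X Y) :
    InducesTriangleEquivalence F E E₁ := by
  refine ⟨hE, hE₁, hex, hpr, ?_, ?_, suspensionCompNatIso F hE hE₁ hex hpr, ?_, ?_⟩
  · have : (stableFunctor F hpr).Full := ⟨by
      rintro ⟨X⟩ ⟨Y⟩ g
      obtain ⟨g, rfl⟩ := (toStable E₁).map_surjective g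
      obtain ⟨f, rfl⟩ := F.map_surjective g
      exact ⟨(toStable E).map f, rfl⟩⟩
    have : (stableFunctor F hpr).EssSurj := ⟨by
      rintro ⟨Y⟩
      exact ⟨(toStable E).obj (F.objPreimage Y),
        ⟨(toStable E₁).mapIso (F.objObjPreimageIso Y)⟩⟩⟩
    have : (stableFunctor F hpr).Faithful := ⟨by
      rintro ⟨X⟩ ⟨Y⟩ f g h
      obtain ⟨f, rfl⟩ := (toStable E).map_surjective f
      obtain ⟨g, rfl⟩ := (toStable E).map_surjective g
      have h : (toStable E₁).map (F.map f) = (toStable E₁).map (F.map g) := h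
      rw [toStable_map_eq_iff, ← F.map_sub] at h
      obtain ⟨e, he, he'⟩ := exists_preimage_mem_projIdeal F hE hex hfull hdense h
      have := hker (f - g - e) (by rw [F.map_sub, he', sub_self])
      rw [toStable_map_eq_iff]
      simpa using add_mem this he⟩
    exact { }
  · exact ⟨by
      rintro ⟨X⟩ ⟨Y⟩ f g
      obtain ⟨f, rfl⟩ := (toStable E).map_surjective f
      obtain ⟨g, rfl⟩ := (toStable E).map_surjective g
      change (toStable E₁).map (F.map (f + g)) = _
      rw [F.map_add]
      rfl⟩
  · intro X a b ha hb
    exact suspensionCompIso_hom F hE hE₁ hex hpr X a b ha hb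
  · exact distinguished_map F hE hE₁ hex hpr

end StableEquivalence

/-! ### The exact category of factorizations -/

namespace Factorization

section

variable {C : Type u} [Category.{v} C] {T : C ⥤ C} {ω : 𝟭 C ⟶ T}

lemma naturality_ω {X Y : C} (f : X ⟶ Y) : f ≫ ω.app Y = ω.app X ≫ T.map f := ω.naturality f

lemma isPullback_of_components [T.IsEquivalence] {P X Y Z : Factorization T ω} {fst : P ⟶ X}
    {snd : P ⟶ Y} {f : X ⟶ Z} {g : Y ⟶ Z} (h₀ : IsPullback fst.f0 snd.f0 f.f0 g.f0)
    (h₁ : IsPullback fst.f1 snd.f1 f.f1 g.f1) : IsPullback fst snd f g := by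
  refine ⟨⟨hom_ext h₀.w h₁.w⟩, ⟨PullbackCone.IsLimit.mk _ (fun s =>
    { f0 := h₀.lift s.fst.f0 s.snd.f0 (congrArg Hom.f0 s.condition)
      f1 := h₁.lift s.fst.f1 s.snd.f1 (congrArg Hom.f1 s.condition)
      comm0 := ?_
      comm1 := ?_ }) (fun s => ?_) (fun s => ?_) (fun s m hm hm' => ?_)⟩⟩
  · apply h₁.hom_ext
    · rw [Category.assoc, h₁.lift_fst, s.fst.comm0, Category.assoc, fst.comm0, ← Category.assoc,
        h₀.lift_fst]
    · rw [Category.assoc, h₁.lift_snd, s.snd.comm0, Category.assoc, snd.comm0, ← Category.assoc,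
        h₀.lift_snd]
  · apply (h₀.map T).hom_ext
    · rw [Category.assoc, ← T.map_comp, h₀.lift_fst, s.fst.comm1, Category.assoc, fst.comm1,
        ← Category.assoc, h₁.lift_fst]
    · rw [Category.assoc, ← T.map_comp, h₀.lift_snd, s.snd.comm1, Category.assoc, snd.comm1,
        ← Category.assoc, h₁.lift_snd]
  · exact hom_ext (h₀.lift_fst _ _ _) (h₁.lift_fst _ _ _)
  · exact hom_ext (h₀.lift_snd _ _ _) (h₁.lift_snd _ _ _)
  · refine hom_ext (h₀.hom_ext ?_ ?_) (h₁.hom_ext ?_ ?_)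
    · rw [h₀.lift_fst, ← hm, comp_f0]
    · rw [h₀.lift_snd, ← hm', comp_f0]
    · rw [h₁.lift_fst, ← hm, comp_f1]
    · rw [h₁.lift_snd, ← hm', comp_f1]

lemma isPushout_of_components [T.IsEquivalence] {X Y Z P : Factorization T ω} {f : Z ⟶ X}
    {g : Z ⟶ Y} {inl : X ⟶ P} {inr : Y ⟶ P} (h₀ : IsPushout f.f0 g.f0 inl.f0 inr.f0)
    (h₁ : IsPushout f.f1 g.f1 inl.f1 inr.f1) : IsPushout f g inl inr := by
  refine ⟨⟨hom_ext h₀.w h₁.w⟩, ⟨PushoutCocone.IsColimit.mk _ (fun s =>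
    { f0 := h₀.desc s.inl.f0 s.inr.f0 (congrArg Hom.f0 s.condition)
      f1 := h₁.desc s.inl.f1 s.inr.f1 (congrArg Hom.f1 s.condition)
      comm0 := ?_
      comm1 := ?_ }) (fun s => ?_) (fun s => ?_) (fun s m hm hm' => ?_)⟩⟩
  · apply h₀.hom_ext
    · rw [← Category.assoc, inl.comm0.symm, Category.assoc, h₁.inl_desc, s.inl.comm0,
        ← Category.assoc, h₀.inl_desc]
    · rw [← Category.assoc, inr.comm0.symm, Category.assoc, h₁.inr_desc, s.inr.comm0,
        ← Category.assoc, h₀.inr_desc]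
  · apply h₁.hom_ext
    · rw [← Category.assoc, ← inl.comm1, Category.assoc, ← T.map_comp, h₀.inl_desc, s.inl.comm1,
        ← Category.assoc, h₁.inl_desc]
    · rw [← Category.assoc, ← inr.comm1, Category.assoc, ← T.map_comp, h₀.inr_desc, s.inr.comm1,
        ← Category.assoc, h₁.inr_desc]
  · exact hom_ext (h₀.inl_desc _ _ _) (h₁.inl_desc _ _ _)
  · exact hom_ext (h₀.inr_desc _ _ _) (h₁.inr_desc _ _ _)
  · refine hom_ext (h₀.hom_ext ?_ ?_) (h₁.hom_ext ?_ ?_)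
    · rw [h₀.inl_desc, ← hm, comp_f0]
    · rw [h₀.inr_desc, ← hm', comp_f0]
    · rw [h₁.inl_desc, ← hm, comp_f1]
    · rw [h₁.inr_desc, ← hm', comp_f1]

end

section

variable {C : Type u} [Category.{v} C] [Preadditive C] {T : C ⥤ C} {ω : 𝟭 C ⟶ T}
  {E : ObjectProperty (ShortComplex C)}

lemma exists_isPullback [T.IsEquivalence] {X Y Z : Factorization T ω} (f : X ⟶ Z) (g : Y ⟶ Z)
    {P₀ P₁ : C} {a₀ : P₀ ⟶ X.X0} {b₀ : P₀ ⟶ Y.X0} {a₁ : P₁ ⟶ X.X1} {b₁ : P₁ ⟶ Y.X1}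
    (h₀ : IsPullback a₀ b₀ f.f0 g.f0) (h₁ : IsPullback a₁ b₁ f.f1 g.f1)
    (hb₀ : IsDeflation E b₀) (hb₁ : IsDeflation E b₁) :
    ∃ (P : Factorization T ω) (a : P ⟶ X) (b : P ⟶ Y), IsPullback a b f g ∧
      IsDeflation E b.f0 ∧ IsDeflation E b.f1 := by
  have hT := h₀.map T
  let P : Factorization T ω :=
    { X0 := P₀
      X1 := P₁
      d0 := h₁.lift (a₀ ≫ X.d0) (b₀ ≫ Y.d0) (by
        rw [Category.assoc, f.comm0, Category.assoc, g.comm0, ← Category.assoc, h₀.w,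
          Category.assoc])
      d1 := hT.lift (a₁ ≫ X.d1) (b₁ ≫ Y.d1) (by
        rw [Category.assoc, f.comm1, Category.assoc, g.comm1, ← Category.assoc, h₁.w,
          Category.assoc])
      d0_d1 := by
        apply hT.hom_ext
        · rw [Category.assoc, hT.lift_fst, ← Category.assoc, h₁.lift_fst, Category.assoc, X.d0_d1,
            naturality_ω]
        · rw [Category.assoc, hT.lift_snd, ← Category.assoc, h₁.lift_snd, Category.assoc, Y.d0_d1,
            naturality_ω]
      d1_d0 := by
        apply (h₁.map T).hom_ext
        · rw [Category.assoc, ← T.map_comp, h₁.lift_fst, T.map_comp, ← Category.assoc,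
            hT.lift_fst, Category.assoc, X.d1_d0, naturality_ω]
        · rw [Category.assoc, ← T.map_comp, h₁.lift_snd, T.map_comp, ← Category.assoc,
            hT.lift_snd, Category.assoc, Y.d1_d0, naturality_ω] }
  let a : P ⟶ X := { f0 := a₀, f1 := a₁, comm0 := h₁.lift_fst _ _ _, comm1 := hT.lift_fst _ _ _ }
  let b : P ⟶ Y := { f0 := b₀, f1 := b₁, comm0 := h₁.lift_snd _ _ _, comm1 := hT.lift_snd _ _ _ }
  exact ⟨P, a, b, isPullback_of_components h₀ h₁, hb₀, hb₁⟩

lemma exists_isPushout [T.IsEquivalence] {X Y Z : Factorization T ω} (f : Z ⟶ X) (g : Z ⟶ Y)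
    {P₀ P₁ : C} {a₀ : X.X0 ⟶ P₀} {b₀ : Y.X0 ⟶ P₀} {a₁ : X.X1 ⟶ P₁} {b₁ : Y.X1 ⟶ P₁}
    (h₀ : IsPushout f.f0 g.f0 a₀ b₀) (h₁ : IsPushout f.f1 g.f1 a₁ b₁)
    (hb₀ : IsInflation E b₀) (hb₁ : IsInflation E b₁) :
    ∃ (P : Factorization T ω) (a : X ⟶ P) (b : Y ⟶ P), IsPushout f g a b ∧
      IsInflation E b.f0 ∧ IsInflation E b.f1 := by
  let P : Factorization T ω :=
    { X0 := P₀
      X1 := P₁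
      d0 := h₀.desc (X.d0 ≫ a₁) (Y.d0 ≫ b₁) (by
        rw [← Category.assoc, ← f.comm0, Category.assoc, h₁.w, ← Category.assoc, g.comm0,
          Category.assoc])
      d1 := h₁.desc (X.d1 ≫ T.map a₀) (Y.d1 ≫ T.map b₀) (by
        rw [← Category.assoc, ← f.comm1, Category.assoc, ← T.map_comp, h₀.w, T.map_comp,
          ← Category.assoc, g.comm1, Category.assoc])
      d0_d1 := by
        apply h₀.hom_ext
        · rw [← Category.assoc, h₀.inl_desc, Category.assoc, h₁.inl_desc, ← Category.assoc,
            X.d0_d1, naturality_ω]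
        · rw [← Category.assoc, h₀.inr_desc, Category.assoc, h₁.inr_desc, ← Category.assoc,
            Y.d0_d1, naturality_ω]
      d1_d0 := by
        apply h₁.hom_ext
        · rw [← Category.assoc, h₁.inl_desc, Category.assoc, ← T.map_comp, h₀.inl_desc,
            T.map_comp, ← Category.assoc, X.d1_d0, naturality_ω]
        · rw [← Category.assoc, h₁.inr_desc, Category.assoc, ← T.map_comp, h₀.inr_desc,
            T.map_comp, ← Category.assoc, Y.d1_d0, naturality_ω] }
  let a : X ⟶ P :=
    { f0 := a₀, f1 := a₁, comm0 := (h₀.inl_desc _ _ _).symm, comm1 := (h₁.inl_desc _ _ _).symm }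
  let b : Y ⟶ P :=
    { f0 := b₀, f1 := b₁, comm0 := (h₀.inr_desc _ _ _).symm, comm1 := (h₁.inr_desc _ _ _).symm }
  exact ⟨P, a, b, isPushout_of_components h₀ h₁, hb₀, hb₁⟩

variable [T.Additive]

/-- The functor `T` is an autoequivalence which preserves and detects conflations. -/
structure _root_.ModFac.IsExactAutoequivalence (T : C ⥤ C) [T.Additive]
    (E : ObjectProperty (ShortComplex C)) : Prop where
  isEquivalence : T.IsEquivalence
  conflation_iff : ∀ S : ShortComplex C, E (S.map T) ↔ E S

lemma _root_.ModFac.IsExactAutoequivalence.map_conflation (hT : IsExactAutoequivalence T E)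
    {X Y Z : C} {i : X ⟶ Y} {d : Y ⟶ Z} {w : i ≫ d = 0} (h : E (ShortComplex.mk i d w)) :
    ∃ w' : T.map i ≫ T.map d = 0, E (ShortComplex.mk (T.map i) (T.map d) w') :=
  ⟨_, (hT.conflation_iff _).2 h⟩

lemma f0_comp_eq_zero {X Y Z : Factorization T ω} {i : X ⟶ Y} {d : Y ⟶ Z} (w : i ≫ d = 0) :
    i.f0 ≫ d.f0 = 0 := congrArg Hom.f0 w

lemma f1_comp_eq_zero {X Y Z : Factorization T ω} {i : X ⟶ Y} {d : Y ⟶ Z} (w : i ≫ d = 0) :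
    i.f1 ≫ d.f1 = 0 := congrArg Hom.f1 w

lemma conflations_mk_iff {X Y Z : Factorization T ω} {i : X ⟶ Y} {d : Y ⟶ Z} {w : i ≫ d = 0} :
    conflations E (ShortComplex.mk i d w) ↔
      E (ShortComplex.mk i.f0 d.f0 (f0_comp_eq_zero w)) ∧
        E (ShortComplex.mk i.f1 d.f1 (f1_comp_eq_zero w)) := Iff.rfl

lemma hasFiniteBiproducts (hE : IsWICExactCategory E) :
    HasFiniteBiproducts (Factorization T ω) := by
  have := hE.hasFiniteBiproducts
  have : HasZeroObject C := hasZeroObject_of_hasFiniteBiproducts C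
  have := hasBinaryBiproducts_of_finite_biproducts C
  obtain ⟨Z, hZ⟩ := HasZeroObject.zero (C := C)
  have hTZ : IsZero (T.obj Z) := T.map_isZero hZ
  refine hasFiniteBiproducts_of_total (⟨Z, Z, 𝟙 Z, ω.app Z, by simp, by simp⟩ : Factorization T ω)
    ((IsZero.iff_id_eq_zero _).2 (hom_ext (hZ.eq_of_src _ _) (hZ.eq_of_src _ _))) (fun X Y => ?_)
  let S : Factorization T ω :=
    { X0 := X.X0 ⊞ Y.X0
      X1 := X.X1 ⊞ Y.X1
      d0 := biprod.map X.d0 Y.d0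
      d1 := biprod.desc (X.d1 ≫ T.map biprod.inl) (Y.d1 ≫ T.map biprod.inr)
      d0_d1 := by
        apply biprod.hom_ext'
        · rw [biprod.inl_map_assoc, biprod.inl_desc, ← Category.assoc, X.d0_d1, naturality_ω]
        · rw [biprod.inr_map_assoc, biprod.inr_desc, ← Category.assoc, Y.d0_d1, naturality_ω]
      d1_d0 := by
        apply biprod.hom_ext'
        · rw [biprod.inl_desc_assoc, Category.assoc, ← T.map_comp, biprod.inl_map, T.map_comp,
            ← Category.assoc, X.d1_d0, naturality_ω]
        · rw [biprod.inr_desc_assoc, Category.assoc, ← T.map_comp, biprod.inr_map, T.map_comp,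
            ← Category.assoc, Y.d1_d0, naturality_ω] }
  refine ⟨{ pt := S
            fst := { f0 := biprod.fst, f1 := biprod.fst, comm0 := biprod.map_fst _ _, comm1 := ?_ }
            snd := { f0 := biprod.snd, f1 := biprod.snd, comm0 := biprod.map_snd _ _, comm1 := ?_ }
            inl := { f0 := biprod.inl, f1 := biprod.inl, comm0 := (biprod.inl_map _ _).symm
                     comm1 := (biprod.inl_desc _ _).symm }
            inr := { f0 := biprod.inr, f1 := biprod.inr, comm0 := (biprod.inr_map _ _).symm
                     comm1 := (biprod.inr_desc _ _).symm }
            inl_fst := hom_ext biprod.inl_fst biprod.inl_fst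
            inl_snd := hom_ext biprod.inl_snd biprod.inl_snd
            inr_fst := hom_ext biprod.inr_fst biprod.inr_fst
            inr_snd := hom_ext biprod.inr_snd biprod.inr_snd },
    hom_ext biprod.total biprod.total⟩
  · apply biprod.hom_ext' <;> simp [S, ← T.map_comp]
  · apply biprod.hom_ext' <;> simp [S, ← T.map_comp]

variable (hE : IsWICExactCategory E) (hT : IsExactAutoequivalence T E)
include hE hT

/-- Componentwise kernels of a componentwise deflation form a factorization. -/
lemma exists_kernel {Y Z : Factorization T ω} (d : Y ⟶ Z) {K₀ K₁ : C} {i₀ : K₀ ⟶ Y.X0}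
    {i₁ : K₁ ⟶ Y.X1} {w₀ : i₀ ≫ d.f0 = 0} {w₁ : i₁ ≫ d.f1 = 0}
    (h₀ : E (ShortComplex.mk i₀ d.f0 w₀)) (h₁ : E (ShortComplex.mk i₁ d.f1 w₁)) :
    ∃ (k₀ : K₀ ⟶ K₁) (k₁ : K₁ ⟶ T.obj K₀) (h : k₀ ≫ k₁ = ω.app K₀)
      (h' : k₁ ≫ T.map k₀ = ω.app K₁) (c₀ : k₀ ≫ i₁ = i₀ ≫ Y.d0)
      (c₁ : k₁ ≫ T.map i₀ = i₁ ≫ Y.d1)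
      (w : ({ f0 := i₀, f1 := i₁, comm0 := c₀, comm1 := c₁ } :
        (⟨K₀, K₁, k₀, k₁, h, h'⟩ : Factorization T ω) ⟶ Y) ≫ d = 0),
      conflations E (ShortComplex.mk _ d w) := by
  obtain ⟨wT, hT₀⟩ := hT.map_conflation h₀
  obtain ⟨k₀, c₀⟩ := hE.exists_lift h₁ (i₀ ≫ Y.d0) (by
    rw [Category.assoc, d.comm0, ← Category.assoc, w₀, zero_comp])
  obtain ⟨k₁, c₁⟩ := hE.exists_lift hT₀ (i₁ ≫ Y.d1) (by
    rw [Category.assoc, d.comm1, ← Category.assoc, w₁, zero_comp])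
  have := hE.mono_f hT₀
  have := hE.mono_f (hT.map_conflation h₁).choose_spec
  refine ⟨k₀, k₁, ?_, ?_, c₀, c₁, hom_ext w₀ w₁, conflations_mk_iff.2 ⟨h₀, h₁⟩⟩
  · rw [← cancel_mono (T.map i₀), Category.assoc, c₁, ← Category.assoc, c₀, Category.assoc,
      Y.d0_d1, naturality_ω]
  · rw [← cancel_mono (T.map i₁), Category.assoc, ← T.map_comp, c₀, T.map_comp, ← Category.assoc,
      c₁, Category.assoc, Y.d1_d0, naturality_ω]

lemma isDeflation_iff {Y Z : Factorization T ω} (d : Y ⟶ Z) :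
    IsDeflation (conflations E) d ↔ IsDeflation E d.f0 ∧ IsDeflation E d.f1 := by
  constructor
  · rintro ⟨X, i, w, h⟩
    exact ⟨⟨_, _, _, h.1⟩, ⟨_, _, _, h.2⟩⟩
  · rintro ⟨⟨K₀, i₀, w₀, h₀⟩, ⟨K₁, i₁, w₁, h₁⟩⟩
    obtain ⟨k₀, k₁, h, h', c₀, c₁, w, hw⟩ := exists_kernel hE hT d h₀ h₁
    exact ⟨_, _, w, hw⟩

/-- Componentwise cokernels of a componentwise inflation form a factorization. -/
lemma exists_cokernel {X Y : Factorization T ω} (i : X ⟶ Y) {K₀ K₁ : C} {p₀ : Y.X0 ⟶ K₀}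
    {p₁ : Y.X1 ⟶ K₁} {w₀ : i.f0 ≫ p₀ = 0} {w₁ : i.f1 ≫ p₁ = 0}
    (h₀ : E (ShortComplex.mk i.f0 p₀ w₀)) (h₁ : E (ShortComplex.mk i.f1 p₁ w₁)) :
    ∃ (k₀ : K₀ ⟶ K₁) (k₁ : K₁ ⟶ T.obj K₀) (h : k₀ ≫ k₁ = ω.app K₀)
      (h' : k₁ ≫ T.map k₀ = ω.app K₁) (c₀ : Y.d0 ≫ p₁ = p₀ ≫ k₀)
      (c₁ : Y.d1 ≫ T.map p₀ = p₁ ≫ k₁)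
      (w : i ≫ ({ f0 := p₀, f1 := p₁, comm0 := c₀, comm1 := c₁ } :
        Y ⟶ (⟨K₀, K₁, k₀, k₁, h, h'⟩ : Factorization T ω)) = 0),
      conflations E (ShortComplex.mk i _ w) := by
  obtain ⟨wT, -⟩ := hT.map_conflation h₀
  obtain ⟨k₀, c₀⟩ := hE.exists_desc h₀ (Y.d0 ≫ p₁) (by
    rw [← Category.assoc, ← i.comm0, Category.assoc, w₁, comp_zero])
  obtain ⟨k₁, c₁⟩ := hE.exists_desc h₁ (Y.d1 ≫ T.map p₀) (by
    rw [← Category.assoc, ← i.comm1, Category.assoc, wT, comp_zero])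
  have := hE.epi_g h₀
  have := hE.epi_g h₁
  refine ⟨k₀, k₁, ?_, ?_, c₀.symm, c₁.symm, hom_ext w₀ w₁, conflations_mk_iff.2 ⟨h₀, h₁⟩⟩
  · rw [← cancel_epi p₀, ← Category.assoc, c₀, Category.assoc, c₁, ← Category.assoc, Y.d0_d1,
      naturality_ω]
  · rw [← cancel_epi p₁, ← Category.assoc, c₁, Category.assoc, ← T.map_comp, c₀, T.map_comp,
      ← Category.assoc, Y.d1_d0, naturality_ω]

lemma isInflation_iff {X Y : Factorization T ω} (i : X ⟶ Y) :
    IsInflation (conflations E) i ↔ IsInflation E i.f0 ∧ IsInflation E i.f1 := by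
  constructor
  · rintro ⟨Z, d, w, h⟩
    exact ⟨⟨_, _, _, h.1⟩, ⟨_, _, _, h.2⟩⟩
  · rintro ⟨⟨K₀, p₀, w₀, h₀⟩, ⟨K₁, p₁, w₁, h₁⟩⟩
    obtain ⟨k₀, k₁, h, h', c₀, c₁, w, hw⟩ := exists_cokernel hE hT i h₀ h₁
    exact ⟨_, _, w, hw⟩

lemma isKernelCokernelPair {X Y Z : Factorization T ω} {i : X ⟶ Y} {d : Y ⟶ Z} {w : i ≫ d = 0}
    (h : conflations E (ShortComplex.mk i d w)) : IsKernelCokernelPair (ShortComplex.mk i d w) := by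
  obtain ⟨h₀, h₁⟩ := conflations_mk_iff.1 h
  have := hE.mono_f h₀
  have := hE.mono_f h₁
  have := hE.mono_f (hT.map_conflation h₀).choose_spec
  have := hE.epi_g h₀
  have := hE.epi_g h₁
  refine isKernelCokernelPair_of_lift_desc _ ⟨fun a b hab => ?_⟩ ⟨fun a b hab => ?_⟩
    (fun W k hk => ?_) (fun W k hk => ?_)
  · have hab : a ≫ i = b ≫ i := hab
    exact hom_ext ((cancel_mono i.f0).1 (congrArg Hom.f0 hab))
      ((cancel_mono i.f1).1 (congrArg Hom.f1 hab))
  · have hab : d ≫ a = d ≫ b := hab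
    exact hom_ext ((cancel_epi d.f0).1 (congrArg Hom.f0 hab))
      ((cancel_epi d.f1).1 (congrArg Hom.f1 hab))
  · change W ⟶ Y at k
    have hk : k ≫ d = 0 := hk
    obtain ⟨l₀, e₀⟩ := hE.exists_lift h₀ k.f0 (congrArg Hom.f0 hk)
    obtain ⟨l₁, e₁⟩ := hE.exists_lift h₁ k.f1 (congrArg Hom.f1 hk)
    refine ⟨({ f0 := l₀, f1 := l₁, comm0 := ?_, comm1 := ?_ } : W ⟶ X), hom_ext e₀ e₁⟩
    · rw [← cancel_mono i.f1, Category.assoc, e₁, k.comm0, Category.assoc, i.comm0,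
        ← Category.assoc, e₀]
    · rw [← cancel_mono (T.map i.f0), Category.assoc, ← T.map_comp, e₀, k.comm1, Category.assoc,
        i.comm1, ← Category.assoc, e₁]
  · change Y ⟶ W at k
    have hk : i ≫ k = 0 := hk
    obtain ⟨l₀, e₀⟩ := hE.exists_desc h₀ k.f0 (congrArg Hom.f0 hk)
    obtain ⟨l₁, e₁⟩ := hE.exists_desc h₁ k.f1 (congrArg Hom.f1 hk)
    refine ⟨({ f0 := l₀, f1 := l₁, comm0 := ?_, comm1 := ?_ } : Z ⟶ W), hom_ext e₀ e₁⟩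
    · rw [← cancel_epi d.f0, ← Category.assoc, ← d.comm0, Category.assoc, e₁, k.comm0,
        ← Category.assoc, e₀]
    · rw [← cancel_epi d.f1, ← Category.assoc, ← d.comm1, Category.assoc, ← T.map_comp, e₀,
        k.comm1, ← Category.assoc, e₁]

/-- The exact structure on factorizations. -/
theorem isWICExactCategory : IsWICExactCategory (conflations (ω := ω) (T := T) E) where
  hasFiniteBiproducts := hasFiniteBiproducts hE
  isoClosed := ⟨fun e h => ⟨hE.of_iso ((pr0 T ω).mapShortComplex.mapIso e) h.1,
    hE.of_iso ((pr1 T ω).mapShortComplex.mapIso e) h.2⟩⟩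
  kernelCokernel S hS := isKernelCokernelPair hE hT hS
  ex0 Z _ := (isDeflation_iff hE hT _).2 ⟨hE.isDeflation_id _, hE.isDeflation_id _⟩
  ex1 d e hd he := by
    rw [isDeflation_iff hE hT] at hd he ⊢
    exact ⟨hE.ex1 _ _ hd.1 he.1, hE.ex1 _ _ hd.2 he.2⟩
  ex1_op i j hi hj := by
    rw [isInflation_iff hE hT] at hi hj ⊢
    exact ⟨hE.ex1_op _ _ hi.1 hj.1, hE.ex1_op _ _ hi.2 hj.2⟩
  ex2 d f hd := by
    have := hT.isEquivalence
    rw [isDeflation_iff hE hT] at hd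
    obtain ⟨Y₀, f₀, d₀, h₀, hd₀⟩ := hE.ex2 d.f0 f.f0 hd.1
    obtain ⟨Y₁, f₁, d₁, h₁, hd₁⟩ := hE.ex2 d.f1 f.f1 hd.2
    obtain ⟨P, a, b, h, hb⟩ := exists_isPullback d f h₀ h₁ hd₀ hd₁
    exact ⟨P, a, b, h, (isDeflation_iff hE hT _).2 hb⟩
  ex2_op i f hi := by
    have := hT.isEquivalence
    rw [isInflation_iff hE hT] at hi
    obtain ⟨Y₀, f₀, i₀, h₀, hi₀⟩ := hE.ex2_op i.f0 f.f0 hi.1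
    obtain ⟨Y₁, f₁, i₁, h₁, hi₁⟩ := hE.ex2_op i.f1 f.f1 hi.2
    obtain ⟨P, a, b, h, hb⟩ := exists_isPushout i f h₀ h₁ hi₀ hi₁
    exact ⟨P, a, b, h, (isInflation_iff hE hT _).2 hb⟩
  deflation_of_comp f g h := by
    rw [isDeflation_iff hE hT] at h ⊢
    exact ⟨hE.deflation_of_comp _ _ h.1, hE.deflation_of_comp _ _ h.2⟩
  inflation_of_comp f g h := by
    rw [isInflation_iff hE hT] at h ⊢
    exact ⟨hE.inflation_of_comp _ _ h.1, hE.inflation_of_comp _ _ h.2⟩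

end

/-! ### Contractible factorizations -/

section

variable {C : Type u} [Category.{v} C] {T : C ⥤ C} {ω : 𝟭 C ⟶ T}

/-- The factorization `P = P ⟶ T(P)`. The functor `disk0` is left adjoint to `X ↦ X0` and
right adjoint to `X ↦ X1`. -/
def disk0 (ω : 𝟭 C ⟶ T) (P : C) : Factorization T ω where
  X0 := P
  X1 := P
  d0 := 𝟙 P
  d1 := ω.app P
  d0_d1 := Category.id_comp _
  d1_d0 := by rw [T.map_id]; exact Category.comp_id _

/-- The morphism `disk0 P ⟶ X` given by a morphism `P ⟶ X0`. -/
def ofDisk0 {P : C} {X : Factorization T ω} (f : P ⟶ X.X0) : disk0 ω P ⟶ X where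
  f0 := f
  f1 := f ≫ X.d0
  comm0 := Category.id_comp _
  comm1 := by
    change ω.app P ≫ T.map f = (f ≫ X.d0) ≫ X.d1
    rw [Category.assoc, X.d0_d1, naturality_ω]

/-- The morphism `X ⟶ disk0 P` given by a morphism `X1 ⟶ P`. -/
def toDisk0 {P : C} {X : Factorization T ω} (f : X.X1 ⟶ P) : X ⟶ disk0 ω P where
  f0 := X.d0 ≫ f
  f1 := f
  comm0 := (Category.comp_id _).symm
  comm1 := by
    change X.d1 ≫ T.map (X.d0 ≫ f) = f ≫ ω.app P
    rw [T.map_comp, ← Category.assoc, X.d1_d0, ← naturality_ω]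

variable (hω : ∀ X, ω.app (T.obj X) = T.map (ω.app X))

/-- The factorization `P ⟶ T(P) = T(P)`. The functor `disk1` is right adjoint to `X ↦ X0`, and
morphisms from `disk1 P` to `X` are morphisms `T(P) ⟶ X1`. -/
def disk1 (P : C) : Factorization T ω where
  X0 := P
  X1 := T.obj P
  d0 := ω.app P
  d1 := 𝟙 _
  d0_d1 := Category.comp_id _
  d1_d0 := by rw [hω]; exact Category.id_comp _

/-- The morphism `X ⟶ disk1 P` given by a morphism `X0 ⟶ P`. -/
def toDisk1 {P : C} {X : Factorization T ω} (f : X.X0 ⟶ P) : X ⟶ disk1 hω P where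
  f0 := f
  f1 := X.d1 ≫ T.map f
  comm0 := by
    change X.d0 ≫ X.d1 ≫ T.map f = f ≫ ω.app P
    rw [← Category.assoc, X.d0_d1, ← naturality_ω]
  comm1 := (Category.comp_id _).symm

/-- The morphism `disk1 P ⟶ X` given by a morphism `T(P) ⟶ X1`. -/
noncomputable def ofDisk1 [T.Full] [T.Faithful] {P : C} {X : Factorization T ω}
    (f : T.obj P ⟶ X.X1) : disk1 hω P ⟶ X where
  f0 := T.preimage (f ≫ X.d1)
  f1 := f
  comm0 := by
    apply T.map_injective
    change T.map (ω.app P ≫ f) = T.map (T.preimage (f ≫ X.d1) ≫ X.d0)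
    rw [T.map_comp, T.map_comp, T.map_preimage, Category.assoc, X.d1_d0, naturality_ω, hω]
  comm1 := by
    rw [T.map_preimage]
    exact Category.id_comp _

end

section

variable {C : Type u} [Category.{v} C] [Preadditive C] {T : C ⥤ C} {ω : 𝟭 C ⟶ T} [T.Additive]
  {E : ObjectProperty (ShortComplex C)} {P : ObjectProperty C}

lemma isProj_disk0 {Q : C} (hQ : IsProj E Q) : IsProj (conflations E) (disk0 ω Q) := by
  rintro ⟨i, d, w⟩ hS f
  obtain ⟨k, hk⟩ := hQ.lift (conflations_mk_iff.1 hS).1 f.f0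
  refine ⟨ofDisk0 k, hom_ext hk ?_⟩
  change (k ≫ _) ≫ d.f1 = f.f1
  rw [Category.assoc, d.comm0, ← Category.assoc, hk]
  refine f.comm0.symm.trans ?_
  exact Category.id_comp _

lemma isInjRel_disk0 {Q : C} (hQ : IsInjRel E P Q) :
    IsInjRel (conflations E) (components P) (disk0 ω Q) := by
  rintro ⟨i, d, w⟩ hS h₁ h₂ h₃ f
  obtain ⟨k, hk⟩ := hQ.extend (conflations_mk_iff.1 hS).2 h₁.2 h₂.2 h₃.2 f.f1
  refine ⟨toDisk0 k, hom_ext ?_ hk⟩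
  change i.f0 ≫ _ ≫ k = f.f0
  rw [← Category.assoc, ← i.comm0, Category.assoc, hk]
  refine f.comm0.trans ?_
  exact Category.comp_id _

variable (hω : ∀ X, ω.app (T.obj X) = T.map (ω.app X))

lemma isProj_disk1 [T.Full] [T.Faithful] {Q : C} (hQ : IsProj E (T.obj Q)) :
    IsProj (conflations E) (disk1 hω Q) := by
  rintro ⟨i, d, w⟩ hS f
  obtain ⟨k, hk⟩ := hQ.lift (conflations_mk_iff.1 hS).2 f.f1
  refine ⟨ofDisk1 hω k, hom_ext (T.map_injective ?_) hk⟩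
  change T.map (T.preimage (k ≫ _) ≫ d.f0) = _
  rw [T.map_comp, T.map_preimage, Category.assoc, d.comm1, ← Category.assoc, hk]
  refine f.comm1.symm.trans ?_
  exact Category.id_comp _

lemma isInjRel_disk1 {Q : C} (hQ : IsInjRel E P Q) :
    IsInjRel (conflations E) (components P) (disk1 hω Q) := by
  rintro ⟨i, d, w⟩ hS h₁ h₂ h₃ f
  obtain ⟨k, hk⟩ := hQ.extend (conflations_mk_iff.1 hS).1 h₁.1 h₂.1 h₃.1 f.f0
  refine ⟨toDisk1 hω k, hom_ext hk ?_⟩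
  change i.f1 ≫ _ ≫ T.map k = f.f1
  rw [← Category.assoc, ← i.comm1, Category.assoc, ← T.map_comp, hk]
  refine f.comm1.trans ?_
  exact Category.comp_id _

lemma _root_.ModFac.IsProj.of_iso {Q Q' : C} (hQ : IsProj E Q) (e : Q ≅ Q') : IsProj E Q' :=
  hQ.of_retract e.inv e.hom e.inv_hom_id

lemma _root_.ModFac.IsInjRel.of_iso {Q Q' : C} (hQ : IsInjRel E P Q) (e : Q ≅ Q') :
    IsInjRel E P Q' :=
  hQ.of_retract e.inv e.hom e.inv_hom_id

/-- An autoequivalence preserving conflations preserves projective objects. -/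
lemma _root_.ModFac.IsProj.map_autoequivalence (hE : IsExactCategory E)
    (hT : IsExactAutoequivalence T E) {Q : C} (hQ : IsProj E Q) : IsProj E (T.obj Q) := by
  have := hT.isEquivalence
  rintro ⟨i, d, w⟩ hS h
  rename_i X Y Z
  let eX := T.objObjPreimageIso X
  let eY := T.objObjPreimageIso Y
  let eZ := T.objObjPreimageIso Z
  let i' := T.preimage (eX.hom ≫ i ≫ eY.inv)
  let d' := T.preimage (eY.hom ≫ d ≫ eZ.inv)
  have hi' : T.map i' = eX.hom ≫ i ≫ eY.inv := T.map_preimage _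
  have hd' : T.map d' = eY.hom ≫ d ≫ eZ.inv := T.map_preimage _
  have w' : i' ≫ d' = 0 := T.map_injective (by
    rw [T.map_comp, hi', hd', T.map_zero, Category.assoc, Category.assoc, eY.inv_hom_id_assoc,
      reassoc_of% w, zero_comp, comp_zero])
  have hS' : E (ShortComplex.mk i' d' w') := by
    refine (hT.conflation_iff _).1 (hE.of_iso (S := ShortComplex.mk i d w)
      (ShortComplex.isoMk eX.symm eY.symm eZ.symm ?_ ?_) hS)
    · change eX.inv ≫ T.map i' = i ≫ eY.inv
      rw [hi', eX.inv_hom_id_assoc]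
    · change eY.inv ≫ T.map d' = d ≫ eZ.inv
      rw [hd', eY.inv_hom_id_assoc]
  obtain ⟨k, hk⟩ := hQ.lift hS' (T.preimage (h ≫ eZ.inv))
  refine ⟨T.map k ≫ eY.hom, ?_⟩
  change (T.map k ≫ eY.hom) ≫ d = h
  have := congrArg T.map hk
  rw [T.map_comp, hd', T.map_preimage, ← Category.assoc, ← Category.assoc, cancel_mono] at this
  exact this

lemma _root_.ModFac.IsInjRel.of_map_autoequivalence (hT : IsExactAutoequivalence T E)
    (hP : ∀ X, P (T.obj X) ↔ P X) {Q : C} (hQ : IsInjRel E P (T.obj Q)) : IsInjRel E P Q := by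
  have := hT.isEquivalence
  intro S hS h₁ h₂ h₃ f
  obtain ⟨k, hk⟩ : ∃ k : T.obj S.X₂ ⟶ T.obj Q, T.map S.f ≫ k = T.map f :=
    hQ _ ((hT.conflation_iff S).2 hS) ((hP _).2 h₁) ((hP _).2 h₂) ((hP _).2 h₃) (T.map f)
  exact ⟨T.preimage k, T.map_injective (by rw [T.map_comp, T.map_preimage, hk])⟩

lemma isProjInj_biprod_disk (hE : IsWICExactCategory E) (hT : IsExactAutoequivalence T E)
    (hP : IsFrobeniusClass E P) (hPT : ∀ X, P (T.obj X) ↔ P X)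
    [HasBinaryBiproducts (Factorization T ω)] {Q Q' : C} (hQ : IsProjInj E P Q) (hQ' : P Q')
    (hpr : IsProj E (T.obj Q')) (hinj : IsInjRel E P Q') :
    IsProjInj (conflations E) (components P) (disk0 ω Q ⊞ disk1 hω Q') := by
  have := hT.isEquivalence
  have h₀ : IsProjInj (conflations E) (components P) (disk0 ω Q) :=
    ⟨⟨hQ.mem, hQ.mem⟩, isProj_disk0 hQ.proj, isInjRel_disk0 hQ.inj⟩
  have h₁ : IsProjInj (conflations E) (components P) (disk1 hω Q') :=
    ⟨⟨hQ', (hPT _).2 hQ'⟩, isProj_disk1 hω hpr, isInjRel_disk1 hω hinj⟩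
  have hc := (isWICExactCategory (ω := ω) hE hT).biprod_conflation (disk0 ω Q) (disk1 hω Q')
  refine ⟨⟨hP.ext _ hc.1 h₀.mem.1 h₁.mem.1, hP.ext _ hc.2 h₀.mem.2 h₁.mem.2⟩, fun S hS f => ?_,
    fun S hS e₁ e₂ e₃ f => ?_⟩
  · obtain ⟨k, hk⟩ := h₀.proj S hS (biprod.inl ≫ f)
    obtain ⟨l, hl⟩ := h₁.proj S hS (biprod.inr ≫ f)
    exact ⟨biprod.desc k l, by apply biprod.hom_ext' <;> simp [hk, hl]⟩
  · obtain ⟨k, hk⟩ := h₀.inj S hS e₁ e₂ e₃ (f ≫ biprod.fst)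
    obtain ⟨l, hl⟩ := h₁.inj S hS e₁ e₂ e₃ (f ≫ biprod.snd)
    exact ⟨biprod.lift k l, by apply biprod.hom_ext <;> simp [hk, hl]⟩

include hω in
/-- Componentwise covers by projective-injective objects give a cover by a projective-injective
factorization. The components of `X` need not belong to `P`. -/
lemma exists_isProjInj_deflation (hE : IsWICExactCategory E) (hT : IsExactAutoequivalence T E)
    (hP : IsFrobeniusClass E P) (hPT : ∀ X, P (T.obj X) ↔ P X) (X : Factorization T ω) {Q₀ Q₁ : C}
    (d₀ : Q₀ ⟶ X.X0) (d₁ : Q₁ ⟶ X.X1) (hd₀ : IsDeflation E d₀) (hd₁ : IsDeflation E d₁)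
    (hQ₀ : IsProjInj E P Q₀) (hQ₁ : IsProjInj E P Q₁) :
    ∃ (Q : Factorization T ω) (d : Q ⟶ X), IsDeflation (conflations E) d ∧
      IsProjInj (conflations E) (components P) Q := by
  have := hT.isEquivalence
  have hE' := isWICExactCategory (ω := ω) hE hT
  have := hE'.hasFiniteBiproducts
  have := hasBinaryBiproducts_of_finite_biproducts (Factorization T ω)
  let e := T.objObjPreimageIso Q₁
  let inl : disk0 ω Q₀ ⟶ disk0 ω Q₀ ⊞ disk1 hω (T.objPreimage Q₁) := biprod.inl
  let inr : disk1 hω (T.objPreimage Q₁) ⟶ disk0 ω Q₀ ⊞ disk1 hω (T.objPreimage Q₁) := biprod.inr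
  let d : disk0 ω Q₀ ⊞ disk1 hω (T.objPreimage Q₁) ⟶ X :=
    biprod.desc (ofDisk0 d₀) (ofDisk1 hω (e.hom ≫ d₁))
  have hd₀' : inl.f0 ≫ d.f0 = d₀ := congrArg Hom.f0 (biprod.inl_desc (ofDisk0 d₀) _)
  have hd₁' : inr.f1 ≫ d.f1 = e.hom ≫ d₁ :=
    congrArg Hom.f1 (biprod.inr_desc (ofDisk0 d₀) (ofDisk1 hω (e.hom ≫ d₁)))
  refine ⟨_, d, (isDeflation_iff hE hT _).2 ⟨?_, ?_⟩, isProjInj_biprod_disk hω hE hT hP hPT hQ₀ ?_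
    (hQ₁.proj.of_iso e.symm)
      (IsInjRel.of_map_autoequivalence hT hPT (hQ₁.inj.of_iso e.symm))⟩
  · refine hE.deflation_of_comp inl.f0 _ ?_
    rw [hd₀']
    exact hd₀
  · refine hE.deflation_of_comp inr.f1 _ ?_
    rw [hd₁']
    exact hE.ex1 _ _ (hE.isDeflation_of_split e.hom e.inv e.inv_hom_id) hd₁
  · exact (hPT _).1 (hP.of_iso e.symm hQ₁.mem)

/-- The factorizations with components in a Frobenius class form a Frobenius class. -/
theorem isFrobeniusClass (hE : IsWICExactCategory E) (hT : IsExactAutoequivalence T E)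
    (hω : ∀ X, ω.app (T.obj X) = T.map (ω.app X)) (hP : IsFrobeniusClass E P)
    (hPT : ∀ X, P (T.obj X) ↔ P X) : IsFrobeniusClass (conflations (ω := ω) E) (components P) := by
  have := hT.isEquivalence
  have hE' := isWICExactCategory (ω := ω) hE hT
  have := hE.hasFiniteBiproducts
  have := hasBinaryBiproducts_of_finite_biproducts C
  have := hE'.hasFiniteBiproducts
  have := hasBinaryBiproducts_of_finite_biproducts (Factorization T ω)
  have ext : ∀ S, conflations (T := T) (ω := ω) E S → components P S.X₁ → components P S.X₃ →
      components P S.X₂ := fun S hS h₁ h₃ => ⟨hP.ext _ hS.1 h₁.1 h₃.1, hP.ext _ hS.2 h₁.2 h₃.2⟩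
  refine ⟨fun Z hZ => ?_, ⟨fun {X Y} e h => ?_⟩, ext, ?_, ?_, ?_, ?_⟩
  · have hZ := (IsZero.iff_id_eq_zero _).1 hZ
    exact ⟨hP.zero _ ((IsZero.iff_id_eq_zero _).2 (congrArg Hom.f0 hZ)),
      hP.zero _ ((IsZero.iff_id_eq_zero _).2 (congrArg Hom.f1 hZ))⟩
  · exact ⟨hP.of_iso ((pr0 T ω).mapIso e) h.1, hP.of_iso ((pr1 T ω).mapIso e) h.2⟩
  · exact fun S hS h₂ h₃ => ⟨hP.ker _ hS.1 h₂.1 h₃.1, hP.ker _ hS.2 h₂.2 h₃.2⟩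
  · intro X Y W Z Z' f g p q w w' h h' hX hY hW hZ'
    exact ⟨hP.coker f.f0 g.f0 p.f0 q.f0 _ _ h.1 h'.1 hX.1 hY.1 hW.1 hZ'.1,
      hP.coker f.f1 g.f1 p.f1 q.f1 _ _ h.2 h'.2 hX.2 hY.2 hW.2 hZ'.2⟩
  · intro X hX
    obtain ⟨Q₀, d₀, hd₀, hQ₀⟩ := hP.enoughProj _ hX.1
    obtain ⟨Q₁, d₁, hd₁, hQ₁⟩ := hP.enoughProj _ hX.2
    exact exists_isProjInj_deflation hω hE hT hP hPT X d₀ d₁ hd₀ hd₁ hQ₀ hQ₁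
  · intro X hX
    obtain ⟨Q₀, Z₀, i₀, p₀, w₀, h₀, hZ₀, hQ₀⟩ := hP.enoughInj _ hX.1
    obtain ⟨Q₁, Z₁, i₁, p₁, w₁, h₁, hZ₁, hQ₁⟩ := hP.enoughInj _ hX.2
    have hQ := isProjInj_biprod_disk hω hE hT hP hPT hQ₁ hQ₀.mem
      (hQ₀.proj.map_autoequivalence hE.toIsExactCategory hT) hQ₀.inj
    let i : X ⟶ disk0 ω Q₁ ⊞ disk1 hω Q₀ := biprod.lift (toDisk0 i₁) (toDisk1 hω i₀)
    let fst : disk0 ω Q₁ ⊞ disk1 hω Q₀ ⟶ disk0 ω Q₁ := biprod.fst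
    let snd : disk0 ω Q₁ ⊞ disk1 hω Q₀ ⟶ disk1 hω Q₀ := biprod.snd
    have hi₀ : i.f0 ≫ snd.f0 = i₀ := congrArg Hom.f0 (biprod.lift_snd (toDisk0 i₁) (toDisk1 hω i₀))
    have hi₁ : i.f1 ≫ fst.f1 = i₁ := congrArg Hom.f1 (biprod.lift_fst (toDisk0 i₁) (toDisk1 hω i₀))
    obtain ⟨Z, p, w, h⟩ : IsInflation (conflations E) i := by
      refine (isInflation_iff hE hT _).2 ⟨?_, ?_⟩
      · refine hE.inflation_of_comp i.f0 snd.f0 ?_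
        rw [hi₀]
        exact ⟨_, _, _, h₀⟩
      · refine hE.inflation_of_comp i.f1 fst.f1 ?_
        rw [hi₁]
        exact ⟨_, _, _, h₁⟩
    refine ⟨_, Z, i, p, w, h, ⟨?_, ?_⟩, hQ⟩
    · obtain ⟨w', h'⟩ : ∃ w', E (ShortComplex.mk (i.f0 ≫ snd.f0) p₀ w') := by
        rw [hi₀]
        exact ⟨w₀, h₀⟩
      exact hP.coker i.f0 _ p.f0 p₀ _ w' h.1 h' hX.1 hQ.mem.1 hQ₀.mem hZ₀
    · obtain ⟨w', h'⟩ : ∃ w', E (ShortComplex.mk (i.f1 ≫ fst.f1) p₁ w') := by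
        rw [hi₁]
        exact ⟨w₁, h₁⟩
      exact hP.coker i.f1 _ p.f1 p₁ _ w' h.2 h' hX.2 hQ.mem.2 hQ₁.mem hZ₁

end

end Factorization

/-! ### Factorizations and cokernels -/

namespace Factorization

section

variable {C : Type u} [Category.{v} C] {T : C ⥤ C} {ω : 𝟭 C ⟶ T}

/-- An isomorphism of factorizations from isomorphisms of the components. -/
def isoMk {X Y : Factorization T ω} (e₀ : X.X0 ≅ Y.X0) (e₁ : X.X1 ≅ Y.X1)
    (h₀ : X.d0 ≫ e₁.hom = e₀.hom ≫ Y.d0) (h₁ : X.d1 ≫ T.map e₀.hom = e₁.hom ≫ Y.d1) : X ≅ Y where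
  hom := { f0 := e₀.hom, f1 := e₁.hom, comm0 := h₀, comm1 := h₁ }
  inv :=
    { f0 := e₀.inv
      f1 := e₁.inv
      comm0 := by rw [← cancel_epi e₀.hom, ← Category.assoc, ← h₀]; simp
      comm1 := by
        rw [← cancel_epi e₁.hom, ← Category.assoc, ← h₁, Category.assoc, ← T.map_comp]
        simp }
  hom_inv_id := hom_ext e₀.hom_inv_id e₁.hom_inv_id
  inv_hom_id := hom_ext e₀.inv_hom_id e₁.inv_hom_id

/-- The functor `disk0`. -/
def disk0Functor (T : C ⥤ C) (ω : 𝟭 C ⟶ T) : C ⥤ Factorization T ω where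
  obj := disk0 ω
  map g :=
    { f0 := g
      f1 := g
      comm0 := (Category.id_comp _).trans (Category.comp_id _).symm
      comm1 := (naturality_ω g).symm }

/-- The functor `X ↦ X1` is left adjoint to `disk0`. -/
def pr1Adjunction (T : C ⥤ C) (ω : 𝟭 C ⟶ T) : pr1 T ω ⊣ disk0Functor T ω :=
  Adjunction.mkOfHomEquiv
    { homEquiv := fun _ _ =>
        { toFun := fun f => toDisk0 f
          invFun := fun f => f.f1
          left_inv := fun _ => rfl
          right_inv := fun f => hom_ext (f.comm0.trans (Category.comp_id _)) rfl }
      homEquiv_naturality_left_symm := fun _ _ => rfl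
      homEquiv_naturality_right := fun _ _ => hom_ext (Category.assoc _ _ _).symm rfl }

instance [Preadditive C] [T.Additive] : (disk0Functor T ω).Additive where
  map_add := rfl

lemma _root_.ModFac.IsProj.map_of_adjunction [Preadditive C]
    {D : Type u'} [Category.{v'} D] [Preadditive D] {E : ObjectProperty (ShortComplex C)}
    {E₁ : ObjectProperty (ShortComplex D)} {F : C ⥤ D} {G : D ⥤ C} [G.Additive] (adj : F ⊣ G)
    (hG : ∀ S, E₁ S → E (S.map G)) {X : C} (hX : IsProj E X) : IsProj E₁ (F.obj X) := by
  intro S hS f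
  obtain ⟨k, hk⟩ := hX (S.map G) (hG S hS) (adj.homEquiv _ _ f)
  change X ⟶ G.obj S.X₂ at k
  have hk : k ≫ G.map S.g = adj.homEquiv _ _ f := hk
  refine ⟨(adj.homEquiv _ _).symm k, ?_⟩
  rw [← adj.homEquiv_naturality_right_symm, hk, Equiv.symm_apply_apply]

end

section

variable {C : Type u} [Category.{v} C] [Preadditive C] {T : C ⥤ C} {ω : 𝟭 C ⟶ T} [T.Additive]
  {E : ObjectProperty (ShortComplex C)} (hE : IsExactCategory E) (hT : IsExactAutoequivalence T E)

include hE hT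

/-- A conflation whose last term is annihilated by `ω` is the first half of a factorization. -/
lemma exists_d1 {X₀ X₁ M : C} {i : X₀ ⟶ X₁} {p : X₁ ⟶ M} {w : i ≫ p = 0}
    (h : E (ShortComplex.mk i p w)) (hM : ω.app M = 0) :
    ∃ d : X₁ ⟶ T.obj X₀, i ≫ d = ω.app X₀ ∧ d ≫ T.map i = ω.app X₁ := by
  obtain ⟨w', h'⟩ := hT.map_conflation h
  obtain ⟨d, hd⟩ := hE.exists_lift h' (ω.app X₁) (by rw [← naturality_ω, hM, comp_zero])
  refine ⟨d, ?_, hd⟩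
  have := hE.mono_f h'
  rw [← cancel_mono (T.map i), Category.assoc, hd, naturality_ω]

/-- A morphism between the components in degree one which is compatible with the cokernels of `d0`
extends to a morphism of factorizations. -/
lemma exists_hom_of_cokernel {X Y : Factorization T ω} {M N : C} {p : X.X1 ⟶ M} {q : Y.X1 ⟶ N}
    {w : X.d0 ≫ p = 0} {w' : Y.d0 ≫ q = 0} (hY : E (ShortComplex.mk Y.d0 q w'))
    (φ : X.X1 ⟶ Y.X1) (ψ : M ⟶ N) (h : φ ≫ q = p ≫ ψ) : ∃ F : X ⟶ Y, F.f1 = φ := by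
  obtain ⟨f, hf⟩ := hE.exists_lift hY (X.d0 ≫ φ) (by
    rw [Category.assoc, h, ← Category.assoc, w, zero_comp])
  have := hE.mono_f (hT.map_conflation hY).choose_spec
  refine ⟨{ f0 := f, f1 := φ, comm0 := hf.symm, comm1 := ?_ }, rfl⟩
  rw [← cancel_mono (T.map Y.d0), Category.assoc, ← T.map_comp, hf, T.map_comp, ← Category.assoc,
    X.d1_d0, Category.assoc, Y.d1_d0, naturality_ω]

end

/-- A morphism of factorizations which induces zero on the cokernels of `d0` factors through
a contractible factorization. -/
lemma exists_factor_disk0 {C : Type u} [Category.{v} C] [Preadditive C] {T : C ⥤ C} {ω : 𝟭 C ⟶ T}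
    {E : ObjectProperty (ShortComplex C)} (hE : IsExactCategory E) {X Y : Factorization T ω} {N : C}
      {q : Y.X1 ⟶ N}
    {w' : Y.d0 ≫ q = 0} (hY : E (ShortComplex.mk Y.d0 q w')) (F : X ⟶ Y) (h : F.f1 ≫ q = 0) :
    ∃ (a : X ⟶ disk0 ω X.X1) (b : disk0 ω X.X1 ⟶ Y), a ≫ b = F := by
  obtain ⟨f, hf⟩ := hE.exists_lift hY F.f1 h
  have := hE.mono_f hY
  refine ⟨toDisk0 (𝟙 _), ofDisk0 f, hom_ext ?_ ?_⟩
  · change (X.d0 ≫ 𝟙 _) ≫ f = F.f0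
    rw [Category.comp_id, ← cancel_mono Y.d0, Category.assoc, hf, F.comm0]
  · change 𝟙 _ ≫ f ≫ Y.d0 = F.f1
    rw [Category.id_comp, hf]

end Factorization

/-! ### Two-dimensional factorizations -/

section

variable {C : Type u} [Category.{v} C] [Preadditive C] {D : Type u'} [Category.{v'} D]
  [Preadditive D] {E : ObjectProperty (ShortComplex C)} {P : ObjectProperty C}
  {E₁ : ObjectProperty (ShortComplex D)} {P₁ : ObjectProperty D}

lemma IsFrobeniusClass.isProjInj (hP : IsFrobeniusClass E P) {Q : C} (hQ : P Q)
    (h : IsProj E Q) : IsProjInj E P Q :=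
  hP.isProjInj_of_isProj (Q := ⟨Q, hQ⟩) (isProj_restrict h hQ)

lemma IsProjInj.of_retract {P Q : C} {R : ObjectProperty C} (hQ : IsProjInj E R Q) (hP : R P)
    (i : P ⟶ Q) (r : Q ⟶ P) (h : i ≫ r = 𝟙 P) : IsProjInj E R P :=
  ⟨hP, hQ.proj.of_retract i r h, hQ.inj.of_retract i r h⟩

/-- In a Frobenius class, the objects which a given exact functor sends to projective-injective
objects of another Frobenius class again form a Frobenius class, provided that they include
the projective-injective ones. -/
theorem IsFrobeniusClass.inter_projInj (hE₁ : IsExactCategory E₁)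
    (hP : IsFrobeniusClass E P) (hP₁ : IsFrobeniusClass E₁ P₁) (F : C ⥤ D) [F.Additive]
    (hF : ∀ S, E S → E₁ (S.map F)) (hPF : ∀ X, P X → P₁ (F.obj X))
    (hproj : ∀ X, IsProj E X → IsProj E₁ (F.obj X)) :
    IsFrobeniusClass E (fun X => P X ∧ IsProjInj E₁ P₁ (F.obj X)) := by
  have hmk : ∀ {X Y Z : C} {f : X ⟶ Y} {g : Y ⟶ Z} {w : f ≫ g = 0}, E (ShortComplex.mk f g w) →
      ∃ w', E₁ (ShortComplex.mk (F.map f) (F.map g) w') := fun h => ⟨_, hF _ h⟩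
  refine ⟨fun Z hZ => ⟨hP.zero Z hZ, hP₁.isProjInj (hPF _ (hP.zero Z hZ)) fun S hS f =>
    ⟨0, (F.map_isZero hZ).eq_of_src _ _⟩⟩, ⟨fun e h => ⟨hP.of_iso e h.1, ?_⟩⟩, ?_, ?_, ?_, ?_, ?_⟩
  · exact h.2.of_retract (hPF _ (hP.of_iso e h.1)) (F.map e.inv) (F.map e.hom) (by
      rw [← F.map_comp, e.inv_hom_id, F.map_id])
  · rintro ⟨f, g, w⟩ hS h₁ h₃
    have h₂ := hP.ext _ hS h₁.1 h₃.1
    obtain ⟨w', hS'⟩ := hmk hS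
    refine ⟨h₂, hP₁.isProjInj (hPF _ h₂) ?_⟩
    obtain ⟨s, hs⟩ := h₃.2.proj.lift hS' (𝟙 _)
    obtain ⟨r, hr⟩ := hE₁.exists_lift hS' (𝟙 _ - F.map g ≫ s) (by simp [hs])
    rintro ⟨i, d, w₁⟩ h f'
    obtain ⟨k, hk⟩ := h₁.2.proj.lift h (F.map f ≫ f')
    obtain ⟨l, hl⟩ := h₃.2.proj.lift h (s ≫ f')
    refine ⟨r ≫ k + F.map g ≫ l, ?_⟩
    change (r ≫ k + F.map g ≫ l) ≫ d = f'
    rw [Preadditive.add_comp, Category.assoc, Category.assoc, hk, hl, ← Category.assoc, hr]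
    simp
  · rintro ⟨f, g, w⟩ hS h₂ h₃
    have h₁ := hP.ker _ hS h₂.1 h₃.1
    obtain ⟨w', hS'⟩ := hmk hS
    obtain ⟨s, hs⟩ := h₃.2.proj.lift hS' (𝟙 _)
    obtain ⟨r, hr⟩ := hE₁.exists_lift hS' (𝟙 _ - F.map g ≫ s) (by simp [hs])
    have := hE₁.mono_f hS'
    refine ⟨h₁, h₂.2.of_retract (hPF _ h₁) (F.map f) r ?_⟩
    rw [← cancel_mono (F.map f), Category.assoc, hr]
    simp [reassoc_of% w']
  · intro X Y W Z Z' f g p q w w' h h' hX hY hW hZ'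
    have hZ := hP.coker f g p q w w' h h' hX.1 hY.1 hW.1 hZ'.1
    obtain ⟨w₁, h₁⟩ := hmk h
    obtain ⟨w₁', h₁'⟩ := hmk h'
    -- The composite `F(f) ≫ F(g)` is a split monomorphism, and hence so is `F(f)`.
    obtain ⟨r, hr⟩ := hX.2.inj.extend h₁' hX.2.mem hW.2.mem hZ'.2.mem (𝟙 _)
    have hr' : F.map f ≫ F.map g ≫ r = 𝟙 _ := by
      rw [← hr, F.map_comp, Category.assoc]
    obtain ⟨s, hs⟩ := hE₁.exists_desc h₁ (𝟙 _ - (F.map g ≫ r) ≫ F.map f) (by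
      rw [Preadditive.comp_sub, ← Category.assoc, hr']
      simp)
    have := hE₁.epi_g h₁
    refine ⟨hZ, hY.2.of_retract (hPF _ hZ) s (F.map p) ?_⟩
    rw [← cancel_epi (F.map p), ← Category.assoc, hs]
    simp [w₁]
  · intro X hX
    obtain ⟨Q, d, hd, hQ⟩ := hP.enoughProj X hX.1
    exact ⟨Q, d, hd, ⟨hQ.mem, hP₁.isProjInj (hPF _ hQ.mem) (hproj _ hQ.proj)⟩, hQ.proj,
      fun S hS e₁ e₂ e₃ f => hQ.inj S hS e₁.1 e₂.1 e₃.1 f⟩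
  · intro X hX
    obtain ⟨Q, Z, i, p, w, h, hZ, hQ⟩ := hP.enoughInj X hX.1
    have hQ' := hP₁.isProjInj (hPF _ hQ.mem) (hproj _ hQ.proj)
    obtain ⟨w', h'⟩ := hmk h
    have := hE₁.epi_g h'
    obtain ⟨r, hr⟩ := hX.2.inj.extend h' hX.2.mem hQ'.mem (hPF _ hZ) (𝟙 _)
    obtain ⟨s, hs⟩ := hE₁.exists_desc h' (𝟙 _ - r ≫ F.map i) (by
      rw [Preadditive.comp_sub, ← Category.assoc, hr]
      simp)
    refine ⟨Q, Z, i, p, w, h, ⟨hZ, hQ'.of_retract (hPF _ hZ) s (F.map p) ?_⟩,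
      ⟨hQ.mem, hQ'⟩, hQ.proj, fun S hS e₁ e₂ e₃ f => hQ.inj S hS e₁.1 e₂.1 e₃.1 f⟩
    rw [← cancel_epi (F.map p), ← Category.assoc, hs]
    simp [w']

lemma IsFrobeniusClass.isProjIn_iff {T : C ⥤ C} [T.Additive] {ω : 𝟭 C ⟶ T}
    (hP : IsFrobeniusClass (Factorization.conflations (ω := ω) E) (Factorization.components P))
    (X : Factorization T ω) : Factorization.IsProjIn E P X ↔
      IsProjInj (Factorization.conflations E) (Factorization.components P) X :=
  ⟨fun ⟨_, h⟩ => hP.isProjInj_of_isProj h, fun h => ⟨h.mem, isProj_restrict h.proj h.mem⟩⟩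

end

namespace CommutingPair

section

variable {C : Type u} [Category.{v} C] (K : CommutingPair C)

open Factorization

lemma naturality_ξ {X Y : C} (f : X ⟶ Y) :
    K.T'.map (K.T.map f) ≫ K.ξ.hom.app Y = K.ξ.hom.app X ≫ K.T.map (K.T'.map f) :=
  K.ξ.hom.naturality f

lemma isEquivalence_liftT' : K.liftT'.IsEquivalence := by
  have := K.isEquivalence
  have := K.isEquivalence'
  have hf : K.liftT'.Faithful := ⟨fun h =>
    hom_ext (K.T'.map_injective (congrArg Hom.f0 h)) (K.T'.map_injective (congrArg Hom.f1 h))⟩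
  have hF : K.liftT'.Full := ⟨fun {X Y} g => by
    obtain ⟨g₀, g₁, h₀, h₁⟩ := g
    change K.T'.obj X.X0 ⟶ K.T'.obj Y.X0 at g₀
    change K.T'.obj X.X1 ⟶ K.T'.obj Y.X1 at g₁
    change K.T'.map X.d0 ≫ g₁ = g₀ ≫ K.T'.map Y.d0 at h₀
    change (K.T'.map X.d1 ≫ K.ξ.hom.app X.X0) ≫ K.T.map g₀ =
      g₁ ≫ K.T'.map Y.d1 ≫ K.ξ.hom.app Y.X0 at h₁
    obtain ⟨f₀, rfl⟩ := K.T'.map_surjective g₀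
    obtain ⟨f₁, rfl⟩ := K.T'.map_surjective g₁
    refine ⟨{ f0 := f₀, f1 := f₁, comm0 := K.T'.map_injective ?_, comm1 := K.T'.map_injective ?_ },
      rfl⟩
    · rw [K.T'.map_comp, K.T'.map_comp, h₀]
    · rw [← cancel_mono (K.ξ.hom.app Y.X0), K.T'.map_comp, Category.assoc, K.naturality_ξ,
        K.T'.map_comp, ← Category.assoc, h₁, Category.assoc]⟩
  have hs : K.liftT'.EssSurj := ⟨fun Y => by
    let e₀ := K.T'.objObjPreimageIso Y.X0
    let e₁ := K.T'.objObjPreimageIso Y.X1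
    let d₀ := K.T'.preimage (e₀.hom ≫ Y.d0 ≫ e₁.inv)
    let d₁ := K.T'.preimage (e₁.hom ≫ Y.d1 ≫ K.T.map e₀.inv ≫ K.ξ.inv.app _)
    have h₀ : K.T'.map d₀ = e₀.hom ≫ Y.d0 ≫ e₁.inv := K.T'.map_preimage _
    have h₁ : K.T'.map d₁ ≫ K.ξ.hom.app _ = e₁.hom ≫ Y.d1 ≫ K.T.map e₀.inv := by
      rw [K.T'.map_preimage]
      simp
    refine ⟨{ X0 := K.T'.objPreimage Y.X0, X1 := K.T'.objPreimage Y.X1, d0 := d₀, d1 := d₁,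
              d0_d1 := K.T'.map_injective ?_, d1_d0 := K.T'.map_injective ?_ },
            ⟨isoMk e₀ e₁ ?_ ?_⟩⟩
    · rw [← cancel_mono (K.ξ.hom.app _), ← K.ω_T', K.T'.map_comp, Category.assoc, h₁, h₀,
        Category.assoc, Category.assoc, e₁.inv_hom_id_assoc, reassoc_of% Y.d0_d1, ← naturality_ω,
        e₀.hom_inv_id_assoc]
    · rw [← cancel_mono (K.ξ.hom.app _), ← K.ω_T', K.T'.map_comp, Category.assoc, K.naturality_ξ,
        reassoc_of% h₁, h₀, ← K.T.map_comp, e₀.inv_hom_id_assoc, K.T.map_comp,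
        reassoc_of% Y.d1_d0, ← naturality_ω, e₁.hom_inv_id_assoc]
    · change K.T'.map d₀ ≫ e₁.hom = e₀.hom ≫ Y.d0
      rw [h₀]
      simp
    · change (K.T'.map d₁ ≫ K.ξ.hom.app _) ≫ K.T.map e₀.hom = e₁.hom ≫ Y.d1
      rw [h₁, Category.assoc, Category.assoc, ← K.T.map_comp, e₀.inv_hom_id, K.T.map_id,
        Category.comp_id]⟩
  exact { }

lemma liftω'_liftT' (X : Factorization K.T K.ω) :
    K.liftω'.app (K.liftT'.obj X) = K.liftT'.map (K.liftω'.app X) :=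
  hom_ext (K.ω'_T' _) (K.ω'_T' _)

/-- The functor sending a two-dimensional factorization to its column `(X^{1,0}, X^{1,1})`. -/
def column1Functor : K.Factorization₂ ⥤ Factorization K.T' K.ω' where
  obj := K.column1
  map f :=
    { f0 := f.f0.f1
      f1 := f.f1.f1
      comm0 := congrArg Hom.f1 f.comm0
      comm1 := congrArg Hom.f1 f.comm1 }

/-- The column `(X^{0,0}, X^{0,1})` of a two-dimensional factorization. -/
def column0 (X : K.Factorization₂) : Factorization K.T' K.ω' where
  X0 := X.X0.X0
  X1 := X.X1.X0
  d0 := X.d0.f0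
  d1 := X.d1.f0
  d0_d1 := congrArg Factorization.Hom.f0 X.d0_d1
  d1_d0 := congrArg Factorization.Hom.f0 X.d1_d0

/-- The functor sending a two-dimensional factorization to its column `(X^{0,0}, X^{0,1})`. -/
def column0Functor : K.Factorization₂ ⥤ Factorization K.T' K.ω' where
  obj := K.column0
  map f :=
    { f0 := f.f0.f0
      f1 := f.f1.f0
      comm0 := congrArg Hom.f0 f.comm0
      comm1 := congrArg Hom.f0 f.comm1 }

/-- The two-dimensional factorization with contractible rows both of whose columns are `M`. It is
the image of `M` under the right adjoint of the functor `column1Functor`, which is also the left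
adjoint of `column0Functor`. -/
def diskRows (M : Factorization K.T' K.ω') : K.Factorization₂ where
  X0 := disk0 K.ω M.X0
  X1 := disk0 K.ω M.X1
  d0 :=
    { f0 := M.d0
      f1 := M.d0
      comm0 := (Category.id_comp _).trans (Category.comp_id _).symm
      comm1 := (naturality_ω _).symm }
  d1 :=
    { f0 := M.d1
      f1 := M.d1
      comm0 := (Category.id_comp _).trans (by
        change _ = M.d1 ≫ K.T'.map (𝟙 _)
        rw [K.T'.map_id, Category.comp_id])
      comm1 := by
        change K.ω.app M.X1 ≫ K.T.map M.d1 = M.d1 ≫ K.T'.map (K.ω.app M.X0) ≫ K.ξ.hom.app M.X0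
        rw [← naturality_ω, K.ω_T'] }
  d0_d1 := hom_ext M.d0_d1 M.d0_d1
  d1_d0 := hom_ext M.d1_d0 M.d1_d0

/-- The morphism `X ⟶ diskRows M` given by a morphism from the column `(X^{1,0}, X^{1,1})`. -/
def toDiskRows {X : K.Factorization₂} {M : Factorization K.T' K.ω'} (f₀ : X.X0.X1 ⟶ M.X0)
    (f₁ : X.X1.X1 ⟶ M.X1) (h₀ : X.d0.f1 ≫ f₁ = f₀ ≫ M.d0)
    (h₁ : X.d1.f1 ≫ K.T'.map f₀ = f₁ ≫ M.d1) : X ⟶ K.diskRows M where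
  f0 := toDisk0 f₀
  f1 := toDisk0 f₁
  comm0 := hom_ext (show X.d0.f0 ≫ X.X1.d0 ≫ f₁ = (X.X0.d0 ≫ f₀) ≫ M.d0 by
    rw [← Category.assoc, ← X.d0.comm0, Category.assoc, h₀, Category.assoc]) h₀
  comm1 := hom_ext (show X.d1.f0 ≫ K.T'.map (X.X0.d0 ≫ f₀) = (X.X1.d0 ≫ f₁) ≫ M.d1 by
    have h' : X.X1.d0 ≫ X.d1.f1 = X.d1.f0 ≫ K.T'.map X.X0.d0 := X.d1.comm0
    rw [K.T'.map_comp, Category.assoc, ← h₁]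
    exact ((Category.assoc _ _ _).symm.trans (congrArg (· ≫ K.T'.map f₀) h'.symm)).trans
      (Category.assoc _ _ _)) h₁

/-- The morphism `diskRows M ⟶ X` given by a morphism to the column `(X^{0,0}, X^{0,1})`. -/
def ofDiskRows {X : K.Factorization₂} {M : Factorization K.T' K.ω'} (f₀ : M.X0 ⟶ X.X0.X0)
    (f₁ : M.X1 ⟶ X.X1.X0) (h₀ : M.d0 ≫ f₁ = f₀ ≫ X.d0.f0)
    (h₁ : M.d1 ≫ K.T'.map f₀ = f₁ ≫ X.d1.f0) : K.diskRows M ⟶ X where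
  f0 := ofDisk0 f₀
  f1 := ofDisk0 f₁
  comm0 := hom_ext h₀ (show M.d0 ≫ f₁ ≫ X.X1.d0 = (f₀ ≫ X.X0.d0) ≫ X.d0.f1 by
    rw [← Category.assoc, h₀, Category.assoc, Category.assoc, X.d0.comm0])
  comm1 := hom_ext h₁ (show M.d1 ≫ K.T'.map (f₀ ≫ X.X0.d0) = (f₁ ≫ X.X1.d0) ≫ X.d1.f1 by
    have h' : X.X1.d0 ≫ X.d1.f1 = X.d1.f0 ≫ K.T'.map X.X0.d0 := X.d1.comm0
    rw [K.T'.map_comp, ← Category.assoc, h₁, Category.assoc]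
    exact (Category.assoc _ _ _).trans (congrArg (f₁ ≫ ·) h'.symm))

end

section

variable {C : Type u} [Category.{v} C] (K : CommutingPair C)

open Factorization

/-- The functor `diskRows`. -/
def diskRowsFunctor : Factorization K.T' K.ω' ⥤ K.Factorization₂ where
  obj := K.diskRows
  map {M N} g :=
    { f0 := (disk0Functor K.T K.ω).map g.f0
      f1 := (disk0Functor K.T K.ω).map g.f1
      comm0 := hom_ext g.comm0 g.comm0
      comm1 := hom_ext g.comm1 g.comm1 }

/-- The functor `column1Functor` is left adjoint to `diskRows`. -/
def column1Adjunction : K.column1Functor ⊣ K.diskRowsFunctor :=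
  Adjunction.mkOfHomEquiv
    { homEquiv := fun _ _ =>
        { toFun := fun f => K.toDiskRows f.f0 f.f1 f.comm0 f.comm1
          invFun := fun f =>
            { f0 := f.f0.f1
              f1 := f.f1.f1
              comm0 := congrArg Hom.f1 f.comm0
              comm1 := congrArg Hom.f1 f.comm1 }
          left_inv := fun _ => rfl
          right_inv := fun f => hom_ext (hom_ext (f.f0.comm0.trans (Category.comp_id _)) rfl)
            (hom_ext (f.f1.comm0.trans (Category.comp_id _)) rfl) }
      homEquiv_naturality_left_symm := fun _ _ => rfl
      homEquiv_naturality_right := fun _ _ => hom_ext (hom_ext (Category.assoc _ _ _).symm rfl)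
        (hom_ext (Category.assoc _ _ _).symm rfl) }

/-- The functor `column0Functor` is right adjoint to `diskRows`. -/
def diskRowsAdjunction : K.diskRowsFunctor ⊣ K.column0Functor :=
  Adjunction.mkOfHomEquiv
    { homEquiv := fun _ _ =>
        { toFun := fun f =>
            { f0 := f.f0.f0
              f1 := f.f1.f0
              comm0 := congrArg Hom.f0 f.comm0
              comm1 := congrArg Hom.f0 f.comm1 }
          invFun := fun f => K.ofDiskRows f.f0 f.f1 f.comm0 f.comm1
          left_inv := fun f => hom_ext (hom_ext rfl (f.f0.comm0.symm.trans (Category.id_comp _)))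
            (hom_ext rfl (f.f1.comm0.symm.trans (Category.id_comp _)))
          right_inv := fun _ => rfl }
      homEquiv_naturality_left_symm := fun _ _ => hom_ext (hom_ext rfl (Category.assoc _ _ _))
        (hom_ext rfl (Category.assoc _ _ _))
      homEquiv_naturality_right := fun _ _ => rfl }

end

section

open Factorization

variable {C : Type u} [Category.{v} C] [Preadditive C] (K : CommutingPair C) [K.T.Additive]
  [K.T'.Additive] {E : ObjectProperty (ShortComplex C)} {P : ObjectProperty C}

instance : K.column1Functor.Additive where
  map_add := rfl

instance : K.column0Functor.Additive where
  map_add := rfl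

lemma isExactAutoequivalence_liftT' (hT' : IsExactAutoequivalence K.T' E) :
    IsExactAutoequivalence K.liftT' (conflations E) :=
  ⟨K.isEquivalence_liftT', fun S =>
    ⟨fun h => ⟨(hT'.conflation_iff (S.map (pr0 K.T K.ω))).1 h.1,
      (hT'.conflation_iff (S.map (pr1 K.T K.ω))).1 h.2⟩,
     fun h => ⟨(hT'.conflation_iff (S.map (pr0 K.T K.ω))).2 h.1,
      (hT'.conflation_iff (S.map (pr1 K.T K.ω))).2 h.2⟩⟩⟩

instance : K.diskRowsFunctor.Additive where
  map_add := rfl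

lemma isProj_X1 {X : K.Factorization₂} (hX : IsProj (K.conflations₂ E) X) :
    IsProj (conflations E) X.X1 :=
  hX.map_of_adjunction (pr1Adjunction K.liftT' K.liftω') fun _ hS => ⟨hS, hS⟩

lemma isProj_column1 {X : K.Factorization₂} (hX : IsProj (K.conflations₂ E) X) :
    IsProj (conflations E) (K.column1 X) :=
  hX.map_of_adjunction K.column1Adjunction fun _ hS => ⟨⟨hS.1, hS.1⟩, ⟨hS.2, hS.2⟩⟩

lemma isProj_diskRows {M : Factorization K.T' K.ω'} (hM : IsProj (conflations E) M) :
    IsProj (K.conflations₂ E) (K.diskRows M) :=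
  hM.map_of_adjunction K.diskRowsAdjunction fun _ hS => ⟨hS.1.1, hS.2.1⟩

/-- The two autoequivalences preserve and detect the conflations and the objects of the Frobenius
class `P`. -/
structure IsCompatible (E : ObjectProperty (ShortComplex C)) (P : ObjectProperty C) : Prop where
  exact : IsWICExactCategory E
  frobenius : IsFrobeniusClass E P
  autT : IsExactAutoequivalence K.T E
  autT' : IsExactAutoequivalence K.T' E
  memT : ∀ X, P (K.T.obj X) ↔ P X
  memT' : ∀ X, P (K.T'.obj X) ↔ P X

namespace IsCompatible

variable {K} (h : K.IsCompatible E P)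

include h

lemma exact_row : IsWICExactCategory (conflations (T := K.T) (ω := K.ω) E) :=
  isWICExactCategory h.exact h.autT

lemma exact_column : IsWICExactCategory (conflations (T := K.T') (ω := K.ω') E) :=
  isWICExactCategory h.exact h.autT'

lemma exact₂ : IsWICExactCategory (K.conflations₂ E) :=
  isWICExactCategory h.exact_row (K.isExactAutoequivalence_liftT' h.autT')

lemma frobenius_row : IsFrobeniusClass (conflations (T := K.T) (ω := K.ω) E) (components P) :=
  isFrobeniusClass h.exact h.autT K.ω_T h.frobenius h.memT

lemma frobenius_column :
    IsFrobeniusClass (conflations (T := K.T') (ω := K.ω') E) (components P) :=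
  isFrobeniusClass h.exact h.autT' K.ω'_T' h.frobenius h.memT'

lemma components_liftT' (X : Factorization K.T K.ω) :
    components P (K.liftT'.obj X) ↔ components P X :=
  and_congr (h.memT' _) (h.memT' _)

lemma frobenius₂ : IsFrobeniusClass (K.conflations₂ E) (components (components P)) :=
  isFrobeniusClass h.exact_row (K.isExactAutoequivalence_liftT' h.autT') K.liftω'_liftT'
    h.frobenius_row h.components_liftT'

lemma zeroZero_iff (X : K.Factorization₂) : K.zeroZero E P X ↔
    components (components P) X ∧ IsProjInj (conflations E) (components P) X.X1 ∧
      IsProjInj (conflations E) (components P) (K.column1 X) :=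
  and_congr_right fun _ =>
    and_congr (h.frobenius_row.isProjIn_iff _) (h.frobenius_column.isProjIn_iff _)

/-- The two-dimensional factorizations with projective factorizations through `X^{1,1}` form
a Frobenius class. -/
theorem frobenius_zeroZero : IsFrobeniusClass (K.conflations₂ E) (K.zeroZero E P) := by
  have h₁ := IsFrobeniusClass.inter_projInj h.exact_row.toIsExactCategory h.frobenius₂
    h.frobenius_row (pr1 K.liftT' K.liftω') (fun _ hS => hS.2) (fun _ hX => hX.2)
    (fun _ hX => K.isProj_X1 hX)
  have h₂ := IsFrobeniusClass.inter_projInj h.exact_column.toIsExactCategory h₁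
    h.frobenius_column K.column1Functor (fun _ hS => ⟨hS.1.2, hS.2.2⟩)
    (fun _ hX => ⟨hX.1.1.2, hX.1.2.2⟩) (fun _ hX => K.isProj_column1 hX)
  convert h₂ using 1
  ext X
  rw [h.zeroZero_iff, and_assoc]
  rfl

/-- The contractible two-dimensional factorization on a projective row is a projective object
of the Frobenius category. -/
lemma isProj_disk0 {X : Factorization K.T K.ω}
    (hX : IsProjInj (conflations E) (components P) X) :
    ∃ hX' : K.zeroZero E P (disk0 K.liftω' X),
      IsProj (restrictConflations (K.conflations₂ E) (K.zeroZero E P)) ⟨_, hX'⟩ := by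
  have hp : IsProj (K.conflations₂ E) (disk0 K.liftω' X) := Factorization.isProj_disk0 hX.proj
  have hm : components (components P) (disk0 K.liftω' X) := ⟨hX.mem, hX.mem⟩
  exact ⟨(h.zeroZero_iff _).2 ⟨hm, hX, h.frobenius_column.isProjInj ⟨hX.mem.2, hX.mem.2⟩
    (K.isProj_column1 hp)⟩, IsFrobeniusClass.isProj_restrict hp _⟩

/-- The two-dimensional factorization with contractible rows on a projective column is
a projective object of the Frobenius category. -/
lemma isProj_diskRows {M : Factorization K.T' K.ω'}
    (hM : IsProjInj (conflations E) (components P) M) :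
    ∃ hX' : K.zeroZero E P (K.diskRows M),
      IsProj (restrictConflations (K.conflations₂ E) (K.zeroZero E P)) ⟨_, hX'⟩ := by
  have hp : IsProj (K.conflations₂ E) (K.diskRows M) := K.isProj_diskRows hM.proj
  have hm : components (components P) (K.diskRows M) :=
    ⟨⟨hM.mem.1, hM.mem.1⟩, ⟨hM.mem.2, hM.mem.2⟩⟩
  exact ⟨(h.zeroZero_iff _).2 ⟨hm, h.frobenius_row.isProjInj hm.2 (K.isProj_X1 hp), hM⟩,
    IsFrobeniusClass.isProj_restrict hp _⟩

end IsCompatible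

end

end CommutingPair

namespace Factorization

variable {C : Type u} [Category.{v} C] [Preadditive C] {T : C ⥤ C} {ω : 𝟭 C ⟶ T} [T.Additive]
  {E : ObjectProperty (ShortComplex C)} {P : ObjectProperty C}

/-- The cokernel of `d0` is annihilated by `ω`. -/
lemma ω_cokernel_eq_zero (hE : IsExactCategory E) {X : Factorization T ω} {N : C} {q : X.X1 ⟶ N}
    {w : X.d0 ≫ q = 0} (h : E (ShortComplex.mk X.d0 q w)) : ω.app N = 0 := by
  have := hE.epi_g h
  rw [← cancel_epi q, naturality_ω, ← X.d1_d0, Category.assoc, ← T.map_comp, w, T.map_zero,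
    comp_zero, comp_zero]

/-- A morphism to the target of a deflation `d : Y ⟶ Z` lifts along `d` if the map which it
induces on the cokernels of `d0` lifts. -/
lemma exists_lift_of_cokernel (hE : IsWICExactCategory E) (hT : IsExactAutoequivalence T E)
    {M Y Z : Factorization T ω} (hM₁ : IsProj E M.X1) {d : Y ⟶ Z}
      (hd : IsDeflation (conflations E) d)
    {N NY NZ : C} {p : M.X1 ⟶ N} {w : M.d0 ≫ p = 0} (hp : E (ShortComplex.mk M.d0 p w))
    {q : Y.X1 ⟶ NY} {wY : Y.d0 ≫ q = 0} (hY : E (ShortComplex.mk Y.d0 q wY))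
    {r : Z.X1 ⟶ NZ} {wZ : Z.d0 ≫ r = 0} (hZ : E (ShortComplex.mk Z.d0 r wZ))
    (hN : ∀ δ : NY ⟶ NZ, IsDeflation E δ → ∀ f : N ⟶ NZ, ∃ k, k ≫ δ = f) (f : M ⟶ Z) :
    ∃ k, k ≫ d = f := by
  have hE' := hE.toIsExactCategory
  have hd₁ := ((isDeflation_iff hE hT d).1 hd).2
  obtain ⟨δ, hδ⟩ := hE.exists_desc hY (d.f1 ≫ r) (by
    rw [← Category.assoc, d.comm0, Category.assoc, wZ, comp_zero])
  obtain ⟨φ, hφ⟩ := hE.exists_desc hp (f.f1 ≫ r) (by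
    rw [← Category.assoc, f.comm0, Category.assoc, wZ, comp_zero])
  obtain ⟨k, rfl⟩ := hN δ (hE.deflation_of_comp q δ (hδ ▸ hE.ex1 _ _ hd₁ ⟨_, _, _, hZ⟩)) φ
  obtain ⟨g, hg⟩ := hM₁.lift hY (p ≫ k)
  obtain ⟨G, rfl⟩ := exists_hom_of_cokernel hE' hT (w := w) hY g k hg
  obtain ⟨a, b, hab⟩ := exists_factor_disk0 hE' hZ (f - G ≫ d) (by
    change (f.f1 + -(G.f1 ≫ d.f1)) ≫ r = 0
    rw [← sub_eq_add_neg, Preadditive.sub_comp, Category.assoc, ← hδ, ← Category.assoc, hg, ← hφ,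
      Category.assoc, sub_self])
  obtain ⟨l, hl⟩ := (isProj_disk0 (ω := ω) hM₁).exists_lift hd b
  refine ⟨G + a ≫ l, ?_⟩
  rw [Preadditive.add_comp, Category.assoc, hl, hab, add_sub_cancel]

/-- A factorization is projective relative to the conflations with components in `P` if its
component in degree one is projective and the cokernel of `d0` is projective relative to
the deflations between objects annihilated by `ω`. -/
lemma isProjIn_of_cokernel (hE : IsWICExactCategory E) (hT : IsExactAutoequivalence T E)
    (hP : ∀ X : Factorization T ω, components P X → ∃ (N : C) (q : X.X1 ⟶ N) (w : X.d0 ≫ q = 0),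
      E (ShortComplex.mk X.d0 q w))
    {M : Factorization T ω} (hM : components P M) (hM₁ : IsProj E M.X1) {N : C} {p : M.X1 ⟶ N}
    {w : M.d0 ≫ p = 0} (hp : E (ShortComplex.mk M.d0 p w))
    (hN : ∀ {N₁ N₂ : C} (d : N₁ ⟶ N₂), IsDeflation E d → ω.app N₁ = 0 → ω.app N₂ = 0 →
      ∀ f : N ⟶ N₂, ∃ k, k ≫ d = f) : IsProjIn E P M := by
  refine ⟨hM, fun S hS h => ?_⟩
  obtain ⟨NY, q, wY, hY⟩ := hP _ S.X₂.property
  obtain ⟨NZ, r, wZ, hZ⟩ := hP _ S.X₃.property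
  obtain ⟨k, hk⟩ := exists_lift_of_cokernel hE hT (M := M) (d := S.g.hom) hM₁ ⟨_, _, _, hS⟩ hp hY hZ
    (fun δ hδ => hN δ hδ (ω_cokernel_eq_zero hE.toIsExactCategory hY)
      (ω_cokernel_eq_zero hE.toIsExactCategory hZ)) h.hom
  exact ⟨ObjectProperty.homMk k, ObjectProperty.hom_ext _ hk⟩

/-- An object `M` annihilated by `ω` as a factorization `0 ⟶ M`. -/
def ofZero {Z M : C} (hZ : IsZero Z) (hM : ω.app M = 0) : Factorization T ω where
  X0 := Z
  X1 := M
  d0 := 0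
  d1 := 0
  d0_d1 := hZ.eq_of_src _ _
  d1_d0 := by rw [zero_comp, hM]

/-- The morphism to `0 ⟶ M` given by a morphism to `M` which vanishes on the image of `d0`. -/
def toOfZero {Z M : C} (hZ : IsZero Z) (hM : ω.app M = 0) {J : Factorization T ω} (f : J.X1 ⟶ M)
    (hf : J.d0 ≫ f = 0) : J ⟶ ofZero hZ hM where
  f0 := 0
  f1 := f
  comm0 := hf.trans (zero_comp (f := (0 : Z ⟶ M))).symm
  comm1 := by
    rw [T.map_zero, comp_zero]
    exact (comp_zero (f := f) (Z := T.obj Z)).symm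

lemma isZero_of_components {X : Factorization T ω} (h₀ : IsZero X.X0) (h₁ : IsZero X.X1) :
    IsZero X :=
  (IsZero.iff_id_eq_zero X).2 (hom_ext (h₀.eq_of_src _ _) (h₁.eq_of_src _ _))

lemma isDeflation_toOfZero (hE : IsWICExactCategory E) (hT : IsExactAutoequivalence T E)
    {Z M₁ M₂ : C} (hZ : IsZero Z) (h₁ : ω.app M₁ = 0) (h₂ : ω.app M₂ = 0) {d : M₁ ⟶ M₂}
    (hd : IsDeflation E d) : IsDeflation (conflations E)
      (toOfZero hZ h₂ (J := ofZero hZ h₁) d (zero_comp (f := d))) := by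
  refine (isDeflation_iff hE hT _).2 ⟨?_, hd⟩
  have h : (0 : Z ⟶ Z) = 𝟙 Z := hZ.eq_of_src _ _
  change IsDeflation E (0 : Z ⟶ Z)
  exact h ▸ hE.isDeflation_id Z

/-- Lifting problems for morphisms from the cokernel of `d0` reduce to lifting problems for
morphisms from the factorization. -/
lemma exists_lift_of_toOfZero (hE : IsExactCategory E) {J : Factorization T ω} {N : C}
    {p : J.X1 ⟶ N} {w : J.d0 ≫ p = 0} (hp : E (ShortComplex.mk J.d0 p w)) {Z M₁ M₂ : C}
    (hZ : IsZero Z) (h₁ : ω.app M₁ = 0) (h₂ : ω.app M₂ = 0) {d : M₁ ⟶ M₂}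
    (hJ : ∀ f : J ⟶ ofZero hZ h₂, ∃ k : J ⟶ ofZero hZ h₁,
      k ≫ toOfZero hZ h₂ (J := ofZero hZ h₁) d (zero_comp (f := d)) = f) (f : N ⟶ M₂) :
    ∃ k, k ≫ d = f := by
  obtain ⟨⟨k₀, k₁, c₀, c₁⟩, hk⟩ := hJ (toOfZero hZ h₂ (p ≫ f) (by rw [reassoc_of% w, zero_comp]))
  change J.X1 ⟶ M₁ at k₁
  have hk₁ : k₁ ≫ d = p ≫ f := congrArg Hom.f1 hk
  obtain ⟨l, hl⟩ := hE.exists_desc hp k₁ (c₀.trans (comp_zero (f := k₀) (Z := M₁)))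
  have := hE.epi_g hp
  exact ⟨l, by rw [← cancel_epi p, ← Category.assoc, hl, hk₁]⟩

end Factorization

namespace CommutingPair

open Factorization

variable {C : Type u} [Category.{v} C] [Preadditive C] {K : CommutingPair C} [K.T.Additive]
  [K.T'.Additive] {E : ObjectProperty (ShortComplex C)} {P : ObjectProperty C}

/-- A presentation of a total-cokernel by two conflations: `Q` is the cokernel of `X.d0`
in the category of `ω`-factorizations, and `N` is the cokernel of `Q.d0`. -/
structure TotalCokernel (E : ObjectProperty (ShortComplex C)) (X : K.Factorization₂) where
  Q : Factorization K.T K.ω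
  q : X.X1 ⟶ Q
  w : X.d0 ≫ q = 0
  conflation : conflations E (ShortComplex.mk X.d0 q w)
  N : C
  p : Q.X1 ⟶ N
  w' : Q.d0 ≫ p = 0
  conflation' : E (ShortComplex.mk Q.d0 p w')

/-- The projection from `X^{1,1}` to the total-cokernel. -/
def TotalCokernel.π {X : K.Factorization₂} (c : TotalCokernel E X) : X.X1.X1 ⟶ c.N := c.q.f1 ≫ c.p

variable (h : K.IsCompatible E P) {X Y : K.Factorization₂}
include h

/-- A morphism between total-cokernels is induced by a morphism of two-dimensional
factorizations. -/
lemma exists_hom_of_totalCokernel (cX : TotalCokernel E X) (cY : TotalCokernel E Y)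
    (hX : IsProj (conflations E) X.X1)
    (hQ : ∀ f : cX.Q.X1 ⟶ cY.N, ∃ k, k ≫ cY.p = f) (g : cX.N ⟶ cY.N) :
    ∃ F : X ⟶ Y, F.f1.f1 ≫ cY.π = cX.π ≫ g := by
  -- The morphism lifts first to the quotients `cX.Q ⟶ cY.Q`, and then from these to `X ⟶ Y`.
  obtain ⟨k, hk⟩ := hQ (cX.p ≫ g)
  obtain ⟨F, rfl⟩ := exists_hom_of_cokernel h.exact.toIsExactCategory h.autT (w := cX.w')
    cY.conflation' k g hk
  obtain ⟨G, hG⟩ := hX.lift cY.conflation (cX.q ≫ F)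
  obtain ⟨H, rfl⟩ := exists_hom_of_cokernel h.exact_row.toIsExactCategory
    (K.isExactAutoequivalence_liftT' h.autT') (w := cX.w) cY.conflation G F hG
  have hG' : H.f1.f1 ≫ cY.q.f1 = cX.q.f1 ≫ F.f1 := congrArg Hom.f1 hG
  exact ⟨H, by rw [TotalCokernel.π, TotalCokernel.π, ← Category.assoc, hG', Category.assoc, hk,
    Category.assoc]⟩

/-- A morphism which induces zero on total-cokernels factors through a sum of two contractible
two-dimensional factorizations. -/
lemma exists_factor_of_totalCokernel_eq_zero (cX : TotalCokernel E X)
    (cY : TotalCokernel E Y) (hX : IsProj E X.X1.X1) (F : X ⟶ Y) (hF : F.f1.f1 ≫ cY.π = 0) :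
    ∃ (a : X ⟶ disk0 K.liftω' X.X1) (b : disk0 K.liftω' X.X1 ⟶ Y)
      (a' : X ⟶ K.diskRows (K.column1 X)) (b' : K.diskRows (K.column1 X) ⟶ Y),
      a ≫ b + a' ≫ b' = F := by
  have hE := h.exact.toIsExactCategory
  have hE' := h.exact_row.toIsExactCategory
  have hq := conflations_mk_iff.1 cX.conflation
  have hqY := conflations_mk_iff.1 cY.conflation
  have := hE.epi_g hq.2
  -- The map induced by `F` on the cokernels in the vertical direction.
  obtain ⟨G, hG⟩ := hE'.exists_desc cX.conflation (F.f1 ≫ cY.q) (by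
    rw [← Category.assoc, F.comm0, Category.assoc, cY.w, comp_zero])
  have hG₁ : cX.q.f1 ≫ G.f1 = F.f1.f1 ≫ cY.q.f1 := congrArg Hom.f1 hG
  obtain ⟨s, hs⟩ := hE.exists_lift cY.conflation' G.f1 (by
    rw [← cancel_epi cX.q.f1, ← Category.assoc, hG₁, comp_zero, Category.assoc]
    exact hF)
  -- It is null-homotopic; the homotopy lifts to a morphism of columns.
  obtain ⟨t, ht⟩ := hX.lift hqY.1 (cX.q.f1 ≫ s)
  obtain ⟨S, hS⟩ := exists_hom_of_cokernel (X := K.column1 X) (Y := K.column0 Y) hE h.autT'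
    (w := f1_comp_eq_zero cX.w) hqY.1 t s ht
  obtain ⟨S₀, S₁, c₀, c₁⟩ := S
  obtain rfl : t = S₁ := hS.symm
  let a' : X ⟶ K.diskRows (K.column1 X) := K.toDiskRows (𝟙 _) (𝟙 _)
    ((Category.comp_id _).trans (Category.id_comp _).symm)
    ((congrArg (X.d1.f1 ≫ ·) (K.T'.map_id X.X0.X1)).trans
      ((Category.comp_id _).trans (Category.id_comp _).symm))
  let b' : K.diskRows (K.column1 X) ⟶ Y := K.ofDiskRows S₀ t c₀ c₁
  have hab₁ : (a' ≫ b').f1.f1 = t ≫ Y.X1.d0 := Category.id_comp _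
  have h₁ : (F.f1 - (a' ≫ b').f1).f1 ≫ cY.q.f1 = 0 := by
    change (F.f1.f1 + -(a' ≫ b').f1.f1) ≫ cY.q.f1 = 0
    rw [← sub_eq_add_neg, Preadditive.sub_comp, hab₁, Category.assoc, cY.q.comm0,
      ← Category.assoc, ht, Category.assoc, hs, hG₁, sub_self]
  have h₂ : (F - a' ≫ b').f1 ≫ cY.q = 0 := by
    have := hE.mono_f cY.conflation'
    refine hom_ext ?_ h₁
    have hc := ((F - a' ≫ b').f1 ≫ cY.q).comm0
    rw [← cancel_mono cY.Q.d0, ← hc]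
    refine (congrArg (X.X1.d0 ≫ ·) h₁).trans ?_
    rw [comp_zero]
    exact zero_comp.symm
  obtain ⟨a, b, hab⟩ := exists_factor_disk0 hE' cY.conflation (F - a' ≫ b') h₂
  exact ⟨a, b, a', b', by rw [hab, sub_add_cancel]⟩

/-- The total-cokernel of a projective two-dimensional factorization is projective relative to the
deflations between objects annihilated by `ω` and `ω'`. -/
lemma TotalCokernel.exists_lift (c : TotalCokernel E X) (hX : IsProj (K.conflations₂ E) X)
    {M₁ M₂ : C} (h₁ : K.ω.app M₁ = 0) (h₂ : K.ω.app M₂ = 0) (h₁' : K.ω'.app M₁ = 0)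
    (h₂' : K.ω'.app M₂ = 0) {d : M₁ ⟶ M₂} (hd : IsDeflation E d) (f : c.N ⟶ M₂) :
    ∃ k, k ≫ d = f := by
  have := h.exact.hasFiniteBiproducts
  obtain ⟨Z, hZ⟩ : ∃ Z : C, IsZero Z := (hasZeroObject_of_hasFiniteBiproducts C).zero
  have h₀ : K.ω.app Z = 0 := hZ.eq_of_src _ _
  have hZ' : IsZero (ofZero hZ h₀) := isZero_of_components hZ hZ
  have hω' : ∀ {M : C} (hM : K.ω.app M = 0), K.ω'.app M = 0 → K.liftω'.app (ofZero hZ hM) = 0 :=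
    fun _ hM' => hom_ext (hZ.eq_of_src _ _) hM'
  refine exists_lift_of_toOfZero h.exact.toIsExactCategory c.conflation' hZ h₁ h₂ (fun f => ?_) f
  refine exists_lift_of_toOfZero h.exact_row.toIsExactCategory c.conflation hZ'
    (hω' h₁ h₁') (hω' h₂ h₂') (fun f => ?_) f
  exact hX.exists_lift (isDeflation_toOfZero h.exact_row (K.isExactAutoequivalence_liftT' h.autT')
    hZ' _ _ (isDeflation_toOfZero h.exact h.autT hZ h₁ h₂ hd)) f

end CommutingPair

/-! ### Gorenstein projective modules -/

section

variable {R : Type u} [Ring R]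

lemma isDeflation_shortExact_iff {M N : ModuleCat.{u} R} (d : M ⟶ N) :
    IsDeflation (shortExact R) d ↔ Epi d := by
  constructor
  · rintro ⟨K, i, w, h⟩
    exact h.epi_g
  · intro _
    exact ⟨kernel d, kernel.ι d, kernel.condition d,
      ⟨(ShortComplex.exact_of_f_is_kernel _ (kernelIsKernel d))⟩⟩

lemma isInflation_shortExact_iff {M N : ModuleCat.{u} R} (i : M ⟶ N) :
    IsInflation (shortExact R) i ↔ Mono i := by
  constructor
  · rintro ⟨K, d, w, h⟩
    exact h.mono_f
  · intro _
    exact ⟨cokernel i, cokernel.π i, cokernel.condition i,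
      ⟨(ShortComplex.exact_of_g_is_cokernel _ (cokernelIsCokernel i))⟩⟩

variable (R) in
lemma isWICExactCategory_shortExact : IsWICExactCategory (shortExact R) where
  hasFiniteBiproducts := inferInstance
  isoClosed := ⟨fun e h => ShortComplex.shortExact_of_iso e h⟩
  kernelCokernel S hS := ⟨⟨hS.fIsKernel⟩, ⟨hS.gIsCokernel⟩⟩
  ex0 Z _ := (isDeflation_shortExact_iff _).2 inferInstance
  ex1 d e hd he := by
    rw [isDeflation_shortExact_iff] at hd he ⊢
    exact epi_comp d e
  ex1_op i j hi hj := by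
    rw [isInflation_shortExact_iff] at hi hj ⊢
    exact mono_comp i j
  ex2 d f hd := by
    rw [isDeflation_shortExact_iff] at hd
    exact ⟨pullback d f, pullback.fst d f, pullback.snd d f, IsPullback.of_hasPullback d f,
      (isDeflation_shortExact_iff _).2 inferInstance⟩
  ex2_op i f hi := by
    rw [isInflation_shortExact_iff] at hi
    exact ⟨pushout i f, pushout.inl i f, pushout.inr i f, IsPushout.of_hasPushout i f,
      (isInflation_shortExact_iff _).2 inferInstance⟩
  deflation_of_comp f g h := by
    rw [isDeflation_shortExact_iff] at h ⊢
    exact epi_of_epi f g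
  inflation_of_comp f g h := by
    rw [isInflation_shortExact_iff] at h ⊢
    exact mono_of_mono f g

lemma isProj_shortExact_iff (P : ModuleCat.{u} R) : IsProj (shortExact R) P ↔ Projective P := by
  constructor
  · exact fun h => ⟨fun f e _ => h.exists_lift ((isDeflation_shortExact_iff e).2 inferInstance) f⟩
  · intro h S hS f
    have := hS.epi_g
    exact ⟨Projective.factorThru f S.g, Projective.factorThru_comp f S.g⟩

/-- The modules `M` such that `Ext^n(M, Q) = 0` for all `n > 0` and all projective `Q`. -/
def Perp (M : ModuleCat.{u} R) : Prop :=
  ∀ Q : ModuleCat.{u} R, Projective Q → ∀ (n : ℕ) (x : Abelian.Ext M Q (n + 1)), x = 0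

lemma perp_of_projective {P : ModuleCat.{u} R} (hP : Projective P) : Perp P :=
  fun _ _ _ x => x.eq_zero_of_projective

lemma Perp.ext {S : ShortComplex (ModuleCat.{u} R)} (hS : S.ShortExact) (h₁ : Perp S.X₁)
    (h₃ : Perp S.X₃) : Perp S.X₂ := by
  intro Q hQ n x
  obtain ⟨y, rfl⟩ := Abelian.Ext.contravariant_sequence_exact₂ hS Q x (h₁ Q hQ n _)
  rw [h₃ Q hQ n y, Abelian.Ext.comp_zero]

lemma Perp.ker {S : ShortComplex (ModuleCat.{u} R)} (hS : S.ShortExact) (h₂ : Perp S.X₂)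
    (h₃ : Perp S.X₃) : Perp S.X₁ := by
  intro Q hQ n x
  obtain ⟨y, rfl⟩ := Abelian.Ext.contravariant_sequence_exact₁ hS Q x (n₁ := n + 1 + 1) (by omega)
    (h₃ Q hQ (n + 1) _)
  rw [h₂ Q hQ n y, Abelian.Ext.comp_zero]

/-- Morphisms to projective modules extend along a monomorphism whose cokernel belongs to
`Perp`. -/
lemma Perp.exists_extension {S : ShortComplex (ModuleCat.{u} R)} (hS : S.ShortExact)
    (h₃ : Perp S.X₃) {Q : ModuleCat.{u} R} (hQ : Projective Q) (f : S.X₁ ⟶ Q) :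
    ∃ g, S.f ≫ g = f := by
  obtain ⟨y, hy⟩ := Abelian.Ext.contravariant_sequence_exact₁ hS Q (Abelian.Ext.mk₀ f) (n₁ := 1)
    (by omega) (h₃ Q hQ 0 _)
  obtain ⟨g, rfl⟩ := Abelian.Ext.mk₀_bijective _ _ |>.2 y
  rw [Abelian.Ext.mk₀_comp_mk₀] at hy
  exact ⟨g, (Abelian.Ext.mk₀_bijective _ _).1 hy⟩

/-- A class of modules closed under syzygies consists of modules in `Perp` as soon as
the first extension groups with projective modules vanish. -/
lemma perp_of_syzygy (X : ObjectProperty (ModuleCat.{u} R))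
    (hX : ∀ M, X M → ∃ (K L : ModuleCat.{u} R) (i : K ⟶ L) (p : L ⟶ M) (w : i ≫ p = 0),
      (ShortComplex.mk i p w).ShortExact ∧ Projective L ∧ X K ∧
        ∀ Q : ModuleCat.{u} R, Projective Q → ∀ f : K ⟶ Q, ∃ g, i ≫ g = f)
    {M : ModuleCat.{u} R} (hM : X M) : Perp M := by
  intro Q hQ n
  induction n generalizing M with
  | zero =>
    intro x
    obtain ⟨K, L, i, p, w, h, hL, -, hext⟩ := hX M hM
    obtain ⟨y, rfl⟩ := Abelian.Ext.contravariant_sequence_exact₃ h Q x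
      (perp_of_projective hL Q hQ 0 _) (n₀ := 0) rfl
    obtain ⟨f, rfl⟩ := (Abelian.Ext.mk₀_bijective _ _).2 y
    obtain ⟨g, rfl⟩ := hext Q hQ f
    rw [← Abelian.Ext.mk₀_comp_mk₀]
    exact h.extClass_comp_assoc _
  | succ n ih =>
    intro x
    obtain ⟨K, L, i, p, w, h, hL, hK, -⟩ := hX M hM
    obtain ⟨y, rfl⟩ := Abelian.Ext.contravariant_sequence_exact₃ h Q x
      (perp_of_projective hL Q hQ (n + 1) _) (n₀ := n + 1) (by omega)
    rw [ih hK y, Abelian.Ext.comp_zero]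

/-- A relation `r` such that every element has a predecessor, and every element of `s`
a successor in `s`, admits a sequence indexed by `ℤ` through any element of `s`. -/
lemma exists_int_sequence {α : Type*} {r : α → α → Prop} {s : α → Prop}
    (h₁ : ∀ a, s a → ∃ b, s b ∧ r a b) (h₂ : ∀ b, ∃ a, r a b) {a : α} (ha : s a) :
    ∃ Z : ℤ → α, Z 1 = a ∧ ∀ n, r (Z n) (Z (n + 1)) := by
  choose f hf hf' using h₁
  choose g hg using h₂
  let F : {a // s a} → {a // s a} := fun a => ⟨f a.1 a.2, hf a.1 a.2⟩
  refine ⟨fun n => if 1 ≤ n then (F^[(n - 1).toNat] ⟨a, ha⟩).1 else g^[(1 - n).toNat] a, by simp,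
    fun n => ?_⟩
  by_cases h : 1 ≤ n
  · have h' : 1 ≤ n + 1 := by omega
    have e : (n + 1 - 1).toNat = (n - 1).toNat + 1 := by omega
    simp only [if_pos h, if_pos h', e, Function.iterate_succ_apply']
    exact hf' _ _
  · have e : (1 - n).toNat = (1 - (n + 1)).toNat + 1 := by omega
    by_cases h' : 1 ≤ n + 1
    · obtain rfl : n = 0 := by omega
      simpa using hg a
    · simp only [if_neg h, if_neg h', e, Function.iterate_succ_apply']
      exact hg _

/-- A complex of projective modules obtained by splicing short exact sequences
`Z n ⟶ K.X n ⟶ Z (n + 1)` with `Z n` in `Perp` is totally acyclic, and `Z 1` is its module of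
cocycles. -/
lemma gproj_of_complex (K : CochainComplex (ModuleCat.{u} R) ℤ) (Z : ℤ → ModuleCat.{u} R)
    (i : ∀ n, Z n ⟶ K.X n) (p : ∀ n, K.X n ⟶ Z (n + 1))
    (hd : ∀ n, K.d n (n + 1) = p n ≫ i (n + 1)) (w : ∀ n, i n ≫ p n = 0)
    (h : ∀ n, (ShortComplex.mk (i n) (p n) (w n)).ShortExact) (hP : ∀ n, Projective (K.X n))
    (hZ : ∀ n, Perp (Z n)) : GProj R (Z 1) := by
  have mono : ∀ n, Mono (i n) := fun n => (h n).mono_f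
  have epi : ∀ n, Epi (p n) := fun n => (h n).epi_g
  have hE := (isWICExactCategory_shortExact R).toIsExactCategory
  refine ⟨K, ⟨hP, fun n => ?_, fun Q hQ n f hf => ?_⟩, ?_⟩
  · obtain ⟨n, rfl⟩ : ∃ m, n = m + 1 := ⟨n - 1, by omega⟩
    rw [K.exactAt_iff' n (n + 1) (n + 1 + 1) (by simp) (by simp), ShortComplex.moduleCat_exact_iff]
    intro x hx
    change K.X (n + 1) at x
    change K.d (n + 1) (n + 1 + 1) x = 0 at hx
    change ∃ y, K.d n (n + 1) y = x
    rw [hd, ModuleCat.comp_apply] at hx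
    rw [hd]
    have hx := (ModuleCat.mono_iff_injective _).1 (mono (n + 1 + 1)) (hx.trans (map_zero _).symm)
    obtain ⟨y, rfl⟩ := (ShortComplex.moduleCat_exact_iff _).1 (h (n + 1)).exact x hx
    obtain ⟨z, rfl⟩ := (ModuleCat.epi_iff_surjective _).1 (epi n) y
    exact ⟨z, rfl⟩
  · obtain ⟨n, rfl⟩ : ∃ m, n = m + 1 := ⟨n - 1, by omega⟩
    rw [add_sub_cancel_right, hd, Category.assoc] at hf
    obtain ⟨g, hg⟩ := hE.exists_desc (h (n + 1)) f
      ((cancel_epi (p n)).1 (hf.trans comp_zero.symm))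
    obtain ⟨k, hk⟩ := (hZ (n + 1 + 1 + 1)).exists_extension (h (n + 1 + 1)) hQ g
    exact ⟨k, by rw [hd, Category.assoc]; exact (congrArg (p (n + 1) ≫ ·) hk).trans hg⟩
  · have hw : i 1 ≫ K.d 1 (1 + 1) = 0 := by rw [hd, reassoc_of% w 1, zero_comp]
    obtain ⟨k, hk⟩ := hE.exists_lift (h 1) (K.iCycles 1) (by
      rw [← cancel_mono (i (1 + 1)), Category.assoc, ← hd, K.iCycles_d, zero_comp])
    refine ⟨⟨K.liftCycles (i 1) (1 + 1) (by simp) hw, k, ?_, ?_⟩⟩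
    · rw [← cancel_mono (i 1), Category.assoc, hk, K.liftCycles_i, Category.id_comp]
    · rw [← cancel_mono (K.iCycles 1), Category.assoc, K.liftCycles_i, hk, Category.id_comp]

/-- A class of modules contained in `Perp` such that each member embeds into a projective module
with cokernel in the class consists of Gorenstein projective modules. -/
lemma gproj_of_class (X : ObjectProperty (ModuleCat.{u} R)) (hX : ∀ M, X M → Perp M)
    (hX' : ∀ M, X M → ∃ (P N : ModuleCat.{u} R) (i : M ⟶ P) (p : P ⟶ N) (w : i ≫ p = 0),
      (ShortComplex.mk i p w).ShortExact ∧ Projective P ∧ X N)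
    {M : ModuleCat.{u} R} (hM : X M) : GProj R M := by
  let r : {M : ModuleCat.{u} R // Perp M} → {M : ModuleCat.{u} R // Perp M} → Prop :=
    fun M N => ∃ (P : ModuleCat.{u} R) (i : M.1 ⟶ P) (p : P ⟶ N.1) (w : i ≫ p = 0),
      (ShortComplex.mk i p w).ShortExact ∧ Projective P
  obtain ⟨Z, hZ, h⟩ := exists_int_sequence (r := r) (s := fun M => X M.1)
    (fun M hM => by
      obtain ⟨P, N, i, p, w, h, hP, hN⟩ := hX' M.1 hM
      exact ⟨⟨N, hX N hN⟩, hN, P, i, p, w, h, hP⟩)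
    (fun M => by
      have h : (ShortComplex.mk _ _ (kernel.condition (Projective.π M.1))).ShortExact :=
        ⟨ShortComplex.exact_of_f_is_kernel _ (kernelIsKernel _)⟩
      exact ⟨⟨_, Perp.ker h (perp_of_projective (Projective.projective_over M.1)) M.2⟩, _, _, _, _,
        h, Projective.projective_over M.1⟩) (a := ⟨M, hX M hM⟩) hM
  choose P i p w h hP using h
  have := gproj_of_complex (CochainComplex.of P (fun n => p n ≫ i (n + 1)) (fun n => by
    rw [Category.assoc, reassoc_of% w (n + 1), zero_comp, comp_zero])) (fun n => (Z n).1) i p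
    (fun n => CochainComplex.of_d P (fun n => p n ≫ i (n + 1)) n) w h hP (fun n => (Z n).2)
  rwa [hZ] at this

lemma gproj_iso {M N : ModuleCat.{u} R} (e : M ≅ N) (hM : GProj R M) : GProj R N := by
  obtain ⟨P, hP, ⟨e'⟩⟩ := hM
  exact ⟨P, hP, ⟨e.symm ≪≫ e'⟩⟩

section

variable {K : CochainComplex (ModuleCat.{u} R) ℤ} (hK : IsTotallyAcyclic K)
include hK

lemma IsTotallyAcyclic.shortExact_cycles (n : ℤ) : ∃ w : K.iCycles n ≫ K.toCycles n (n + 1) = 0,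
    (ShortComplex.mk (K.iCycles n) (K.toCycles n (n + 1)) w).ShortExact := by
  have hE := (isWICExactCategory_shortExact R).toIsExactCategory
  have w : K.iCycles n ≫ K.toCycles n (n + 1) = 0 := by
    rw [← cancel_mono (K.iCycles (n + 1)), Category.assoc, K.toCycles_i, K.iCycles_d, zero_comp]
  refine ⟨w, hE.conflation_of_kernel w ((isDeflation_shortExact_iff _).2 ?_) inferInstance
    fun W k hk => ⟨K.liftCycles k (n + 1) (by simp) ?_, K.liftCycles_i _ _ _ _⟩⟩
  · rw [ModuleCat.epi_iff_surjective]
    intro z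
    have h := hK.acyclic (n + 1)
    rw [K.exactAt_iff' n (n + 1) (n + 1 + 1) (by simp) (by simp),
      ShortComplex.moduleCat_exact_iff] at h
    obtain ⟨y, hy⟩ := h (K.iCycles (n + 1) z)
      (congrArg (fun f => (ModuleCat.Hom.hom f) z) (K.iCycles_d (n + 1) (n + 1 + 1)))
    refine ⟨y, (ModuleCat.mono_iff_injective (K.iCycles (n + 1))).1 inferInstance
      ((congrArg (fun f => (ModuleCat.Hom.hom f) y) (K.toCycles_i n (n + 1))).trans hy)⟩
  · rw [← K.toCycles_i n (n + 1), reassoc_of% hk, zero_comp]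

lemma IsTotallyAcyclic.perp_cycles (n : ℤ) : Perp (K.cycles n) := by
  refine perp_of_syzygy (fun M => ∃ n, M = K.cycles n) ?_ ⟨n, rfl⟩
  rintro _ ⟨n, rfl⟩
  obtain ⟨n, rfl⟩ : ∃ m, n = m + 1 + 1 := ⟨n - 2, by omega⟩
  obtain ⟨w, h⟩ := hK.shortExact_cycles (n + 1)
  refine ⟨_, _, _, _, w, h, hK.projective _, ⟨_, rfl⟩, fun Q hQ f => ?_⟩
  obtain ⟨g, hg⟩ := hK.hom_acyclic Q hQ n (K.toCycles n (n + 1) ≫ f) (by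
    rw [K.d_toCycles_assoc, zero_comp])
  have := (hK.shortExact_cycles n).choose_spec.epi_g
  refine ⟨g, (cancel_epi (K.toCycles n (n + 1))).1 ?_⟩
  rw [K.toCycles_i_assoc, hg]

lemma IsTotallyAcyclic.gproj_cycles (n : ℤ) : GProj R (K.cycles n) := by
  refine gproj_of_class (fun M => ∃ n, M = K.cycles n) ?_ ?_ ⟨n, rfl⟩
  · rintro _ ⟨n, rfl⟩
    exact hK.perp_cycles n
  · rintro _ ⟨n, rfl⟩
    obtain ⟨w, h⟩ := hK.shortExact_cycles n
    exact ⟨_, _, _, _, w, h, hK.projective n, n + 1, rfl⟩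

end

end

section

variable {C : Type u} [Category.{v} C] [Preadditive C] {E : ObjectProperty (ShortComplex C)}

/-- In the composite of a conflation `X ⟶ Y ⟶ Z` with an inflation `j : Y ⟶ W`, the cokernel of
`X ⟶ W` is an extension of the cokernel of `j` by `Z`. -/
lemma IsExactCategory.exists_conflation_comp (hE : IsExactCategory E) {X Y Z W V : C} {i : X ⟶ Y}
    {p : Y ⟶ Z} {w : i ≫ p = 0} (h : E (ShortComplex.mk i p w)) {j : Y ⟶ W} {q : W ⟶ V}
    {w' : j ≫ q = 0} (h' : E (ShortComplex.mk j q w')) :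
    ∃ (U : C) (r : W ⟶ U) (k : Z ⟶ U) (s : U ⟶ V) (wr : (i ≫ j) ≫ r = 0) (wk : k ≫ s = 0),
      E (ShortComplex.mk (i ≫ j) r wr) ∧ E (ShortComplex.mk k s wk) := by
  obtain ⟨U, r, k, sq, hk⟩ := hE.ex2_op j p ⟨_, _, _, h'⟩
  obtain ⟨s, ws, -, hs⟩ := hE.conflation_of_isPushout h' sq hk
  have := hE.epi_g h
  have wr : (i ≫ j) ≫ r = 0 := by rw [Category.assoc, sq.w, reassoc_of% w, zero_comp]
  refine ⟨U, r, k, s, wr, ws, hE.conflation_of_cokernel wr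
    (hE.ex1_op _ _ ⟨_, _, _, h⟩ ⟨_, _, _, h'⟩) ⟨fun a b hab => ?_⟩ (fun T f hf => ?_), hs⟩
  · refine sq.hom_ext hab ?_
    rw [← cancel_epi p, ← Category.assoc, ← Category.assoc, ← sq.w, Category.assoc, hab,
      Category.assoc]
  · obtain ⟨g, hg⟩ := hE.exists_desc h (j ≫ f) (by rw [← Category.assoc, hf])
    exact ⟨sq.desc f g hg.symm, sq.inl_desc _ _ _⟩

/-- If `P` is closed under extensions and kernels of deflations, then the kernel of a deflation from
an object of `P` to `M` belongs to `P` as soon as this holds for one such deflation. -/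
lemma ker_mem_of_ker_mem (hE : IsExactCategory E) {P : ObjectProperty C}
    (ext : ∀ S, E S → P S.X₁ → P S.X₃ → P S.X₂) (ker : ∀ S, E S → P S.X₂ → P S.X₃ → P S.X₁)
    {X₀ X₁ Y₀ Y₁ M : C} {i : X₀ ⟶ X₁} {p : X₁ ⟶ M} {w : i ≫ p = 0}
    (hX : E (ShortComplex.mk i p w)) {j : Y₀ ⟶ Y₁} {q : Y₁ ⟶ M} {w' : j ≫ q = 0}
    (hY : E (ShortComplex.mk j q w')) (h₀ : P X₀) (h₁ : P X₁) (h : P Y₁) : P Y₀ := by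
  obtain ⟨W, a, b, sq, hb⟩ := hE.ex2 p q ⟨_, _, _, hX⟩
  obtain ⟨i', wi, -, hi⟩ := hE.conflation_of_isPullback hX sq hb
  obtain ⟨W', b', a', sq', ha⟩ := hE.ex2 q p ⟨_, _, _, hY⟩
  obtain ⟨j', wj, -, hj⟩ := hE.conflation_of_isPullback hY sq' ha
  let e := sq.isoIsPullback _ _ sq'.flip
  have hW : P W := ext _ hi h₀ h
  have hea : e.hom ≫ a' = a := by simp [e]
  have hea' : e.inv ≫ a = a' := by simp [e]
  have wj' : (j' ≫ e.inv) ≫ a = 0 := by rw [Category.assoc, hea', wj]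
  refine ker (ShortComplex.mk (j' ≫ e.inv) a wj') (hE.of_iso (ShortComplex.isoMk
    (S₁ := ShortComplex.mk j' a' wj) (Iso.refl _) e.symm (Iso.refl _) ?_ ?_) hj) hW h₁
  · exact Category.id_comp _
  · exact hea'.trans (Category.comp_id _).symm

/-- Closure under extensions and kernels of deflations implies the closure under cokernels required
of a Frobenius class. -/
lemma IsFrobeniusClass.of_ext_ker (hE : IsWICExactCategory E) {P : ObjectProperty C}
    (zero : ∀ Z, IsZero Z → P Z) (iso : P.IsClosedUnderIsomorphisms)
    (ext : ∀ S, E S → P S.X₁ → P S.X₃ → P S.X₂) (ker : ∀ S, E S → P S.X₂ → P S.X₃ → P S.X₁)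
    (enoughProj : ∀ X, P X → ∃ (Q : C) (d : Q ⟶ X), IsDeflation E d ∧ IsProjInj E P Q)
    (enoughInj : ∀ X, P X → ∃ (Q Z : C) (i : X ⟶ Q) (p : Q ⟶ Z) (w : i ≫ p = 0),
      E (ShortComplex.mk i p w) ∧ P Z ∧ IsProjInj E P Q) : IsFrobeniusClass E P := by
  refine ⟨zero, iso, ext, ker, ?_, enoughProj, enoughInj⟩
  intro X Y W Z Z' f g p q w w' h h' hX hY hW hZ'
  -- The cokernel `Z` of `f` is a direct complement of `W` in the pushout of `f` and `f ≫ g`.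
  obtain ⟨U, a, b, sq, hb⟩ := hE.ex2_op f (f ≫ g) ⟨_, _, _, h⟩
  obtain ⟨d, wd, -, hd⟩ := hE.conflation_of_isPushout h sq hb
  have ha := hE.isInflation_of_isPushout ⟨_, _, _, h'⟩ sq.flip
  obtain ⟨d', wd', -, hd'⟩ := hE.conflation_of_isPushout h' sq.flip ha
  have hU : P U := ext _ hd' hY hZ'
  let r : U ⟶ W := sq.desc g (𝟙 W) (Category.comp_id _).symm
  have hr : b ≫ r = 𝟙 W := sq.inr_desc _ _ _
  have := hE.epi_g hd
  obtain ⟨s, hs⟩ := hE.exists_desc hd (𝟙 U - r ≫ b) (by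
    rw [Preadditive.comp_sub, ← Category.assoc, hr]
    simp)
  have hsr : s ≫ r = 0 := by
    rw [← cancel_epi d, ← Category.assoc, hs, Preadditive.sub_comp, Category.assoc, hr]
    simp
  have hsd : s ≫ d = 𝟙 Z := by
    rw [← cancel_epi d, ← Category.assoc, hs, Preadditive.sub_comp, Category.assoc, wd]
    simp
  refine ker (ShortComplex.mk s r hsr) (hE.conflation_of_kernel hsr
    (hE.isDeflation_of_split r b hr) ⟨fun x y hxy => ?_⟩ (fun T k hk => ⟨k ≫ d, ?_⟩)) hU hW
  · rw [← Category.comp_id x, ← hsd, ← Category.assoc, hxy, Category.assoc, hsd, Category.comp_id]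
  · rw [Category.assoc, hs, Preadditive.comp_sub, ← Category.assoc, hk]
    simp

end

section

variable {R : Type u} [Ring R]

lemma shortExact_mk_iff {X Y Z : ModuleCat.{u} R} (i : X ⟶ Y) (p : Y ⟶ Z) (w : i ≫ p = 0) :
    (ShortComplex.mk i p w).ShortExact ↔ Function.Injective i ∧ Function.Surjective p ∧
      ∀ y, p y = 0 → ∃ x, i x = y := by
  constructor
  · intro h
    exact ⟨(ModuleCat.mono_iff_injective i).1 h.mono_f, (ModuleCat.epi_iff_surjective p).1 h.epi_g,
      (ShortComplex.moduleCat_exact_iff _).1 h.exact⟩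
  · rintro ⟨h₁, h₂, h₃⟩
    exact ShortComplex.ShortExact.mk' ((ShortComplex.moduleCat_exact_iff _).2 h₃)
      ((ModuleCat.mono_iff_injective i).2 h₁) ((ModuleCat.epi_iff_surjective p).2 h₂)

lemma hom_apply_of_comp_eq {X Y Z : ModuleCat.{u} R} {f : X ⟶ Y} {g : Y ⟶ Z} {h : X ⟶ Z}
    (w : f ≫ g = h) (x : X) : g (f x) = h x :=
  congrArg (fun k => (ModuleCat.Hom.hom k) x) w

lemma hom_apply_of_comm {X Y Y' Z : ModuleCat.{u} R} {f : X ⟶ Y} {g : Y ⟶ Z} {f' : X ⟶ Y'}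
    {g' : Y' ⟶ Z} (w : f ≫ g = f' ≫ g') (x : X) : g (f x) = g' (f' x) :=
  congrArg (fun k => (ModuleCat.Hom.hom k) x) w

/-- The cokernels of a monomorphism of short exact sequences form a short exact sequence. -/
lemma shortExact_cokernels {A₀ A₁ A₂ B₀ B₁ B₂ C₀ C₁ C₂ : ModuleCat.{u} R}
    {a : A₀ ⟶ A₁} {a' : A₁ ⟶ A₂} {wa : a ≫ a' = 0} (hA : (ShortComplex.mk a a' wa).ShortExact)
    {b : B₀ ⟶ B₁} {b' : B₁ ⟶ B₂} {wb : b ≫ b' = 0} (hB : (ShortComplex.mk b b' wb).ShortExact)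
    {f₀ : A₀ ⟶ B₀} {q₀ : B₀ ⟶ C₀} {w₀ : f₀ ≫ q₀ = 0} (h₀ : (ShortComplex.mk f₀ q₀ w₀).ShortExact)
    {f₁ : A₁ ⟶ B₁} {q₁ : B₁ ⟶ C₁} {w₁ : f₁ ≫ q₁ = 0} (h₁ : (ShortComplex.mk f₁ q₁ w₁).ShortExact)
    {f₂ : A₂ ⟶ B₂} {q₂ : B₂ ⟶ C₂} {w₂ : f₂ ≫ q₂ = 0} (h₂ : (ShortComplex.mk f₂ q₂ w₂).ShortExact)
    (c₀ : f₀ ≫ b = a ≫ f₁) (c₁ : f₁ ≫ b' = a' ≫ f₂) {u : C₀ ⟶ C₁} {v : C₁ ⟶ C₂}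
    (hu : b ≫ q₁ = q₀ ≫ u) (hv : b' ≫ q₂ = q₁ ≫ v) :
    ∃ w : u ≫ v = 0, (ShortComplex.mk u v w).ShortExact := by
  have := h₀.epi_g
  have w : u ≫ v = 0 := by
    rw [← cancel_epi q₀, ← Category.assoc, ← hu, Category.assoc, ← hv, reassoc_of% wb]
    simp
  refine ⟨w, ?_⟩
  rw [shortExact_mk_iff] at hA hB h₀ h₁ h₂ ⊢
  obtain ⟨-, hA₂, hA₃⟩ := hA
  obtain ⟨hB₁, hB₂, hB₃⟩ := hB
  refine ⟨(injective_iff_map_eq_zero _).2 fun x hx => ?_, fun z => ?_, fun y hy => ?_⟩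
  · obtain ⟨y, rfl⟩ := h₀.2.1 x
    rw [← hom_apply_of_comm hu] at hx
    obtain ⟨z, hz⟩ := h₁.2.2 _ hx
    obtain ⟨t, rfl⟩ := hA₃ z (h₂.1 (by
      rw [← hom_apply_of_comm c₁, hz, hom_apply_of_comp_eq wb, map_zero]
      rfl))
    rw [← hom_apply_of_comm c₀] at hz
    rw [← hB₁ hz, hom_apply_of_comp_eq w₀]
    rfl
  · obtain ⟨z, rfl⟩ := h₂.2.1 z
    obtain ⟨z, rfl⟩ := hB₂ z
    exact ⟨q₁ z, (hom_apply_of_comm hv z).symm⟩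
  · obtain ⟨y, rfl⟩ := h₁.2.1 y
    rw [← hom_apply_of_comm hv] at hy
    obtain ⟨t, ht⟩ := h₂.2.2 _ hy
    obtain ⟨t, rfl⟩ := hA₂ t
    obtain ⟨s, hs⟩ := hB₃ (y - f₁ t) (by
      rw [map_sub, hom_apply_of_comm c₁, ht, sub_self])
    refine ⟨q₀ s, ?_⟩
    rw [← hom_apply_of_comm hu, hs, map_sub, hom_apply_of_comp_eq w₁]
    exact sub_zero _

lemma GProj.exists_cosyzygy {M : ModuleCat.{u} R} (hM : GProj R M) :
    ∃ (P N : ModuleCat.{u} R) (i : M ⟶ P) (p : P ⟶ N) (w : i ≫ p = 0),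
      (ShortComplex.mk i p w).ShortExact ∧ Projective P ∧ GProj R N := by
  obtain ⟨K, hK, ⟨e⟩⟩ := hM
  obtain ⟨w, h⟩ := hK.shortExact_cycles 1
  refine ⟨_, _, e.hom ≫ K.iCycles 1, K.toCycles 1 (1 + 1), by rw [Category.assoc, w, comp_zero],
    ShortComplex.shortExact_of_iso (ShortComplex.isoMk
      (S₁ := ShortComplex.mk (K.iCycles 1) (K.toCycles 1 (1 + 1)) w) e.symm (Iso.refl _)
        (Iso.refl _)
      ?_ ?_) h,
    hK.projective 1, hK.gproj_cycles _⟩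
  · change e.inv ≫ e.hom ≫ _ = _ ≫ 𝟙 _
    rw [e.inv_hom_id_assoc, Category.comp_id]
  · exact (Category.id_comp _).trans (Category.comp_id _).symm

lemma perp_iso {M N : ModuleCat.{u} R} (e : M ≅ N) (hM : Perp M) : Perp N := by
  intro Q hQ n x
  rw [← Abelian.Ext.mk₀_id_comp x, ← e.inv_hom_id, ← Abelian.Ext.mk₀_comp_mk₀_assoc,
    hM Q hQ n ((Abelian.Ext.mk₀ e.hom).comp x (zero_add _)), Abelian.Ext.comp_zero]

lemma GProj.perp {M : ModuleCat.{u} R} (hM : GProj R M) : Perp M := by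
  obtain ⟨K, hK, ⟨e⟩⟩ := hM
  exact perp_iso e.symm (hK.perp_cycles 1)

lemma gproj_of_projective {P : ModuleCat.{u} R} (hP : Projective P) : GProj R P := by
  refine gproj_of_class (fun P => Projective P) (fun P hP => perp_of_projective hP)
    (fun P hP => ⟨P, ModuleCat.of R PUnit, 𝟙 P, 0, comp_zero, ?_, hP,
      (ModuleCat.isZero_of_subsingleton _).projective⟩) hP
  rw [shortExact_mk_iff]
  exact ⟨Function.injective_id, fun _ => ⟨0, Subsingleton.elim _ _⟩, fun y _ => ⟨y, rfl⟩⟩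

/-- Gorenstein projective modules are closed under extensions. -/
lemma GProj.ext {S : ShortComplex (ModuleCat.{u} R)} (hS : S.ShortExact) (h₁ : GProj R S.X₁)
    (h₃ : GProj R S.X₃) : GProj R S.X₂ := by
  refine gproj_of_class (fun M => ∃ (M' M'' : ModuleCat.{u} R) (i : M' ⟶ M) (p : M ⟶ M'')
    (w : i ≫ p = 0), (ShortComplex.mk i p w).ShortExact ∧ GProj R M' ∧ GProj R M'') ?_ ?_
    ⟨_, _, _, _, S.zero, hS, h₁, h₃⟩
  · rintro M ⟨M', M'', i, p, w, h, h', h''⟩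
    exact Perp.ext h h'.perp h''.perp
  · rintro M ⟨M', M'', i, p, w, h, h', h''⟩
    obtain ⟨P', N', i', p', w', hi', hP', hN'⟩ := h'.exists_cosyzygy
    obtain ⟨P'', N'', i'', p'', w'', hi'', hP'', hN''⟩ := h''.exists_cosyzygy
    obtain ⟨k, hk⟩ : ∃ k : M ⟶ P', i ≫ k = i' := h''.perp.exists_extension h hP' i'
    have hb := (isWICExactCategory_shortExact R).biprod_conflation P' P''
    have hE := (isWICExactCategory_shortExact R).toIsExactCategory
    -- As in the horseshoe lemma, the extension embeds into `P' ⊞ P''`, and its cokernel is again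
    -- an extension of Gorenstein projective modules.
    let j : M ⟶ P' ⊞ P'' := biprod.lift k (p ≫ i'')
    have c₀ : i' ≫ biprod.inl = i ≫ j := by
      apply biprod.hom_ext <;> simp [j, hk, reassoc_of% w]
    have c₁ : j ≫ biprod.snd = p ≫ i'' := biprod.lift_snd _ _
    have mono : Mono j := by
      rw [ModuleCat.mono_iff_injective, injective_iff_map_eq_zero]
      intro x hx
      rw [shortExact_mk_iff] at h hi' hi''
      have hpx : p x = 0 := hi''.1 (by
        rw [← hom_apply_of_comm c₁, hx, map_zero, map_zero])
      obtain ⟨y, rfl⟩ := h.2.2 x hpx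
      have hy : i' y = 0 := by
        rw [← hom_apply_of_comp_eq hk, ← hom_apply_of_comp_eq (biprod.lift_fst k (p ≫ i'')), hx,
          map_zero]
      rw [hi'.1 (hy.trans (map_zero _).symm), map_zero]
    have hj : (ShortComplex.mk j (cokernel.π j) (cokernel.condition j)).ShortExact :=
      ⟨ShortComplex.exact_of_g_is_cokernel _ (cokernelIsCokernel j)⟩
    obtain ⟨a, ha⟩ := hE.exists_desc hi' (biprod.inl ≫ cokernel.π j) (by
      rw [reassoc_of% c₀, cokernel.condition, comp_zero])
    obtain ⟨b, hb'⟩ := hE.exists_desc hj (biprod.snd ≫ p'') (by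
      rw [reassoc_of% c₁, w'', comp_zero])
    obtain ⟨w₃, h₃⟩ := shortExact_cokernels h hb hi' hj hi'' c₀ c₁ ha.symm hb'.symm
    exact ⟨P' ⊞ P'', cokernel j, j, cokernel.π j, cokernel.condition j, hj, inferInstance, N', N'',
      a, b, w₃, h₃, hN', hN''⟩

/-- Gorenstein projective modules are closed under kernels of epimorphisms. -/
lemma GProj.ker {S : ShortComplex (ModuleCat.{u} R)} (hS : S.ShortExact) (h₂ : GProj R S.X₂)
    (h₃ : GProj R S.X₃) : GProj R S.X₁ := by
  refine gproj_of_class (fun M => GProj R M ∨ M = S.X₁) ?_ ?_ (Or.inr rfl)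
  · rintro M (h | rfl)
    · exact h.perp
    · exact Perp.ker hS h₂.perp h₃.perp
  · rintro M (h | rfl)
    · obtain ⟨P, N, i, p, w, hi, hP, hN⟩ := h.exists_cosyzygy
      exact ⟨P, N, i, p, w, hi, hP, Or.inl hN⟩
    · -- The kernel embeds into the projective module which contains the middle term; the cokernel
      -- is an extension of Gorenstein projective modules.
      obtain ⟨P, N, i, p, w, hi, hP, hN⟩ := h₂.exists_cosyzygy
      obtain ⟨U, r, k, s, wr, wk, hr, hk⟩ :=
        (isWICExactCategory_shortExact R).toIsExactCategory.exists_conflation_comp hS hi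
      exact ⟨P, U, _, r, wr, hr, hP, Or.inl (GProj.ext hk h₃ hN)⟩

/-- Projective modules are injective relative to every class of Gorenstein projective modules. -/
lemma GProj.isProjInj {X : ObjectProperty (ModuleCat.{u} R)} (hX : ∀ M, X M → GProj R M)
    {P : ModuleCat.{u} R} (hP : Projective P) (h : X P) : IsProjInj (shortExact R) X P :=
  ⟨h, (isProj_shortExact_iff P).2 hP, fun _ hS _ _ h₃ f => (hX _ h₃).perp.exists_extension hS hP f⟩

variable (R) in
theorem isFrobeniusClass_gproj : IsFrobeniusClass (shortExact R) (GProj R) :=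
  IsFrobeniusClass.of_ext_ker (isWICExactCategory_shortExact R)
    (fun Z hZ => gproj_of_projective hZ.projective) ⟨fun e h => gproj_iso e h⟩
    (fun _ => GProj.ext) (fun _ => GProj.ker)
    (fun M _ => ⟨Projective.over M, Projective.π M,
      (isDeflation_shortExact_iff _).2 inferInstance,
      GProj.isProjInj (fun _ h => h) inferInstance (gproj_of_projective inferInstance)⟩)
    (fun M hM => by
      obtain ⟨P, N, i, p, w, hi, hP, hN⟩ := hM.exists_cosyzygy
      exact ⟨P, N, i, p, w, hi, hN,
        GProj.isProjInj (fun _ h => h) hP (gproj_of_projective hP)⟩)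

/-- Gorenstein projective modules of finite projective dimension are projective. -/
lemma GProj.projective {M : ModuleCat.{u} R} (hM : GProj R M) {n : ℕ}
    (hn : HasProjectiveDimensionLT M n) : Projective M := by
  induction n generalizing M with
  | zero => exact (isZero_of_hasProjectiveDimensionLT_zero M).projective
  | succ n ih =>
    obtain _ | n := n
    · exact projective_iff_hasProjectiveDimensionLT_one.2 hn
    · have h : (ShortComplex.mk _ _ (kernel.condition (Projective.π M))).ShortExact :=
        ⟨ShortComplex.exact_of_f_is_kernel _ (kernelIsKernel _)⟩
      -- The syzygy of `M` is projective by induction, so that `M` is a direct summand of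
      -- a projective module because `Ext^1(M, -)` vanishes on projective modules.
      have hK := ih (GProj.ker h (gproj_of_projective (Projective.projective_over M)) hM)
        (h.hasProjectiveDimensionLT_X₁ (n + 1) inferInstance hn)
      obtain ⟨r, hr⟩ : ∃ r : Projective.over M ⟶ _, kernel.ι (Projective.π M) ≫ r = 𝟙 _ :=
        hM.perp.exists_extension h hK (𝟙 _)
      obtain ⟨s, hs⟩ :=
        (isWICExactCategory_shortExact R).toIsExactCategory.exists_desc h
          (𝟙 _ - r ≫ kernel.ι (Projective.π M)) (by
            rw [Preadditive.comp_sub, ← Category.assoc, hr]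
            simp)
      have hs' : s ≫ Projective.π M = 𝟙 M := by
        rw [← cancel_epi (Projective.π M), ← Category.assoc, hs]
        simp
      exact Retract.projective ⟨s, Projective.π M, hs'⟩

end

/-! ### Finiteness conditions -/

section

variable {R : Type u} [Ring R]

variable (R) in
theorem isFrobeniusClass_fgProj : IsFrobeniusClass (shortExact R) (fgProj R) := by
  have mem : ∀ {P : ModuleCat.{u} R}, fgProj R P → IsProjInj (shortExact R) (fgProj R) P :=
    fun h => GProj.isProjInj (fun _ h => gproj_of_projective h.2) h.2 h
  refine IsFrobeniusClass.of_ext_ker (isWICExactCategory_shortExact R)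
    (fun Z hZ => ⟨?_, hZ.projective⟩) ⟨fun e h => ⟨?_, ?_⟩⟩ (fun S hS h₁ h₃ => ⟨?_, ?_⟩)
    (fun S hS h₂ h₃ => ⟨?_, ?_⟩) (fun P hP => ⟨P, 𝟙 P, ?_, mem hP⟩) (fun P hP => ?_)
  · have := ModuleCat.subsingleton_of_isZero hZ
    infer_instance
  · have := h.1
    exact Module.Finite.equiv e.toLinearEquiv
  · exact Projective.of_iso e h.2
  · obtain @⟨X, Y, Z, i, p, w⟩ := S
    obtain ⟨-, h₅, h₆⟩ := (shortExact_mk_iff i p w).1 hS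
    have : Module.Finite R X := h₁.1
    have : Module.Finite R Z := h₃.1
    exact Module.Finite.of_exact (f := i.hom) (g := p.hom) (fun y => ⟨h₆ y, by
      rintro ⟨x, rfl⟩
      exact hom_apply_of_comp_eq w x⟩) h₅
  · rw [projective_iff_hasProjectiveDimensionLT_one]
    exact hS.hasProjectiveDimensionLT_X₂ 1 (projective_iff_hasProjectiveDimensionLT_one.1 h₁.2)
      (projective_iff_hasProjectiveDimensionLT_one.1 h₃.2)
  · obtain ⟨s, hs⟩ := (isProj_shortExact_iff _).2 h₃.2 _ hS (𝟙 _)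
    obtain @⟨X, Y, Z, i, p, w⟩ := S
    have : Module.Finite R Y := h₂.1
    obtain ⟨r, hr⟩ := (isWICExactCategory_shortExact R).toIsExactCategory.exists_lift hS
      (𝟙 Y - p ≫ s) (by
        rw [Preadditive.sub_comp, Category.assoc]
        exact (congrArg (𝟙 Y ≫ p - p ≫ ·) hs).trans (by simp))
    have := hS.mono_f
    have hi : i ≫ r = 𝟙 X := by
      rw [← cancel_mono i, Category.assoc, hr, Preadditive.comp_sub, reassoc_of% w]
      simp
    exact Module.Finite.of_surjective r.hom fun x => ⟨i x, hom_apply_of_comp_eq hi x⟩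
  · rw [projective_iff_hasProjectiveDimensionLT_one]
    have := h₂.2
    have := h₃.2
    exact hS.hasProjectiveDimensionLT_X₁ 1 inferInstance inferInstance
  · exact (isDeflation_shortExact_iff _).2 inferInstance
  · refine ⟨P, ModuleCat.of R PUnit, 𝟙 P, 0, comp_zero, ?_,
      ⟨inferInstance, (ModuleCat.isZero_of_subsingleton _).projective⟩, mem hP⟩
    change (ShortComplex.mk _ _ _).ShortExact
    rw [shortExact_mk_iff]
    exact ⟨Function.injective_id, fun _ => ⟨0, Subsingleton.elim _ _⟩, fun y _ => ⟨y, rfl⟩⟩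

end

section

variable {R : Type u} [Ring R] {S : Type u} [Ring S] (f : R →+* S)

lemma shortExact_restrictScalars_iff {X Y Z : ModuleCat.{u} S} (i : X ⟶ Y) (p : Y ⟶ Z)
    (w : i ≫ p = 0)
    (w' : (ModuleCat.restrictScalars f).map i ≫ (ModuleCat.restrictScalars f).map p = 0) :
    (ShortComplex.mk ((ModuleCat.restrictScalars f).map i) ((ModuleCat.restrictScalars f).map p)
      w').ShortExact ↔ (ShortComplex.mk i p w).ShortExact := by
  rw [shortExact_mk_iff, shortExact_mk_iff]
  exact Iff.rfl

lemma shortExact_restrictScalars {X Y Z : ModuleCat.{u} S} {i : X ⟶ Y} {p : Y ⟶ Z}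
    {w : i ≫ p = 0} (h : (ShortComplex.mk i p w).ShortExact) :
    ∃ w' : (ModuleCat.restrictScalars f).map i ≫ (ModuleCat.restrictScalars f).map p = 0,
    (ShortComplex.mk ((ModuleCat.restrictScalars f).map i) ((ModuleCat.restrictScalars f).map p)
      w').ShortExact := by
  refine ⟨?_, (shortExact_restrictScalars_iff f i p w _).2 h⟩
  rw [← Functor.map_comp, w, Functor.map_zero]

/-- The `S`-modules whose restriction to `R` has finite projective dimension. -/
def FinitePd : ObjectProperty (ModuleCat.{u} S) := fun M =>
  ∃ n : ℕ, HasProjectiveDimensionLT ((ModuleCat.restrictScalars.{u} f).obj M) n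

variable {f}

lemma FinitePd.two_of_three {X Y Z : ModuleCat.{u} S} {i : X ⟶ Y} {p : Y ⟶ Z} {w : i ≫ p = 0}
    (h : (ShortComplex.mk i p w).ShortExact) :
    (FinitePd f X → FinitePd f Z → FinitePd f Y) ∧ (FinitePd f Y → FinitePd f Z → FinitePd f X) ∧
      (FinitePd f X → FinitePd f Y → FinitePd f Z) := by
  obtain ⟨w', h'⟩ := shortExact_restrictScalars f h
  refine ⟨?_, ?_, ?_⟩
  · rintro ⟨a, ha⟩ ⟨b, hb⟩
    exact ⟨max a b, h'.hasProjectiveDimensionLT_X₂ _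
      (hasProjectiveDimensionLT_of_ge _ a _ (le_max_left _ _))
      (hasProjectiveDimensionLT_of_ge _ b _ (le_max_right _ _))⟩
  · rintro ⟨a, ha⟩ ⟨b, hb⟩
    exact ⟨max a b, h'.hasProjectiveDimensionLT_X₁ _
      (hasProjectiveDimensionLT_of_ge _ a _ (le_max_left _ _))
      (hasProjectiveDimensionLT_of_ge _ b _ (le_trans (le_max_right _ _) (Nat.le_succ _)))⟩
  · rintro ⟨a, ha⟩ ⟨b, hb⟩
    exact ⟨max a b + 1, h'.hasProjectiveDimensionLT_X₃ _
      (hasProjectiveDimensionLT_of_ge _ a _ (le_max_left _ _))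
      (hasProjectiveDimensionLT_of_ge _ b _ (le_trans (le_max_right _ _) (Nat.le_succ _)))⟩

lemma FinitePd.of_iso {X Y : ModuleCat.{u} S} (e : X ≅ Y) (h : FinitePd f X) : FinitePd f Y := by
  obtain ⟨n, hn⟩ := h
  exact ⟨n, hasProjectiveDimensionLT_of_iso ((ModuleCat.restrictScalars f).mapIso e) n⟩

lemma finitePd_of_isZero {X : ModuleCat.{u} S} (h : IsZero X) : FinitePd f X :=
  ⟨0, (hasProjectiveDimensionLT_zero_iff_isZero _).2 (Functor.map_isZero _ h)⟩

lemma finitePd_pi (h : FinitePd f (ModuleCat.of S S)) (n : ℕ) :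
    FinitePd f (ModuleCat.of S (Fin n → S)) := by
  induction n with
  | zero => exact finitePd_of_isZero (ModuleCat.isZero_of_subsingleton _)
  | succ n ih =>
    have w : ModuleCat.ofHom (LinearMap.single S (fun _ : Fin (n + 1) => S) 0) ≫
        ModuleCat.ofHom (LinearMap.funLeft S S Fin.succ) = 0 := by
      ext i
      exact Pi.single_eq_of_ne (M := fun _ => S) (Fin.succ_ne_zero i) (1 : S)
    refine (FinitePd.two_of_three (w := w) ?_).1 h ih
    rw [shortExact_mk_iff]
    refine ⟨Pi.single_injective (M := fun _ : Fin (n + 1) => S) 0,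
      fun y => ⟨Fin.cons (α := fun _ => S) 0 y, ?_⟩, fun y hy => ⟨y 0, ?_⟩⟩
    · funext i
      exact Fin.cons_succ (α := fun _ => S) 0 y i
    · funext i
      refine Fin.cases ?_ (fun i => ?_) i
      · exact Pi.single_eq_same (M := fun _ : Fin (n + 1) => S) 0 (y 0)
      · exact (Pi.single_eq_of_ne (M := fun _ => S) (Fin.succ_ne_zero i) (y 0)).trans
          (congrFun hy i).symm

instance {ι : Type u} : Projective (ModuleCat.of R (ι →₀ R)) :=
  ModuleCat.projective_of_free Finsupp.basisSingleOne

lemma projective_pi (n : ℕ) : Projective (ModuleCat.of R (Fin n → R)) :=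
  ModuleCat.projective_of_free (Pi.basisFun R (Fin n))

/-- A morphism from a finitely generated module to a projective module factors through a finite free
module. -/
lemma exists_factor_finite_free {M P : ModuleCat.{u} R} [Module.Finite R M] [Projective P]
    (i : M ⟶ P) : ∃ (n : ℕ) (j : M ⟶ ModuleCat.of R (Fin n → R))
      (k : ModuleCat.of R (Fin n → R) ⟶ P), j ≫ k = i := by
  have : Module.Projective R P := inferInstance
  obtain ⟨s, hs⟩ := Module.projective_def'.1 this
  obtain ⟨t, ht⟩ : ∃ t : Finset P, ∀ x : M, s (i x) ∈ Finsupp.supported R R (t : Set P) := by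
    classical
    obtain ⟨g, hg⟩ := Module.Finite.fg_top (R := R) (M := M)
    refine ⟨g.biUnion fun x => (s (i x)).support, fun x => ?_⟩
    have hx : x ∈ Submodule.span R (g : Set M) := hg ▸ Submodule.mem_top
    induction hx using Submodule.span_induction with
    | mem x hx =>
      rw [Finsupp.mem_supported]
      exact Finset.coe_subset.2 (Finset.subset_biUnion_of_mem (fun x => (s (i x)).support) hx)
    | zero => simp
    | add x y _ _ hx hy => rw [map_add, map_add]; exact Submodule.add_mem _ hx hy
    | smul a x _ hx => rw [map_smul, map_smul]; exact Submodule.smul_mem _ _ hx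
  let e := t.equivFin
  refine ⟨t.card, ModuleCat.ofHom (LinearMap.pi fun l =>
    Finsupp.lapply (e.symm l : P) ∘ₗ s ∘ₗ i.hom), ModuleCat.ofHom (Fintype.linearCombination R
      fun l => (e.symm l : P)), ?_⟩
  ext x
  have h₁ : Finsupp.linearCombination R id (s (i x)) = i x :=
    congrArg (fun k : P →ₗ[R] P => k (i x)) hs
  refine Eq.trans ?_ h₁
  rw [Finsupp.linearCombination_apply, Finsupp.sum_of_support_subset _
    (Finset.coe_subset.1 ((Finsupp.mem_supported _ _).1 (ht x))) _ (by simp),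
    ← Finset.sum_coe_sort, ← e.symm.sum_comp]
  exact Fintype.linearCombination_apply R (fun l => (e.symm l : P))
    (fun l => s (i x) (e.symm l))

/-- The finitely generated Gorenstein projective `S`-modules of finite projective dimension over
`R` form a Frobenius class if `S` is noetherian and of finite projective dimension over `R`. -/
theorem isFrobeniusClass_fgGProjFinite [IsNoetherianRing S] (h : FinitePd f (ModuleCat.of S S)) :
    IsFrobeniusClass (shortExact S) (fgGProjFinite f) := by
  have hS := isWICExactCategory_shortExact S
  have free : ∀ n : ℕ, IsProjInj (shortExact S) (fgGProjFinite f)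
      (ModuleCat.of S (Fin n → S)) := fun n => by
    refine GProj.isProjInj (fun _ h => h.2.1) (projective_pi n)
      ⟨inferInstance, gproj_of_projective (projective_pi n), finitePd_pi h n⟩
  refine IsFrobeniusClass.of_ext_ker hS
    (fun Z hZ => ⟨?_, gproj_of_projective hZ.projective, finitePd_of_isZero hZ⟩)
    ⟨fun e h => ⟨?_, gproj_iso e h.2.1, FinitePd.of_iso e h.2.2⟩⟩
    (fun T hT h₁ h₃ => ⟨?_, GProj.ext hT h₁.2.1 h₃.2.1,
      (FinitePd.two_of_three hT).1 h₁.2.2 h₃.2.2⟩)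
    (fun T hT h₂ h₃ => ⟨?_, GProj.ker hT h₂.2.1 h₃.2.1,
      (FinitePd.two_of_three hT).2.1 h₂.2.2 h₃.2.2⟩) (fun M hM => ?_) (fun M hM => ?_)
  · have := ModuleCat.subsingleton_of_isZero hZ
    infer_instance
  · have := h.1
    exact Module.Finite.equiv e.toLinearEquiv
  · obtain @⟨X, Y, Z, i, p, w⟩ := T
    obtain ⟨-, h₅, h₆⟩ := (shortExact_mk_iff i p w).1 hT
    have : Module.Finite S X := h₁.1
    have : Module.Finite S Z := h₃.1
    exact Module.Finite.of_exact (f := i.hom) (g := p.hom) (fun y => ⟨h₆ y, by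
      rintro ⟨x, rfl⟩
      exact hom_apply_of_comp_eq w x⟩) h₅
  · obtain @⟨X, Y, Z, i, p, w⟩ := T
    have : Module.Finite S Y := h₂.1
    exact Module.Finite.of_injective i.hom ((shortExact_mk_iff i p w).1 hT).1
  · have := hM.1
    obtain ⟨n, p, hp⟩ := Module.Finite.exists_fin' S M
    exact ⟨_, ModuleCat.ofHom p, (isDeflation_shortExact_iff _).2
      ((ModuleCat.epi_iff_surjective _).2 hp), free n⟩
  · have := hM.1
    obtain ⟨P, N, i, p, w, hi, hP, hN⟩ := hM.2.1.exists_cosyzygy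
    -- The embedding into a projective module factors through a finite free module, and closure
    -- of Gorenstein projective modules under the cokernels in question applies.
    obtain ⟨n, j, k, rfl⟩ := exists_factor_finite_free i
    have := hi.mono_f
    have : Mono j := mono_of_mono j k
    have hj : (ShortComplex.mk j (cokernel.π j) (cokernel.condition j)).ShortExact :=
      ⟨ShortComplex.exact_of_g_is_cokernel _ (cokernelIsCokernel j)⟩
    refine ⟨_, _, _, _, _, hj, ⟨?_, (isFrobeniusClass_gproj S).coker j k _ p _ w hj hi hM.2.1
      (gproj_of_projective (projective_pi n)) (gproj_of_projective hP) hN,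
      (FinitePd.two_of_three hj).2.2 hM.2.2 (free n).mem.2.2⟩, free n⟩
    have := hj.epi_g
    exact Module.Finite.of_surjective (cokernel.π j).hom
      ((ModuleCat.epi_iff_surjective (cokernel.π j)).1 inferInstance)

end

/-! ### Twisting -/

section

variable {A : Type u} [Ring A] (σ : A ≃+* A)

lemma isExactAutoequivalence_twist : IsExactAutoequivalence (twist σ) (shortExact A) where
  isEquivalence := (ModuleCat.restrictScalarsEquivalenceOfRingEquiv σ).isEquivalence_functor
  conflation_iff := by
    rintro ⟨i, p, w⟩
    exact shortExact_restrictScalars_iff (σ : A →+* A) i p w _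

instance : (twist σ).IsEquivalence := (isExactAutoequivalence_twist σ).isEquivalence

/-- Twisting by an automorphism is undone by twisting by its inverse. -/
noncomputable def twistSymmIso (M : ModuleCat.{u} A) :
    (twist σ).obj ((twist σ.symm).obj M) ≅ M where
  hom := ModuleCat.ofHom (X := (twist σ).obj ((twist σ.symm).obj M))
    { toFun := fun m : M => m
      map_add' := fun _ _ => rfl
      map_smul' := fun a (m : M) => by
        change σ.symm (σ a) • m = a • m
        rw [σ.symm_apply_apply] }
  inv := ModuleCat.ofHom (Y := (twist σ).obj ((twist σ.symm).obj M))
    { toFun := fun m : M => m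
      map_add' := fun _ _ => rfl
      map_smul' := fun a (m : M) => by
        change a • m = σ.symm (σ a) • m
        rw [σ.symm_apply_apply] }

/-- Twisting by the inverse of an automorphism is undone by twisting by the automorphism. -/
noncomputable def symmTwistIso (M : ModuleCat.{u} A) :
    (twist σ.symm).obj ((twist σ).obj M) ≅ M :=
  twistSymmIso σ.symm M

lemma projective_twist {P : ModuleCat.{u} A} (h : Projective P) : Projective ((twist σ).obj P) :=
  ((ModuleCat.restrictScalarsEquivalenceOfRingEquiv σ).map_projective_iff P).2 h

lemma perp_twist {M : ModuleCat.{u} A} (hM : Perp M) : Perp ((twist σ).obj M) := by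
  refine perp_of_syzygy (fun N => ∃ M, Perp M ∧ N = (twist σ).obj M) ?_ ⟨M, hM, rfl⟩
  rintro _ ⟨M, hM, rfl⟩
  have h : (ShortComplex.mk _ _ (kernel.condition (Projective.π M))).ShortExact :=
    ⟨ShortComplex.exact_of_f_is_kernel _ (kernelIsKernel _)⟩
  obtain ⟨w, h'⟩ := shortExact_restrictScalars (σ : A →+* A) h
  refine ⟨_, _, _, _, w, h', projective_twist σ (Projective.projective_over M),
    ⟨_, Perp.ker h (perp_of_projective (Projective.projective_over M)) hM, rfl⟩, fun Q hQ f => ?_⟩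
  obtain ⟨g, hg⟩ := (twist σ).map_surjective (f ≫ (twistSymmIso σ Q).inv)
  obtain ⟨k, rfl⟩ : ∃ k, _ ≫ k = g := hM.exists_extension h (projective_twist σ.symm hQ) g
  exact ⟨(twist σ).map k ≫ (twistSymmIso σ Q).hom, by
    rw [← Category.assoc, ← Functor.map_comp, hg, Category.assoc, Iso.inv_hom_id,
      Category.comp_id]⟩

lemma gproj_twist {M : ModuleCat.{u} A} (hM : GProj A M) : GProj A ((twist σ).obj M) := by
  refine gproj_of_class (fun N => ∃ M, GProj A M ∧ N = (twist σ).obj M) ?_ ?_ ⟨M, hM, rfl⟩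
  · rintro _ ⟨M, hM, rfl⟩
    exact perp_twist σ hM.perp
  · rintro _ ⟨M, hM, rfl⟩
    obtain ⟨P, N, i, p, w, h, hP, hN⟩ := hM.exists_cosyzygy
    obtain ⟨w', h'⟩ := shortExact_restrictScalars (σ : A →+* A) h
    exact ⟨_, _, _, _, w', h', projective_twist σ hP, N, hN, rfl⟩

lemma gproj_twist_iff (M : ModuleCat.{u} A) : GProj A ((twist σ).obj M) ↔ GProj A M :=
  ⟨fun h => gproj_iso (symmTwistIso σ M) (gproj_twist σ.symm h), gproj_twist σ⟩

lemma fgProj_twist {M : ModuleCat.{u} A} (hM : fgProj A M) : fgProj A ((twist σ).obj M) := by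
  refine ⟨?_, projective_twist σ hM.2⟩
  have := hM.1
  have : RingHomInvPair (σ.symm : A →+* A) (σ : A →+* A) := RingHomInvPair.of_ringEquiv σ.symm
  have := RingHomInvPair.symm (σ.symm : A →+* A) (σ : A →+* A)
  exact Module.Finite.of_surjective (σ := (σ.symm : A →+* A)) (M := M) (P := (twist σ).obj M)
    { toFun := fun m : M => m
      map_add' := fun _ _ => rfl
      map_smul' := fun a m => by
        change a • m = σ (σ.symm a) • m
        rw [σ.apply_symm_apply] } fun m => ⟨m, rfl⟩

lemma fgProj_twist_iff (M : ModuleCat.{u} A) : fgProj A ((twist σ).obj M) ↔ fgProj A M :=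
  ⟨fun h => (isFrobeniusClass_fgProj A).iso.of_iso (symmTwistIso σ M) (fgProj_twist σ.symm h),
    fgProj_twist σ⟩

end

section

variable {A : Type u} [Ring A] {ω' ω : A} {σ' σ : A ≃+* A} {ξ : Aˣ} (h : IsOfType ω' ω σ' σ ξ)

lemma isCompatible_gproj : (pairOfType h).IsCompatible (shortExact A) (GProj A) where
  exact := isWICExactCategory_shortExact A
  frobenius := isFrobeniusClass_gproj A
  autT := isExactAutoequivalence_twist σ
  autT' := isExactAutoequivalence_twist σ'
  memT := gproj_twist_iff σ
  memT' := gproj_twist_iff σ'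

lemma isCompatible_fgProj : (pairOfType h).IsCompatible (shortExact A) (fgProj A) where
  exact := isWICExactCategory_shortExact A
  frobenius := isFrobeniusClass_fgProj A
  autT := isExactAutoequivalence_twist σ
  autT' := isExactAutoequivalence_twist σ'
  memT := fgProj_twist_iff σ
  memT' := fgProj_twist_iff σ'

end

/-! ### Passing to the quotient by a regular normal element -/

section

variable {C : Type u} [Category.{v} C] [Preadditive C] {E : ObjectProperty (ShortComplex C)}

/-- In the composite of a deflation `p : Y ⟶ Z` with the end of a conflation `K ⟶ Z ⟶ W`,
the kernel of `Y ⟶ W` is an extension of `K` by the kernel of `p`. -/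
lemma IsExactCategory.exists_conflation_comp_op (hE : IsExactCategory E) {X Y Z K W : C} {i : X ⟶ Y}
    {p : Y ⟶ Z} {w : i ≫ p = 0} (h : E (ShortComplex.mk i p w)) {k : K ⟶ Z} {q : Z ⟶ W}
    {w' : k ≫ q = 0} (h' : E (ShortComplex.mk k q w')) :
    ∃ (U : C) (a : X ⟶ U) (b : U ⟶ K) (c : U ⟶ Y) (wa : a ≫ b = 0) (wc : c ≫ p ≫ q = 0),
      E (ShortComplex.mk a b wa) ∧ E (ShortComplex.mk c (p ≫ q) wc) ∧ a ≫ c = i ∧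
        c ≫ p = b ≫ k := by
  obtain ⟨U, c, b, sq, hb⟩ := hE.ex2 p k ⟨_, _, _, h⟩
  obtain ⟨a, wa, hac, ha⟩ := hE.conflation_of_isPullback h sq hb
  have := hE.mono_f h'
  have wc : c ≫ p ≫ q = 0 := by rw [← Category.assoc, sq.w, Category.assoc, w', comp_zero]
  refine ⟨U, a, b, c, wa, wc, ha, hE.conflation_of_kernel wc
    (hE.ex1 _ _ ⟨_, _, _, h⟩ ⟨_, _, _, h'⟩) ⟨fun x y hxy => ?_⟩ (fun T f hf => ?_), hac, sq.w⟩
  · refine sq.hom_ext hxy ?_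
    rw [← cancel_mono k, Category.assoc, Category.assoc, ← sq.w, ← Category.assoc, hxy,
      Category.assoc]
  · obtain ⟨g, hg⟩ := hE.exists_lift h' (f ≫ p) (by rw [Category.assoc, hf])
    exact ⟨sq.lift f g hg.symm, sq.lift_fst _ _ _⟩

/-- Two conflations with the same last term have a common refinement. -/
lemma IsExactCategory.exists_common_refinement (hE : IsExactCategory E) {X₀ X₁ Y₀ Y₁ M : C}
    {i : X₀ ⟶ X₁} {p : X₁ ⟶ M} {w : i ≫ p = 0} (hX : E (ShortComplex.mk i p w)) {j : Y₀ ⟶ Y₁}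
    {q : Y₁ ⟶ M} {w' : j ≫ q = 0} (hY : E (ShortComplex.mk j q w')) :
    ∃ (W : C) (i' : X₀ ⟶ W) (a : W ⟶ Y₁) (j' : Y₀ ⟶ W) (b : W ⟶ X₁) (wi : i' ≫ a = 0)
      (wj : j' ≫ b = 0), E (ShortComplex.mk i' a wi) ∧ E (ShortComplex.mk j' b wj) ∧
        i' ≫ b = i ∧ j' ≫ a = j ∧ b ≫ p = a ≫ q := by
  obtain ⟨W, b, a, sq, hb⟩ := hE.ex2 p q ⟨_, _, _, hX⟩
  obtain ⟨i', wi, hi₁, hi⟩ := hE.conflation_of_isPullback hX sq hb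
  obtain ⟨W', a', b', sq', ha⟩ := hE.ex2 q p ⟨_, _, _, hY⟩
  obtain ⟨j', wj, hj₁, hj⟩ := hE.conflation_of_isPullback hY sq' ha
  let e := sq.isoIsPullback _ _ sq'.flip
  have hea : e.inv ≫ b = b' := by simp [e]
  have hea' : e.inv ≫ a = a' := by simp [e]
  have wj' : (j' ≫ e.inv) ≫ b = 0 := by rw [Category.assoc, hea, wj]
  refine ⟨W, i', a, j' ≫ e.inv, b, wi, wj', hi, hE.of_iso (ShortComplex.isoMk
    (S₁ := ShortComplex.mk j' b' wj) (Iso.refl _) e.symm (Iso.refl _) ?_ ?_) hj, hi₁,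
    by rw [Category.assoc, hea', hj₁], sq.w⟩
  · exact Category.id_comp _
  · exact hea.trans (Category.comp_id _).symm

end

section

variable {R : Type u} [Ring R]

/-- Morphisms from a module in `Perp` lift along an epimorphism with projective kernel. -/
lemma Perp.exists_lift {X Y Z M : ModuleCat.{u} R} {i : X ⟶ Y} {p : Y ⟶ Z} {w : i ≫ p = 0}
    (h : (ShortComplex.mk i p w).ShortExact) (hX : Projective X) (hM : Perp M) (f : M ⟶ Z) :
    ∃ g, g ≫ p = f := by
  have hE := (isWICExactCategory_shortExact R).toIsExactCategory
  obtain ⟨W, b, a, sq, hb⟩ := hE.ex2 p f ⟨_, _, _, h⟩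
  obtain ⟨j, wj, -, hj⟩ := hE.conflation_of_isPullback h sq hb
  obtain ⟨r, hr⟩ : ∃ r, j ≫ r = 𝟙 X := hM.exists_extension hj hX (𝟙 X)
  obtain ⟨s, hs⟩ := hE.exists_desc hj (𝟙 W - r ≫ j) (by
    rw [Preadditive.comp_sub, ← Category.assoc, hr]
    simp)
  have := hE.epi_g hj
  have hs' : s ≫ a = 𝟙 M := by
    rw [← cancel_epi a, ← Category.assoc, hs, Preadditive.sub_comp, Category.assoc, wj]
    simp
  exact ⟨s ≫ b, by rw [Category.assoc, sq.w, reassoc_of% hs']⟩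

end

/-- The ring homomorphism `π : R → S` is the projection to the quotient of `R` by the ideal
generated by the regular normal element `w`, and `τ` is the automorphism of `R` with
`w r = τ(r) w`. -/
structure IsRegularQuotient {R S : Type u} [Ring R] [Ring S] (π : R →+* S) (w : R) (τ : R ≃+* R) :
    Prop where
  surjective : Function.Surjective π
  exists_of_map_eq_zero : ∀ r, π r = 0 → ∃ s, w * s = r
  map_eq_zero : π w = 0
  regular : IsRegular w
  mul : ∀ r, w * r = τ r * w

namespace IsRegularQuotient

variable {R S : Type u} [Ring R] [Ring S] {π : R →+* S} {w : R} {τ : R ≃+* R}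

lemma exists_hom_of_restrictScalars (hπ : Function.Surjective π) {M N : ModuleCat.{u} S}
    (f : (ModuleCat.restrictScalars π).obj M ⟶ (ModuleCat.restrictScalars π).obj N) :
    ∃ g : M ⟶ N, (ModuleCat.restrictScalars π).map g = f := by
  refine ⟨ModuleCat.ofHom (X := M) (Y := N)
    { toFun := fun m : M => (f m : N)
      map_add' := fun x y => map_add f.hom x y
      map_smul' := fun s m => ?_ }, rfl⟩
  obtain ⟨r, rfl⟩ := hπ s
  exact f.hom.map_smul r (m : (ModuleCat.restrictScalars π).obj M)

variable (hw : IsRegularQuotient π w τ)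
include hw

lemma map_self : τ w = w := (hw.regular.right (hw.mul w)).symm

/-- Multiplication by the regular normal element as a natural transformation. -/
noncomputable abbrev nat : 𝟭 (ModuleCat.{u} R) ⟶ twist τ := mulNat w τ hw.mul

lemma nat_twist (M : ModuleCat.{u} R) :
    hw.nat.app ((twist τ).obj M) = (twist τ).map (hw.nat.app M) := by
  ext m
  have key : ∀ x : M, τ w • x = w • x := fun x => by rw [hw.map_self]
  exact key m

lemma nat_restrictScalars (M : ModuleCat.{u} S) :
    hw.nat.app ((ModuleCat.restrictScalars π).obj M) = 0 := by
  ext m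
  have key : ∀ x : M, π w • x = 0 := fun x => by rw [hw.map_eq_zero, zero_smul]
  exact key m

/-- A module annihilated by `w` is the restriction of a module over the quotient. -/
lemma exists_restrictScalars_iso {V : ModuleCat.{u} R} (hV : hw.nat.app V = 0) :
    ∃ V' : ModuleCat.{u} S, Nonempty ((ModuleCat.restrictScalars π).obj V' ≅ V) := by
  have hV : ∀ v : V, w • v = 0 := fun v => congrArg (fun k => (ModuleCat.Hom.hom k) v) hV
  have key : ∀ r r' : R, π r = π r' → ∀ v : V, r • v = r' • v := fun r r' h v => by
    obtain ⟨s, hs⟩ := hw.exists_of_map_eq_zero (r - r') (by rw [map_sub, h, sub_self])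
    rw [← sub_eq_zero, ← sub_smul, ← hs, mul_smul, hV]
  obtain ⟨σ, hσ⟩ := hw.surjective.hasRightInverse
  let m : Module S V :=
    { smul := fun s v => σ s • v
      one_smul := fun v => (key _ 1 (by rw [hσ, map_one]) v).trans (one_smul R v)
      mul_smul := fun s t v => (key _ (σ s * σ t) (by rw [hσ, map_mul, hσ, hσ]) v).trans
        (mul_smul _ _ v)
      smul_zero := fun s => smul_zero (σ s)
      smul_add := fun s => smul_add (σ s)
      add_smul := fun s t v => (key _ (σ s + σ t) (by rw [hσ, map_add, hσ, hσ]) v).trans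
        (add_smul _ _ v)
      zero_smul := fun v => (key _ 0 (by rw [hσ, map_zero]) v).trans (zero_smul R v) }
  have hsmul : ∀ (r : R) (v : V), m.smul (π r) v = r • v := fun r v => key _ _ (hσ _) v
  let V' : ModuleCat.{u} S := @ModuleCat.of S _ V _ m
  exact ⟨V', ⟨
    { hom := ModuleCat.ofHom (X := (ModuleCat.restrictScalars π).obj V') (Y := V)
        { toFun := fun v => v
          map_add' := fun _ _ => rfl
          map_smul' := fun r v => hsmul r v }
      inv := ModuleCat.ofHom (X := V) (Y := (ModuleCat.restrictScalars π).obj V')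
        { toFun := fun v => v
          map_add' := fun _ _ => rfl
          map_smul' := fun r v => (hsmul r v).symm } }⟩⟩

/-- The last term of a short exact sequence may be replaced by the restriction of a module over
the quotient if it is annihilated by `w`. -/
lemma exists_restrictScalars_shortExact {X Y V : ModuleCat.{u} R} {i : X ⟶ Y} {p : Y ⟶ V}
    {w' : i ≫ p = 0} (h : (ShortComplex.mk i p w').ShortExact) (hV : hw.nat.app V = 0) :
    ∃ (V' : ModuleCat.{u} S) (p' : Y ⟶ (ModuleCat.restrictScalars π).obj V') (w'' : i ≫ p' = 0),
      (ShortComplex.mk i p' w'').ShortExact := by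
  obtain ⟨V', ⟨e⟩⟩ := hw.exists_restrictScalars_iso hV
  have w'' : i ≫ p ≫ e.inv = 0 := by rw [← Category.assoc, w', zero_comp]
  refine ⟨V', p ≫ e.inv, w'', ShortComplex.shortExact_of_iso (ShortComplex.isoMk
    (S₁ := ShortComplex.mk i p w') (Iso.refl _) (Iso.refl _) e.symm ?_ ?_) h⟩
  · exact (Category.id_comp _).trans (Category.comp_id _).symm
  · exact Category.id_comp _

lemma mono_nat_projective {P : ModuleCat.{u} R} (hP : Projective P) : Mono (hw.nat.app P) := by
  have : Module.Projective R P := inferInstance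
  obtain ⟨s, hs⟩ := Module.projective_def'.1 this
  have hs : ∀ x : P, Finsupp.linearCombination R id (s x) = x :=
    fun x => congrArg (fun k : P →ₗ[R] P => k x) hs
  rw [ModuleCat.mono_iff_injective, injective_iff_map_eq_zero]
  intro x hx
  have hx : w • x = 0 := hx
  have : w • s x = 0 := by rw [← map_smul, hx, map_zero]
  have : s x = 0 := by
    ext i
    exact hw.regular.left ((DFunLike.congr_fun this i).trans (mul_zero w).symm)
  rw [← hs x, this, map_zero]

/-- The element `w` acts injectively on Gorenstein projective modules. -/
lemma mono_nat {M : ModuleCat.{u} R} (hM : GProj R M) : Mono (hw.nat.app M) := by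
  obtain ⟨P, N, i, p, w', h, hP, -⟩ := hM.exists_cosyzygy
  have := h.mono_f
  have := hw.mono_nat_projective hP
  have h := Factorization.naturality_ω (ω := hw.nat) i
  have : Mono (hw.nat.app M ≫ (twist τ).map i) := h ▸ mono_comp i _
  exact mono_of_mono _ ((twist τ).map i)

/-- Projective modules over the quotient are direct summands of cokernels of multiplications by
`w` on projective modules. -/
lemma exists_presentation {Q : ModuleCat.{u} S} (hQ : Projective Q) :
    ∃ (Q' : ModuleCat.{u} S) (_ : Retract Q Q') (F : ModuleCat.{u} R)
      (q : (twist τ).obj F ⟶ (ModuleCat.restrictScalars π).obj Q') (w' : hw.nat.app F ≫ q = 0),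
      Projective F ∧ Projective Q' ∧ (ShortComplex.mk _ q w').ShortExact := by
  have : Module.Projective S Q := inferInstance
  obtain ⟨s, hs⟩ := Module.projective_def'.1 this
  let L := ModuleCat.of R (Q →₀ R)
  let Q' := ModuleCat.of S (Q →₀ S)
  let q : (twist τ).obj ((twist τ.symm).obj L) ⟶ (ModuleCat.restrictScalars π).obj Q' :=
    (twistSymmIso τ L).hom ≫ ModuleCat.ofHom (X := L) (Y := (ModuleCat.restrictScalars π).obj Q')
      { toFun := fun x => (x.mapRange π (map_zero π) : Q →₀ S)
        map_add' := fun x y => Finsupp.mapRange_add (fun a b => map_add π a b) x y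
        map_smul' := fun r x => by
          change Finsupp.mapRange π _ (r • x) = π r • Finsupp.mapRange π _ x
          ext i
          exact map_mul π r (x i) }
  have hq : ∀ x : Q →₀ R, q x = (x.mapRange π (map_zero π) : Q →₀ S) := fun _ => rfl
  have hwL : ∀ x : Q →₀ R, hw.nat.app ((twist τ.symm).obj L) x = (w • x : Q →₀ R) := fun x => by
    change τ.symm w • x = w • x
    rw [τ.symm_apply_eq.2 hw.map_self.symm]
  have hF : Projective ((twist τ.symm).obj L) := projective_twist τ.symm inferInstance
  refine ⟨Q', ⟨ModuleCat.ofHom s, ModuleCat.ofHom (Finsupp.linearCombination S id),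
    ModuleCat.hom_ext hs⟩, (twist τ.symm).obj L, q, ?_, hF, inferInstance, ?_⟩
  · ext x : 2
    refine (congrArg q (hwL x)).trans ?_
    rw [hq]
    refine Finsupp.ext fun i => (map_mul π w _).trans ?_
    rw [hw.map_eq_zero, zero_mul]
    rfl
  · rw [shortExact_mk_iff]
    refine ⟨(ModuleCat.mono_iff_injective _).1 (hw.mono_nat_projective hF), fun y => ?_,
      fun x hx => ?_⟩
    · obtain ⟨x, hx⟩ := Finsupp.mapRange_surjective π (map_zero π) hw.surjective y
      exact ⟨x, hx⟩
    · change Q →₀ R at x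
      rw [hq] at hx
      have hx : ∀ i, π (x i) = 0 := fun i => congrArg (fun y : Q →₀ S => y i) hx
      classical
      let c : R → R := fun r => if h : π r = 0 ∧ r ≠ 0 then
        (hw.exists_of_map_eq_zero r h.1).choose else 0
      have hc : ∀ r, π r = 0 → w * c r = r := fun r hr => by
        by_cases h : r = 0
        · simp [c, h]
        · have h' : π r = 0 ∧ r ≠ 0 := ⟨hr, h⟩
          simp only [c, dif_pos h']
          exact (hw.exists_of_map_eq_zero r h'.1).choose_spec
      refine ⟨(x.mapRange c (by simp [c]) : Q →₀ R), ?_⟩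
      exact (hwL _).trans (Finsupp.ext fun i => hc _ (hx i))

/-- Projective modules over the quotient have projective dimension at most one over `R`. -/
lemma hasProjectiveDimensionLT_two {Q : ModuleCat.{u} S} (hQ : Projective Q) :
    HasProjectiveDimensionLT ((ModuleCat.restrictScalars π).obj Q) 2 := by
  obtain ⟨Q', r, F, q, w', hF, -, h⟩ := hw.exists_presentation hQ
  have := projective_twist τ hF
  have := h.hasProjectiveDimensionLT_X₃ 1 (projective_iff_hasProjectiveDimensionLT_one.1 hF)
    (hasProjectiveDimensionLT_of_ge _ 1 _ (by omega))
  exact (r.map (ModuleCat.restrictScalars π)).hasProjectiveDimensionLT 2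

/-- The cokernel of `d0` is projective for projective factorizations, because taking cokernels is
left adjoint to an exact functor. -/
lemma projective_of_cokernel {J : Factorization (twist τ) hw.nat}
    (hJ : IsProj (Factorization.conflations (shortExact R)) J) {N : ModuleCat.{u} S}
    {p : J.X1 ⟶ (ModuleCat.restrictScalars π).obj N} {w' : J.d0 ≫ p = 0}
    (hp : (ShortComplex.mk J.d0 p w').ShortExact) : Projective N := by
  have hE := isWICExactCategory_shortExact R
  refine ⟨fun {M₁ M₂} f g hg => ?_⟩
  have hg' : IsDeflation (shortExact R) ((ModuleCat.restrictScalars π).map g) :=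
    (isDeflation_shortExact_iff _).2 ((ModuleCat.epi_iff_surjective _).2
      ((ModuleCat.epi_iff_surjective g).1 hg))
  obtain ⟨k, hk⟩ := Factorization.exists_lift_of_toOfZero hE.toIsExactCategory hp (isZero_zero _)
    (hw.nat_restrictScalars _) (hw.nat_restrictScalars _) (fun f => hJ.exists_lift
      (Factorization.isDeflation_toOfZero hE (isExactAutoequivalence_twist τ) _ _ _ hg') f)
    ((ModuleCat.restrictScalars π).map f)
  obtain ⟨k, rfl⟩ := exists_hom_of_restrictScalars hw.surjective k
  exact ⟨k, (ModuleCat.restrictScalars π).map_injective (by rw [Functor.map_comp, hk])⟩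

end IsRegularQuotient

lemma projective_X₂ {R : Type u} [Ring R] {T : ShortComplex (ModuleCat.{u} R)} (hT : T.ShortExact)
    (h₁ : Projective T.X₁) (h₃ : Projective T.X₃) : Projective T.X₂ :=
  projective_iff_hasProjectiveDimensionLT_one.2 (hT.hasProjectiveDimensionLT_X₂ 1
    (projective_iff_hasProjectiveDimensionLT_one.1 h₁)
    (projective_iff_hasProjectiveDimensionLT_one.1 h₃))

namespace IsRegularQuotient

open Factorization

variable {R S : Type u} [Ring R] [Ring S] {π : R →+* S} {w : R} {τ : R ≃+* R}

variable (π) in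
/-- The kernels of epimorphisms from projective `R`-modules to Gorenstein projective modules over
the quotient. -/
def IsSyzygy (Y : ModuleCat.{u} R) : Prop :=
  ∃ (M : ModuleCat.{u} S) (L : ModuleCat.{u} R) (c : Y ⟶ L)
    (p : L ⟶ (ModuleCat.restrictScalars π).obj M) (wp : c ≫ p = 0), GProj S M ∧ Projective L ∧
      (ShortComplex.mk c p wp).ShortExact

variable (hw : IsRegularQuotient π w τ)
include hw

/-- The morphism `d0` of a factorization with Gorenstein projective components has a cokernel which
is a module over the quotient. -/
lemma exists_cokernel_restrictScalars (X : Factorization (twist τ) hw.nat) (hX : GProj R X.X0) :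
    ∃ (N : ModuleCat.{u} S) (p : X.X1 ⟶ (ModuleCat.restrictScalars π).obj N) (w' : X.d0 ≫ p = 0),
      (ShortComplex.mk X.d0 p w').ShortExact := by
  have := hw.mono_nat hX
  have : Mono (X.d0 ≫ X.d1) := X.d0_d1 ▸ this
  have : Mono X.d0 := mono_of_mono X.d0 X.d1
  have h : (ShortComplex.mk _ _ (cokernel.condition X.d0)).ShortExact :=
    ⟨ShortComplex.exact_of_g_is_cokernel _ (cokernelIsCokernel X.d0)⟩
  exact hw.exists_restrictScalars_shortExact h
    (ω_cokernel_eq_zero (isWICExactCategory_shortExact R).toIsExactCategory h)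

/-- The cokernels of `d0` in a conflation of factorizations form a short exact sequence. -/
lemma exists_shortExact_cokernels {X Y Z : Factorization (twist τ) hw.nat} {i : X ⟶ Y} {d : Y ⟶ Z}
    {wi : i ≫ d = 0} (h : conflations (shortExact R) (ShortComplex.mk i d wi))
    {NX NY NZ : ModuleCat.{u} S} {p : X.X1 ⟶ (ModuleCat.restrictScalars π).obj NX}
    {wp : X.d0 ≫ p = 0} (hp : (ShortComplex.mk X.d0 p wp).ShortExact)
    {q : Y.X1 ⟶ (ModuleCat.restrictScalars π).obj NY} {wq : Y.d0 ≫ q = 0}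
    (hq : (ShortComplex.mk Y.d0 q wq).ShortExact)
    {r : Z.X1 ⟶ (ModuleCat.restrictScalars π).obj NZ} {wr : Z.d0 ≫ r = 0}
    (hr : (ShortComplex.mk Z.d0 r wr).ShortExact) :
    ∃ (a : NX ⟶ NY) (b : NY ⟶ NZ) (w' : a ≫ b = 0), (ShortComplex.mk a b w').ShortExact ∧
      i.f1 ≫ q = p ≫ (ModuleCat.restrictScalars π).map a ∧
      d.f1 ≫ r = q ≫ (ModuleCat.restrictScalars π).map b := by
  have hE := (isWICExactCategory_shortExact R).toIsExactCategory
  obtain ⟨a, ha⟩ := hE.exists_desc hp (i.f1 ≫ q) (by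
    rw [← Category.assoc, i.comm0, Category.assoc, wq, comp_zero])
  obtain ⟨a, rfl⟩ := exists_hom_of_restrictScalars hw.surjective a
  obtain ⟨b, hb⟩ := hE.exists_desc hq (d.f1 ≫ r) (by
    rw [← Category.assoc, d.comm0, Category.assoc, wr, comp_zero])
  obtain ⟨b, rfl⟩ := exists_hom_of_restrictScalars hw.surjective b
  obtain ⟨w', hab⟩ := shortExact_cokernels (conflations_mk_iff.1 h).1 (conflations_mk_iff.1 h).2
    hp hq hr i.comm0 d.comm0 ha.symm hb.symm
  have w'' : a ≫ b = 0 := (ModuleCat.restrictScalars π).map_injective (by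
    rw [Functor.map_comp, w', Functor.map_zero])
  exact ⟨a, b, w'', (shortExact_restrictScalars_iff π a b w'' w').1 hab, ha.symm, hb.symm⟩

lemma isFrobeniusClass_factorization : IsFrobeniusClass (conflations (ω := hw.nat) (shortExact R))
    (components (GProj R)) :=
  isFrobeniusClass (isWICExactCategory_shortExact R) (isExactAutoequivalence_twist τ) hw.nat_twist
    (isFrobeniusClass_gproj R) (gproj_twist_iff τ)

/-- The modules over the quotient which are cokernels of `d0` for factorizations with Gorenstein
projective components. -/
def IsCokernel (M : ModuleCat.{u} S) : Prop :=
  ∃ (X : Factorization (twist τ) hw.nat) (p : X.X1 ⟶ (ModuleCat.restrictScalars π).obj M)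
    (w' : X.d0 ≫ p = 0), components (GProj R) X ∧ (ShortComplex.mk X.d0 p w').ShortExact

/-- Morphisms to projective modules over the quotient extend along the monomorphism of cokernels
induced by an inflation of factorizations: they lift to morphisms to a relatively injective
factorization. -/
lemma exists_extension_cokernel {X Y Z : Factorization (twist τ) hw.nat} {i : X ⟶ Y} {d : Y ⟶ Z}
    {wi : i ≫ d = 0} (h : conflations (shortExact R) (ShortComplex.mk i d wi))
    (hX : components (GProj R) X) (hY : components (GProj R) Y) (hZ : components (GProj R) Z)
    {NX NY : ModuleCat.{u} S} {p : X.X1 ⟶ (ModuleCat.restrictScalars π).obj NX}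
    {wp : X.d0 ≫ p = 0} (hp : (ShortComplex.mk X.d0 p wp).ShortExact)
    {q : Y.X1 ⟶ (ModuleCat.restrictScalars π).obj NY} {wq : Y.d0 ≫ q = 0}
    (hq : (ShortComplex.mk Y.d0 q wq).ShortExact) {a : NX ⟶ NY}
    (ha : i.f1 ≫ q = p ≫ (ModuleCat.restrictScalars π).map a) {Q : ModuleCat.{u} S}
    (hQ : Projective Q) (f : NX ⟶ Q) : ∃ g, a ≫ g = f := by
  have hE := (isWICExactCategory_shortExact R).toIsExactCategory
  have hT := isExactAutoequivalence_twist τ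
  obtain ⟨Q', e, F, t, wt, hF, -, ht⟩ := hw.exists_presentation hQ
  obtain ⟨φ, hφ⟩ := hX.2.perp.exists_lift ht hF
    (p ≫ (ModuleCat.restrictScalars π).map (f ≫ e.i))
  obtain ⟨G, rfl⟩ := exists_hom_of_cokernel (Y := disk1 hw.nat_twist F) hE hT (w := wp) ht φ _ hφ
  obtain ⟨G', rfl⟩ := (isInjRel_disk1 (P := GProj R) (ω := hw.nat) hw.nat_twist
    (GProj.isProjInj (X := GProj R) (fun _ h => h) hF (gproj_of_projective hF)).inj).extend
      h hX hY hZ G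
  obtain ⟨G₀, G₁, c₀, c₁⟩ := G'
  change Y.X1 ⟶ (twist τ).obj F at G₁
  change Y.X0 ⟶ F at G₀
  have hφ : (i.f1 ≫ G₁) ≫ t = p ≫ (ModuleCat.restrictScalars π).map (f ≫ e.i) := hφ
  have c₀ : Y.d0 ≫ G₁ = G₀ ≫ hw.nat.app F := c₀
  obtain ⟨l, hl⟩ := hE.exists_desc hq (G₁ ≫ t) (by
    rw [← Category.assoc, c₀, Category.assoc, wt, comp_zero])
  obtain ⟨l, rfl⟩ := exists_hom_of_restrictScalars hw.surjective l
  have := hp.epi_g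
  refine ⟨l ≫ e.r, ?_⟩
  have key : a ≫ l = f ≫ e.i := (ModuleCat.restrictScalars π).map_injective (by
    rw [← cancel_epi p, Functor.map_comp, ← Category.assoc, ← ha, Category.assoc, hl,
      ← Category.assoc, hφ])
  rw [← Category.assoc, key, Category.assoc, e.retract, Category.comp_id]

/-- A covering by a projective factorization induces a syzygy of the cokernel, to which
`exists_extension_cokernel` applies. -/
lemma IsCokernel.perp {M : ModuleCat.{u} S} (hM : hw.IsCokernel M) : Perp M := by
  refine perp_of_syzygy hw.IsCokernel ?_ hM
  rintro M ⟨Z, r, wr, hZ, hr⟩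
  obtain ⟨Y, d, ⟨X, i, wi, h⟩, hY⟩ := hw.isFrobeniusClass_factorization.enoughProj Z hZ
  have hX := hw.isFrobeniusClass_factorization.ker _ h hY.mem hZ
  obtain ⟨NX, p, wp, hp⟩ := hw.exists_cokernel_restrictScalars X hX.1
  obtain ⟨NY, q, wq, hq⟩ := hw.exists_cokernel_restrictScalars Y hY.mem.1
  obtain ⟨a, b, w', hab, ha, -⟩ := hw.exists_shortExact_cokernels h hp hq hr
  exact ⟨NX, NY, a, b, w', hab, hw.projective_of_cokernel hY.proj hq, ⟨X, p, wp, hX, hp⟩,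
    fun Q hQ f => hw.exists_extension_cokernel h hX hY.mem hZ hp hq ha hQ f⟩

/-- An embedding of a factorization into a relatively injective one induces an embedding of its
cokernel into a projective module over the quotient. -/
lemma IsCokernel.gproj {M : ModuleCat.{u} S} (hM : hw.IsCokernel M) : GProj S M := by
  refine gproj_of_class hw.IsCokernel (fun _ h => h.perp) ?_ hM
  rintro M ⟨X, p, wp, hX, hp⟩
  obtain ⟨Y, Z, i, d, wi, h, hZ, hY⟩ := hw.isFrobeniusClass_factorization.enoughInj X hX
  obtain ⟨NY, q, wq, hq⟩ := hw.exists_cokernel_restrictScalars Y hY.mem.1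
  obtain ⟨NZ, r, wr, hr⟩ := hw.exists_cokernel_restrictScalars Z hZ.1
  obtain ⟨a, b, w', hab, -, -⟩ := hw.exists_shortExact_cokernels h hp hq hr
  exact ⟨NY, NZ, a, b, w', hab, hw.projective_of_cokernel hY.proj hq, Z, r, wr, hZ, hr⟩

/-- A module over the quotient is Gorenstein projective if it is the cokernel of a monomorphism of
Gorenstein projective `R`-modules. -/
theorem gproj_of_shortExact {X₀ X₁ : ModuleCat.{u} R} {M : ModuleCat.{u} S} {i : X₀ ⟶ X₁}
    {p : X₁ ⟶ (ModuleCat.restrictScalars π).obj M} {wp : i ≫ p = 0}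
    (h : (ShortComplex.mk i p wp).ShortExact) (h₀ : GProj R X₀) (h₁ : GProj R X₁) : GProj S M := by
  obtain ⟨d, hd, hd'⟩ := exists_d1 (isWICExactCategory_shortExact R).toIsExactCategory
    (isExactAutoequivalence_twist τ) h (hw.nat_restrictScalars M)
  exact IsCokernel.gproj hw ⟨⟨X₀, X₁, i, d, hd, hd'⟩, p, wp, ⟨h₀, h₁⟩, h⟩

/-- The cokernel of the multiplication by `w` on a projective module is projective. -/
lemma exists_cokernel_nat {L : ModuleCat.{u} R} (hL : Projective L) :
    ∃ (Q : ModuleCat.{u} S) (q : (twist τ).obj L ⟶ (ModuleCat.restrictScalars π).obj Q)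
      (wq : hw.nat.app L ≫ q = 0), Projective Q ∧ (ShortComplex.mk _ q wq).ShortExact := by
  obtain ⟨Q, q, wq, hq⟩ := hw.exists_cokernel_restrictScalars (disk1 hw.nat_twist L)
    (gproj_of_projective hL)
  exact ⟨Q, q, wq, hw.projective_of_cokernel (isProj_disk1 hw.nat_twist
    ((isProj_shortExact_iff _).2 (projective_twist τ hL))) hq, hq⟩

lemma nat_comp_eq_zero {L V : ModuleCat.{u} R} (f : (twist τ).obj L ⟶ V) (hV : hw.nat.app V = 0) :
    hw.nat.app L ≫ f = 0 := by
  apply (twist τ).map_injective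
  rw [Functor.map_comp, ← hw.nat_twist, ← naturality_ω, hV, comp_zero, Functor.map_zero]

/-- A kernel `Y` of `T(L) ⟶ M` is an extension of a module `K` over the quotient by `L`, where
`K` is the kernel of the induced epimorphism from `T(L)/w L` to `M`. -/
lemma IsSyzygy.exists_extension {Y : ModuleCat.{u} R} (hY : IsSyzygy π Y) :
    ∃ (L : ModuleCat.{u} R) (K Q M : ModuleCat.{u} S) (a : L ⟶ Y)
      (b : Y ⟶ (ModuleCat.restrictScalars π).obj K) (wa : a ≫ b = 0) (c : Y ⟶ (twist τ).obj L)
      (q : (twist τ).obj L ⟶ (ModuleCat.restrictScalars π).obj Q) (k : K ⟶ Q) (v : Q ⟶ M)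
      (wk : k ≫ v = 0), (ShortComplex.mk a b wa).ShortExact ∧ (ShortComplex.mk k v wk).ShortExact ∧
        Projective L ∧ Projective Q ∧ GProj S M ∧ Mono c ∧ a ≫ c = hw.nat.app L ∧
        c ≫ q = b ≫ (ModuleCat.restrictScalars π).map k := by
  have hE := (isWICExactCategory_shortExact R).toIsExactCategory
  obtain ⟨M, L₁, c, p, wp, hM, hL₁, h⟩ := hY
  let r := ModuleCat.restrictScalars.{u} π
  let e := twistSymmIso τ L₁
  let L := (twist τ.symm).obj L₁
  have hL : Projective L := projective_twist τ.symm hL₁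
  obtain ⟨Q, q, wq, hQ, hq⟩ := hw.exists_cokernel_nat hL
  obtain ⟨v, hv⟩ := hE.exists_desc hq (e.hom ≫ p) (by
    exact hw.nat_comp_eq_zero _ (hw.nat_restrictScalars M))
  obtain ⟨v, rfl⟩ := exists_hom_of_restrictScalars hw.surjective v
  have := h.epi_g
  have : Epi (e.hom ≫ p) := epi_comp _ _
  have : Epi (q ≫ r.map v) := hv ▸ this
  have hv' : Epi v := r.epi_of_epi_map (epi_of_epi q _)
  have hk : (ShortComplex.mk _ _ (kernel.condition v)).ShortExact :=
    ⟨ShortComplex.exact_of_f_is_kernel _ (kernelIsKernel v)⟩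
  obtain ⟨wk, hk'⟩ := shortExact_restrictScalars π hk
  obtain ⟨a, ha⟩ := hE.exists_lift h (hw.nat.app L ≫ e.hom) (by
    rw [Category.assoc, ← hv, reassoc_of% wq, zero_comp])
  obtain ⟨b, hb⟩ := hE.exists_lift hk' ((c ≫ e.inv) ≫ q) (by
    rw [Category.assoc, Category.assoc, hv, e.inv_hom_id_assoc, wp])
  have hac : a ≫ c ≫ e.inv = hw.nat.app L := by
    rw [← Category.assoc, ha, Category.assoc, e.hom_inv_id, Category.comp_id]
  have hmono : Mono (c ≫ e.inv) := by
    have := h.mono_f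
    exact mono_comp _ _
  have hmono' := hk'.mono_f
  have wa : a ≫ b = 0 := by
    rw [← cancel_mono (r.map (kernel.ι v)), Category.assoc]
    refine (congrArg (a ≫ ·) hb).trans ?_
    rw [← Category.assoc, hac, wq, zero_comp]
  refine ⟨L, kernel v, Q, M, a, b, wa, c ≫ e.inv, q, kernel.ι v, v, kernel.condition v, ?_, hk, hL,
    hQ, hM, hmono, hac, hb.symm⟩
  have hp : (ShortComplex.mk (c ≫ e.inv) (e.hom ≫ p) (by simp [wp])).ShortExact :=
    ShortComplex.shortExact_of_iso (ShortComplex.isoMk (S₁ := ShortComplex.mk c p wp) (Iso.refl _)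
      e.symm (Iso.refl _) (Category.id_comp _)
      ((e.inv_hom_id_assoc p).trans (Category.comp_id _).symm)) h
  rw [shortExact_mk_iff] at hq hk' hp ⊢
  rw [ModuleCat.mono_iff_injective] at hmono
  refine ⟨(injective_iff_map_eq_zero _).2 fun x hx => hq.1 ?_, fun z => ?_, fun y hy => ?_⟩
  · rw [map_zero, ← hom_apply_of_comp_eq hac]
    exact (congrArg (c ≫ e.inv) hx).trans (map_zero _)
  · obtain ⟨t, ht⟩ := hq.2.1 (r.map (kernel.ι v) z)
    obtain ⟨y, rfl⟩ := hp.2.2 t (by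
      rw [← hom_apply_of_comp_eq hv]
      refine (congrArg (r.map v) ht).trans ?_
      exact hom_apply_of_comp_eq wk z)
    exact ⟨y, hk'.1 ((hom_apply_of_comm hb y).trans ht)⟩
  · obtain ⟨l, hl⟩ := hq.2.2 ((c ≫ e.inv) y) (by
      rw [← hom_apply_of_comm hb, hy, map_zero])
    exact ⟨l, hmono ((hom_apply_of_comp_eq hac l).trans hl)⟩

/-- Extensions of syzygies by projective modules split. -/
lemma IsSyzygy.exists_retraction {Y Q' E : ModuleCat.{u} R} (hY : IsSyzygy π Y)
    (hQ' : Projective Q') {s : Q' ⟶ E} {t : E ⟶ Y} {ws : s ≫ t = 0}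
    (hs : (ShortComplex.mk s t ws).ShortExact) : ∃ ρ, s ≫ ρ = 𝟙 Q' := by
  have hE := (isWICExactCategory_shortExact R).toIsExactCategory
  have hT := isExactAutoequivalence_twist τ
  obtain ⟨L, K, Q, M, a, b, wa, c, q, k, v, wk, hab, hkv, hL, hQ, hM, hc, hac, hcq⟩ :=
    hY.exists_extension hw
  have := hs.epi_g
  have : Mono ((twist τ).map c) := inferInstance
  obtain ⟨ws', hs'⟩ := shortExact_restrictScalars (τ : R →+* R) hs
  have := hs'.mono_f
  have hca : c ≫ (twist τ).map a = hw.nat.app Y := by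
    rw [← cancel_mono ((twist τ).map c), Category.assoc, ← Functor.map_comp, hac, ← hw.nat_twist]
    exact naturality_ω c
  obtain ⟨a', ha'⟩ := Projective.factors a t
  -- The difference of `w` and the morphism `E ⟶ Y ⟶ T(L) ⟶ T(E)` takes values in `T(Q')`.
  obtain ⟨δ, hδ⟩ := hE.exists_lift hs' (𝟙 E ≫ hw.nat.app E - t ≫ c ≫ (twist τ).map a') (by
    rw [Category.id_comp, Preadditive.sub_comp, Category.assoc, Category.assoc, ← Functor.map_comp,
      ha', hca,
      ← naturality_ω, sub_self])
  have hsδ : s ≫ δ = hw.nat.app Q' := by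
    rw [← cancel_mono ((twist τ).map s), Category.assoc]
    refine (congrArg (s ≫ ·) hδ).trans ?_
    rw [Preadditive.comp_sub, reassoc_of% ws, zero_comp, sub_zero, Category.id_comp, naturality_ω]
  have haδ : a' ≫ δ = 0 := by
    rw [← cancel_mono ((twist τ).map s), Category.assoc]
    refine (congrArg (a' ≫ ·) hδ).trans ?_
    rw [Preadditive.comp_sub, Category.id_comp, reassoc_of% ha', reassoc_of% hac, naturality_ω,
      sub_self, zero_comp]
  -- It induces a morphism from `K` to `T(Q')/w Q'`, which extends to `T(L)/w L`.
  obtain ⟨N, n, wn, hN, hn⟩ := hw.exists_cokernel_nat hQ'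
  obtain ⟨η, hη⟩ := hE.exists_desc hs (δ ≫ n) (by rw [← Category.assoc, hsδ, wn])
  obtain ⟨θ, hθ⟩ := hE.exists_desc hab η (by
    rw [← ha', Category.assoc, hη, ← Category.assoc, haδ, zero_comp])
  obtain ⟨θ, rfl⟩ := exists_hom_of_restrictScalars hw.surjective θ
  obtain ⟨θ', rfl⟩ : ∃ θ', k ≫ θ' = θ := hM.perp.exists_extension hkv hN θ
  have := projective_twist τ hL
  have := hn.epi_g
  obtain ⟨g, hg⟩ := Projective.factors (q ≫ (ModuleCat.restrictScalars π).map θ') n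
  obtain ⟨ρ, hρ⟩ := hE.exists_lift hn (δ - t ≫ c ≫ g) (by
    rw [Preadditive.sub_comp, Category.assoc, Category.assoc, hg, reassoc_of% hcq,
      ← Functor.map_comp, hθ, hη, sub_self])
  have := hn.mono_f
  refine ⟨ρ, ?_⟩
  rw [← cancel_mono (hw.nat.app Q'), Category.assoc, hρ, Preadditive.comp_sub, reassoc_of% ws,
    zero_comp, sub_zero, hsδ, Category.id_comp]

/-- By `IsSyzygy.exists_retraction` the first extension groups with projective modules vanish, and
`Y` has a syzygy of the same kind, namely a syzygy of the module `K` of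
`IsSyzygy.exists_extension`. -/
lemma IsSyzygy.perp {Y : ModuleCat.{u} R} (hY : IsSyzygy π Y) : Perp Y := by
  have hE := (isWICExactCategory_shortExact R).toIsExactCategory
  refine perp_of_syzygy (IsSyzygy π) (fun Y hY => ?_) hY
  obtain ⟨L, K, Q, M, a, b, wa, c, q, k, v, wk, hab, hkv, hL, hQ, hM, -⟩ := hY.exists_extension hw
  have h : (ShortComplex.mk _ _
      (kernel.condition (Projective.π ((ModuleCat.restrictScalars π).obj K)))).ShortExact :=
    ⟨ShortComplex.exact_of_f_is_kernel _ (kernelIsKernel _)⟩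
  obtain ⟨W, i, d, j, e, wi, wj, hi, hj, -⟩ := hE.exists_common_refinement hab h
  refine ⟨_, W, j, e, wj, hj, ?_, ⟨K, _, _, _, _, GProj.ker hkv (gproj_of_projective hQ) hM,
    Projective.projective_over _, h⟩, fun Q hQ f => ?_⟩
  · exact projective_X₂ hi hL (Projective.projective_over _)
  · obtain ⟨V, x, y, sq, hy⟩ := hE.ex2_op j f ⟨_, _, _, hj⟩
    obtain ⟨t, wt, -, ht⟩ := hE.conflation_of_isPushout hj sq hy
    obtain ⟨ρ, hρ⟩ := hY.exists_retraction hw hQ ht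
    exact ⟨x ≫ ρ, by rw [← Category.assoc, sq.w, Category.assoc, hρ, Category.comp_id]⟩

/-- A syzygy of a Gorenstein projective module `M` over the quotient embeds into a projective module
with cokernel a syzygy of a cosyzygy of `M`. -/
lemma IsSyzygy.gproj {Y : ModuleCat.{u} R} (hY : IsSyzygy π Y) : GProj R Y := by
  have hE := (isWICExactCategory_shortExact R).toIsExactCategory
  refine gproj_of_class (IsSyzygy π) (fun _ h => h.perp hw) ?_ hY
  rintro Y ⟨M, L, c, p, wp, hM, hL, h⟩
  obtain ⟨P, N, i, d, wi, hi, hP, hN⟩ := hM.exists_cosyzygy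
  obtain ⟨wi', hi'⟩ := shortExact_restrictScalars π hi
  have hF : (ShortComplex.mk _ _
      (kernel.condition (Projective.π ((ModuleCat.restrictScalars π).obj P)))).ShortExact :=
    ⟨ShortComplex.exact_of_f_is_kernel _ (kernelIsKernel _)⟩
  have hV : Projective (kernel (Projective.π ((ModuleCat.restrictScalars π).obj P))) :=
    projective_iff_hasProjectiveDimensionLT_one.2 (hF.hasProjectiveDimensionLT_X₁ 1
      (projective_iff_hasProjectiveDimensionLT_one.1 (Projective.projective_over _))
      (hw.hasProjectiveDimensionLT_two hP))
  obtain ⟨Z, e, f, g, we, wg, he, hg, -⟩ := hE.exists_conflation_comp_op hF hi'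
  obtain ⟨W, j, a, i', b, wj, wi₂, hj, hi₂, -⟩ := hE.exists_common_refinement h he
  exact ⟨W, Z, j, a, wj, hj, projective_X₂ hi₂ hV hL, N, _, g, _, wg, hN,
    Projective.projective_over _, hg⟩

/-- The kernel of an epimorphism from a Gorenstein projective `R`-module to a Gorenstein projective
module over the quotient is Gorenstein projective. -/
theorem gproj_kernel {Y L : ModuleCat.{u} R} {M : ModuleCat.{u} S} {c : Y ⟶ L}
    {p : L ⟶ (ModuleCat.restrictScalars π).obj M} {wp : c ≫ p = 0}
    (h : (ShortComplex.mk c p wp).ShortExact) (hL : GProj R L) (hM : GProj S M) : GProj R Y := by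
  have h' : (ShortComplex.mk _ _
      (kernel.condition (Projective.π ((ModuleCat.restrictScalars π).obj M)))).ShortExact :=
    ⟨ShortComplex.exact_of_f_is_kernel _ (kernelIsKernel _)⟩
  exact ker_mem_of_ker_mem (isWICExactCategory_shortExact R).toIsExactCategory
    (isFrobeniusClass_gproj R).ext (isFrobeniusClass_gproj R).ker h' h
    (IsSyzygy.gproj hw ⟨M, _, _, _, _, hM, Projective.projective_over _, h'⟩)
    (gproj_of_projective (Projective.projective_over _)) hL

end IsRegularQuotient

/-! ### Regular sequences -/

section

variable {A : Type u} [Ring A]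

lemma twoSidedSpan_induction {s : Set A} {p : A → Prop} (zero : p 0)
    (add : ∀ a b, p a → p b → p (a + b)) (neg : ∀ a, p a → p (-a)) (left : ∀ a b, p b → p (a * b))
    (right : ∀ a b, p a → p (a * b)) (mem : ∀ a ∈ s, p a) {a : A} (ha : a ∈ twoSidedSpan s) :
    p a := by
  have ha : a ∈ TwoSidedIdeal.span s := by simpa using ha
  rw [TwoSidedIdeal.mem_span_iff] at ha
  have := ha (TwoSidedIdeal.mk' {a : A | p a} zero (fun {a b} => add a b) (fun {a} => neg a)
    (fun {a b} => left a b) (fun {a b} => right a b)) (fun a ha => by simpa using mem a ha)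
  simpa using this

lemma subset_twoSidedSpan {s : Set A} {a : A} (ha : a ∈ s) : a ∈ twoSidedSpan s := by
  simpa using TwoSidedIdeal.subset_span ha

lemma twoSidedSpan_le {s : Set A} {I : Ideal A} [I.IsTwoSided] (h : s ⊆ I) :
    twoSidedSpan s ≤ I := fun _ ha =>
  twoSidedSpan_induction I.zero_mem (fun _ _ => I.add_mem) (fun _ => I.neg_mem)
    (fun a _ => I.mul_mem_left a) (fun _ b => I.mul_mem_right b) h ha

variable {ω' ω : A} {σ' σ : A ≃+* A} {ξ : Aˣ}

namespace IsOfType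

lemma exists_mul_eq (h : IsOfType ω' ω σ' σ ξ) {a : A} (ha : a ∈ twoSidedSpan {ω'}) :
    ∃ s, ω' * s = a := by
  refine twoSidedSpan_induction (p := fun a => ∃ s, ω' * s = a) ⟨0, mul_zero _⟩ ?_ ?_ ?_ ?_ ?_ ha
  · rintro _ _ ⟨s, rfl⟩ ⟨t, rfl⟩
    exact ⟨s + t, mul_add _ _ _⟩
  · rintro _ ⟨s, rfl⟩
    exact ⟨-s, mul_neg _ _⟩
  · rintro a _ ⟨s, rfl⟩
    exact ⟨σ'.symm a * s, by rw [← mul_assoc, h.mul', σ'.apply_symm_apply, mul_assoc]⟩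
  · rintro _ b ⟨s, rfl⟩
    exact ⟨s * b, (mul_assoc _ _ _).symm⟩
  · rintro _ rfl
    exact ⟨1, mul_one _⟩

lemma exists_mul_add_eq (h : IsOfType ω' ω σ' σ ξ) {a : A} (ha : a ∈ twoSidedSpan {ω, ω'}) :
    ∃ s t, ω * s + ω' * t = a := by
  refine twoSidedSpan_induction (p := fun a => ∃ s t, ω * s + ω' * t = a)
    ⟨0, 0, by rw [mul_zero, mul_zero, zero_add]⟩ ?_ ?_ ?_ ?_ ?_ ha
  · rintro _ _ ⟨s, t, rfl⟩ ⟨s', t', rfl⟩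
    exact ⟨s + s', t + t', by rw [mul_add, mul_add, add_add_add_comm]⟩
  · rintro _ ⟨s, t, rfl⟩
    exact ⟨-s, -t, by rw [mul_neg, mul_neg, neg_add]⟩
  · rintro a _ ⟨s, t, rfl⟩
    refine ⟨σ.symm a * s, σ'.symm a * t, ?_⟩
    rw [← mul_assoc, h.mul, σ.apply_symm_apply, ← mul_assoc, h.mul', σ'.apply_symm_apply, mul_add,
      mul_assoc, mul_assoc]
  · rintro _ b ⟨s, t, rfl⟩
    exact ⟨s * b, t * b, by rw [add_mul, mul_assoc, mul_assoc]⟩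
  · rintro _ (rfl | rfl)
    · exact ⟨1, 0, by rw [mul_one, mul_zero, add_zero]⟩
    · exact ⟨0, 1, by rw [mul_one, mul_zero, zero_add]⟩

lemma map_mem (h : IsOfType ω' ω σ' σ ξ) {a : A} (ha : a ∈ twoSidedSpan {ω'}) :
    σ a ∈ twoSidedSpan {ω'} := by
  obtain ⟨s, rfl⟩ := h.exists_mul_eq ha
  rw [map_mul, h.map_ω', mul_assoc]
  exact Ideal.mul_mem_left _ _ (Ideal.mul_mem_right _ _ (subset_twoSidedSpan rfl))

lemma symm_map_mem (h : IsOfType ω' ω σ' σ ξ) {a : A} (ha : a ∈ twoSidedSpan {ω'}) :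
    σ.symm a ∈ twoSidedSpan {ω'} := by
  have key : σ.symm ω' = σ.symm ξ * ω' := by
    rw [σ.symm_apply_eq, map_mul, σ.apply_symm_apply, h.map_ω', ← mul_assoc, Units.mul_inv,
      one_mul]
  obtain ⟨s, rfl⟩ := h.exists_mul_eq ha
  rw [map_mul, key, mul_assoc]
  exact Ideal.mul_mem_left _ _ (Ideal.mul_mem_right _ _ (subset_twoSidedSpan rfl))

/-- The automorphism of `A/(ω')` induced by `σ`. -/
noncomputable def quotientEquiv (h : IsOfType ω' ω σ' σ ξ) :
    (A ⧸ twoSidedSpan {ω'}) ≃+* (A ⧸ twoSidedSpan {ω'}) :=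
  RingEquiv.ofRingHom
    (Ideal.Quotient.lift _ ((Ideal.Quotient.mk _).comp (σ : A →+* A)) fun _ ha =>
      Ideal.Quotient.eq_zero_iff_mem.2 (h.map_mem ha))
    (Ideal.Quotient.lift _ ((Ideal.Quotient.mk _).comp (σ.symm : A →+* A)) fun _ ha =>
      Ideal.Quotient.eq_zero_iff_mem.2 (h.symm_map_mem ha))
    (Ideal.Quotient.ringHom_ext (RingHom.ext fun a =>
      congrArg (Ideal.Quotient.mk _) (σ.apply_symm_apply a)))
    (Ideal.Quotient.ringHom_ext (RingHom.ext fun a =>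
      congrArg (Ideal.Quotient.mk _) (σ.symm_apply_apply a)))

end IsOfType

variable (ω' ω) in
/-- The projection `A/(ω') → A/(ω, ω')`. -/
noncomputable abbrev quotientProj :
    (A ⧸ twoSidedSpan {ω'}) →+* (A ⧸ twoSidedSpan {ω, ω'}) :=
  Ideal.Quotient.factor (twoSidedSpan_le (Set.singleton_subset_iff.2
    (subset_twoSidedSpan (Set.mem_insert_of_mem ω rfl))))

lemma isRegularQuotient_mk (hreg : IsRegularSequence ω' ω) (h : IsOfType ω' ω σ' σ ξ) :
    IsRegularQuotient (Ideal.Quotient.mk (twoSidedSpan {ω'})) ω' σ' where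
  surjective := Ideal.Quotient.mk_surjective
  exists_of_map_eq_zero _ hr := h.exists_mul_eq (Ideal.Quotient.eq_zero_iff_mem.1 hr)
  map_eq_zero := Ideal.Quotient.eq_zero_iff_mem.2 (subset_twoSidedSpan rfl)
  regular := hreg.regular'
  mul := h.mul'

lemma isRegularQuotient_quotientProj (hreg : IsRegularSequence ω' ω)
    (h : IsOfType ω' ω σ' σ ξ) :
    IsRegularQuotient (quotientProj ω' ω) (Ideal.Quotient.mk (twoSidedSpan {ω'}) ω)
      h.quotientEquiv where
  surjective := fun b => by
    obtain ⟨a, rfl⟩ := Ideal.Quotient.mk_surjective b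
    exact ⟨Ideal.Quotient.mk _ a, rfl⟩
  exists_of_map_eq_zero := fun r hr => by
    obtain ⟨a, rfl⟩ := Ideal.Quotient.mk_surjective r
    obtain ⟨s, t, rfl⟩ := h.exists_mul_add_eq (Ideal.Quotient.eq_zero_iff_mem.1 hr)
    refine ⟨Ideal.Quotient.mk _ s, ?_⟩
    rw [map_add, map_mul, map_mul, (isRegularQuotient_mk hreg h).map_eq_zero, zero_mul, add_zero]
  map_eq_zero := Ideal.Quotient.eq_zero_iff_mem.2 (subset_twoSidedSpan (Set.mem_insert ω {ω'}))
  regular := hreg.regular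
  mul := fun r => by
    obtain ⟨a, rfl⟩ := Ideal.Quotient.mk_surjective r
    exact congrArg (Ideal.Quotient.mk _) (h.mul a)

variable (ω') in
/-- The restriction of scalars from `A/(ω')` to `A`. -/
noncomputable abbrev res₁ : ModuleCat.{u} (A ⧸ twoSidedSpan {ω'}) ⥤ ModuleCat.{u} A :=
  ModuleCat.restrictScalars (Ideal.Quotient.mk (twoSidedSpan {ω'}))

variable (ω' ω) in
/-- The restriction of scalars from `A/(ω, ω')` to `A/(ω')`. -/
noncomputable abbrev res₂ : ModuleCat.{u} (A ⧸ twoSidedSpan {ω, ω'}) ⥤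
    ModuleCat.{u} (A ⧸ twoSidedSpan {ω'}) :=
  ModuleCat.restrictScalars (quotientProj ω' ω)

end

/-! ### The total-cokernel functor -/

section

open Factorization CommutingPair

variable {A : Type u} [Ring A] {ω' ω : A} {σ' σ : A ≃+* A} {ξ : Aˣ} (h : IsOfType ω' ω σ' σ ξ)

/-- The projection from `X^{1,1}` to the total-cokernel, as a morphism of `A`-modules. -/
noncomputable def tcokProj (X : ModFactorization₂ h) :
    X.X1.X1 ⟶ (res₁ ω').obj ((res₂ ω' ω).obj (tcokObj h X)) :=
  ModuleCat.ofHom (Y := (res₁ ω').obj ((res₂ ω' ω).obj (tcokObj h X)))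
    { toFun := fun x => (tcokRange h X).mkQ x
      map_add' := fun x y => map_add (tcokRange h X).mkQ x y
      map_smul' := fun a x => map_smul (tcokRange h X).mkQ a x }

lemma tcokProj_surjective (X : ModFactorization₂ h) : Function.Surjective (tcokProj h X) :=
  Submodule.mkQ_surjective (tcokRange h X)

instance (X : ModFactorization₂ h) : Epi (tcokProj h X) :=
  (ModuleCat.epi_iff_surjective _).2 (tcokProj_surjective h X)

lemma tcokProj_eq_zero_iff (X : ModFactorization₂ h) (x : X.X1.X1) :
    tcokProj h X x = 0 ↔ ∃ (a : X.X0.X1) (b : X.X1.X0), X.d0.f1 a + X.X1.d0 b = x := by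
  refine (Submodule.Quotient.mk_eq_zero (tcokRange h X)).trans ⟨?_, ?_⟩
  · rintro ⟨⟨a, b⟩, hab⟩
    exact ⟨a, b, hab⟩
  · rintro ⟨a, b, hab⟩
    exact ⟨⟨a, b⟩, hab⟩

lemma d0_f1_tcokProj (X : ModFactorization₂ h) : X.d0.f1 ≫ tcokProj h X = 0 := by
  ext x
  refine (tcokProj_eq_zero_iff h X (X.d0.f1 x)).2 ⟨x, 0, ?_⟩
  rw [map_zero, add_zero]

lemma tcokProj_naturality {X Y : ModFactorization₂ h} (F : X ⟶ Y) :
    F.f1.f1 ≫ tcokProj h Y =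
      tcokProj h X ≫ (res₁ ω').map ((res₂ ω' ω).map ((TCok h).map F)) := rfl

lemma ω_app_restrictScalars (N : ModuleCat.{u} (A ⧸ twoSidedSpan {ω, ω'})) :
    (pairOfType h).ω.app ((res₁ ω').obj ((res₂ ω' ω).obj N)) = 0 := by
  ext x
  have key : ∀ x : N, Ideal.Quotient.mk (twoSidedSpan {ω, ω'}) ω • x = 0 := fun x => by
    rw [Ideal.Quotient.eq_zero_iff_mem.2 (subset_twoSidedSpan (Set.mem_insert ω {ω'})), zero_smul]
  exact key x

lemma ω'_app_restrictScalars (N : ModuleCat.{u} (A ⧸ twoSidedSpan {ω'})) :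
    (pairOfType h).ω'.app ((res₁ ω').obj N) = 0 := by
  ext x
  have key : ∀ x : N, Ideal.Quotient.mk (twoSidedSpan {ω'}) ω' • x = 0 := fun x => by
    rw [Ideal.Quotient.eq_zero_iff_mem.2 (subset_twoSidedSpan (Set.mem_singleton ω')), zero_smul]
  exact key x

/-- A presentation of the total-cokernel by modules over `A/(ω')`: the modules `Q₀` and `Q₁` are
the cokernels of the vertical morphisms into `X^{0,1}` and `X^{1,1}`, and the total-cokernel
is the cokernel of `Q₀ ⟶ Q₁`. -/
structure TCokPresentation (X : ModFactorization₂ h) where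
  Q₀ : ModuleCat.{u} (A ⧸ twoSidedSpan {ω'})
  Q₁ : ModuleCat.{u} (A ⧸ twoSidedSpan {ω'})
  q₀ : X.X1.X0 ⟶ (res₁ ω').obj Q₀
  q₁ : X.X1.X1 ⟶ (res₁ ω').obj Q₁
  w₀ : X.d0.f0 ≫ q₀ = 0
  w₁ : X.d0.f1 ≫ q₁ = 0
  exact₀ : (ShortComplex.mk X.d0.f0 q₀ w₀).ShortExact
  exact₁ : (ShortComplex.mk X.d0.f1 q₁ w₁).ShortExact
  d : Q₀ ⟶ Q₁
  p : Q₁ ⟶ (res₂ ω' ω).obj (tcokObj h X)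
  w : d ≫ p = 0
  exact : (ShortComplex.mk d p w).ShortExact
  comm : X.X1.d0 ≫ q₁ = q₀ ≫ (res₁ ω').map d
  comm' : q₁ ≫ (res₁ ω').map p = tcokProj h X
  gproj : GProj _ Q₀
  projective : Projective Q₁

variable (hreg : IsRegularSequence ω' ω)

include hreg in
/-- The cokernel of a column with Gorenstein projective components is Gorenstein projective over
`A/(ω')`, and it is projective if the column is. -/
lemma exists_tcokPresentation {X : ModFactorization₂ h}
    (hX : components (components (GProj A)) X)
    (hcol : IsProj (conflations (shortExact A)) ((pairOfType h).column1 X)) :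
    Nonempty (TCokPresentation h X) := by
  have hE := (isWICExactCategory_shortExact A).toIsExactCategory
  have hw := isRegularQuotient_mk hreg h
  have hw₂ := isRegularQuotient_quotientProj hreg h
  obtain ⟨Q₁, q₁, w₁, h₁⟩ := hw.exists_cokernel_restrictScalars ((pairOfType h).column1 X) hX.1.2
  obtain ⟨Q₀, q₀, w₀, h₀⟩ := hw.exists_cokernel_restrictScalars ((pairOfType h).column0 X) hX.1.1
  have hQ₁ : Projective Q₁ := hw.projective_of_cokernel hcol h₁
  have hQ₀ : GProj _ Q₀ := hw.gproj_of_shortExact h₀ hX.1.1 hX.2.1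
  change X.d0.f1 ≫ q₁ = 0 at w₁
  change X.d0.f0 ≫ q₀ = 0 at w₀
  change X.X1.X1 ⟶ _ at q₁
  change X.X1.X0 ⟶ _ at q₀
  change (ShortComplex.mk X.d0.f1 q₁ w₁).ShortExact at h₁
  change (ShortComplex.mk X.d0.f0 q₀ w₀).ShortExact at h₀
  obtain ⟨d, hd⟩ := hE.exists_desc h₀ (X.X1.d0 ≫ q₁) (by
    rw [← Category.assoc, ← X.d0.comm0, Category.assoc, w₁, comp_zero])
  obtain ⟨d, rfl⟩ := IsRegularQuotient.exists_hom_of_restrictScalars hw.surjective d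
  obtain ⟨p, hp⟩ := hE.exists_desc h₁ (tcokProj h X) (d0_f1_tcokProj h X)
  obtain ⟨p, rfl⟩ := IsRegularQuotient.exists_hom_of_restrictScalars hw.surjective p
  have hd' : ∀ x, (res₁ ω').map d (q₀ x) = q₁ (X.X1.d0 x) := hom_apply_of_comm hd
  have hp' : ∀ x, (res₁ ω').map p (q₁ x) = tcokProj h X x := hom_apply_of_comp_eq hp
  have hs₀ := ((shortExact_mk_iff _ _ _).1 h₀)
  have hs₁ := ((shortExact_mk_iff _ _ _).1 h₁)
  have w : d ≫ p = 0 := by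
    ext x
    obtain ⟨x, rfl⟩ := hs₀.2.1 x
    refine (congrArg p (hd' x)).trans ((hp' _).trans ((tcokProj_eq_zero_iff h X _).2 ⟨0, x, ?_⟩))
    rw [map_zero, zero_add]
  refine ⟨⟨Q₀, Q₁, q₀, q₁, w₀, w₁, h₀, h₁, d, p, w, ?_, hd.symm, hp, hQ₀, hQ₁⟩⟩
  rw [shortExact_mk_iff]
  refine ⟨(injective_iff_map_eq_zero _).2 fun x hx => ?_, fun z => ?_, fun y hy => ?_⟩
  · -- The element `ω` annihilates the kernel of `d`, and it acts injectively on `Q₀`.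
    obtain ⟨x, rfl⟩ := hs₀.2.1 x
    obtain ⟨z, hz⟩ := hs₁.2.2 (X.X1.d0 x) ((hd' x).symm.trans hx)
    have key : X.d0.f0 (X.X0.d1 z : X.X0.X0) = (ω • x : X.X1.X0) := by
      have h₁ := hom_apply_of_comm X.d0.comm1 z
      have h₂ := hom_apply_of_comp_eq X.X1.d0_d1 x
      exact h₁.trans ((congrArg X.X1.d1 hz).trans h₂)
    have h₃ : q₀ (ω • x) = 0 := by
      rw [← key]
      exact hom_apply_of_comp_eq w₀ _
    have := (ModuleCat.mono_iff_injective _).1 (hw₂.mono_nat hQ₀)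
    refine this ((?_ : _ = (0 : Q₀)).trans (map_zero _).symm)
    exact (map_smul q₀.hom ω x).symm.trans h₃
  · obtain ⟨x, hx⟩ := tcokProj_surjective h X z
    exact ⟨q₁ x, (hp' x).trans hx⟩
  · obtain ⟨x, rfl⟩ := hs₁.2.1 y
    obtain ⟨a, b, rfl⟩ := (tcokProj_eq_zero_iff h X x).1 ((hp' x).symm.trans hy)
    refine ⟨q₀ b, (hd' b).trans ?_⟩
    rw [map_add, hom_apply_of_comp_eq w₁]
    exact (zero_add _).symm

variable {h}

namespace TCokPresentation

variable {X Y : ModFactorization₂ h} (c : TCokPresentation h X) (c' : TCokPresentation h Y)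

lemma exists_d1 : ∃ k : (res₁ ω').obj c.Q₁ ⟶ (pairOfType h).T.obj ((res₁ ω').obj c.Q₀),
    (res₁ ω').map c.d ≫ k = (pairOfType h).ω.app _ ∧
      k ≫ (pairOfType h).T.map ((res₁ ω').map c.d) = (pairOfType h).ω.app _ := by
  obtain ⟨w, hc⟩ := shortExact_restrictScalars (Ideal.Quotient.mk (twoSidedSpan {ω'})) c.exact
  exact Factorization.exists_d1 (T := (pairOfType h).T)
    (isWICExactCategory_shortExact A).toIsExactCategory (isExactAutoequivalence_twist σ) hc
    (ω_app_restrictScalars h _)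

/-- The cokernel of `X.d0` in the category of `ω`-factorizations. -/
noncomputable def factorization : Factorization (pairOfType h).T (pairOfType h).ω where
  X0 := (res₁ ω').obj c.Q₀
  X1 := (res₁ ω').obj c.Q₁
  d0 := (res₁ ω').map c.d
  d1 := c.exists_d1.choose
  d0_d1 := c.exists_d1.choose_spec.1
  d1_d0 := c.exists_d1.choose_spec.2

lemma mono_map_d : Mono ((pairOfType h).T.map ((res₁ ω').map c.d)) :=
  (ModuleCat.mono_iff_injective _).2 ((shortExact_mk_iff _ _ _).1 c.exact).1

/-- The projection from the upper row to its quotient. -/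
noncomputable def proj : X.X1 ⟶ c.factorization where
  f0 := c.q₀
  f1 := c.q₁
  comm0 := c.comm
  comm1 := by
    have := c.mono_map_d
    change X.X1.d1 ≫ (pairOfType h).T.map c.q₀ = c.q₁ ≫ c.exists_d1.choose
    rw [← cancel_mono ((pairOfType h).T.map ((res₁ ω').map c.d)), Category.assoc, Category.assoc,
      c.exists_d1.choose_spec.2, ← Functor.map_comp, ← c.comm, Functor.map_comp, ← Category.assoc,
      X.X1.d1_d0]
    exact (naturality_ω (ω := (pairOfType h).ω) c.q₁).symm

/-- The presentation of the total-cokernel as a sequence of two cokernels of `A`-modules. -/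
noncomputable def totalCokernel : TotalCokernel (shortExact A) X where
  Q := c.factorization
  q := c.proj
  w := hom_ext c.w₀ c.w₁
  conflation := conflations_mk_iff.2 ⟨c.exact₀, c.exact₁⟩
  N := (res₁ ω').obj ((res₂ ω' ω).obj (tcokObj h X))
  p := (res₁ ω').map c.p
  w' := (shortExact_restrictScalars _ c.exact).choose
  conflation' := (shortExact_restrictScalars _ c.exact).choose_spec

lemma totalCokernel_π : c.totalCokernel.π = tcokProj h X := c.comm'

include c c'

/-- A morphism between total-cokernels lifts to a morphism of factorizations. -/
lemma exists_preimage {P : ObjectProperty (ModuleCat.{u} A)}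
    (hc : (pairOfType h).IsCompatible (shortExact A) P)
      (hX : IsProj (conflations (shortExact A)) X.X1)
    (g : (TCok h).obj X ⟶ (TCok h).obj Y) : ∃ F : X ⟶ Y, (TCok h).map F = g := by
  have := c.projective
  have := c'.exact.epi_g
  obtain ⟨F, hF⟩ := exists_hom_of_totalCokernel hc c.totalCokernel c'.totalCokernel hX (fun f => by
    obtain ⟨f, rfl⟩ : ∃ f', (res₁ ω').map f' = f :=
      IsRegularQuotient.exists_hom_of_restrictScalars Ideal.Quotient.mk_surjective f
    obtain ⟨k, hk⟩ := Projective.factors f c'.p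
    exact ⟨(res₁ ω').map k, congrArg (res₁ ω').map hk⟩) ((res₁ ω').map ((res₂ ω' ω).map g))
  refine ⟨F, (res₂ ω' ω).map_injective ((res₁ ω').map_injective ?_)⟩
  rw [totalCokernel_π, totalCokernel_π] at hF
  exact (cancel_epi (tcokProj h X)).1 ((tcokProj_naturality h F).symm.trans hF)

/-- A morphism of factorizations induces compatible morphisms between the presentations. -/
lemma comm_of_hom (F : X ⟶ Y) {a₀ : c.Q₀ ⟶ c'.Q₀} {a₁ : c.Q₁ ⟶ c'.Q₁}
    (h₀ : F.f1.f0 ≫ c'.q₀ = c.q₀ ≫ (res₁ ω').map a₀)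
    (h₁ : F.f1.f1 ≫ c'.q₁ = c.q₁ ≫ (res₁ ω').map a₁) :
    c.d ≫ a₁ = a₀ ≫ c'.d ∧ a₁ ≫ c'.p = c.p ≫ (res₂ ω' ω).map ((TCok h).map F) := by
  have := c.exact₀.epi_g
  have := c.exact₁.epi_g
  constructor
  · apply (res₁ ω').map_injective
    rw [← cancel_epi c.q₀, Functor.map_comp, ← Category.assoc, ← c.comm, Category.assoc, ← h₁,
      ← Category.assoc, F.f1.comm0, Category.assoc, c'.comm, ← Category.assoc, h₀, Category.assoc,
      Functor.map_comp]
  · apply (res₁ ω').map_injective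
    rw [← cancel_epi c.q₁, Functor.map_comp, ← Category.assoc, ← h₁, Category.assoc, c'.comm']
    refine (tcokProj_naturality h F).trans ?_
    rw [← c.comm', Category.assoc]
    exact congrArg (c.q₁ ≫ ·) ((res₁ ω').map_comp _ _).symm

include hreg in
/-- The total-cokernel functor is exact, because it is the composite of two cokernels of
monomorphisms of short exact sequences. -/
lemma shortExact_tcok {Z : ModFactorization₂ h} (c'' : TCokPresentation h Z) {i : X ⟶ Y}
    {d : Y ⟶ Z} {w : i ≫ d = 0}
    (hid : (pairOfType h).conflations₂ (shortExact A) (ShortComplex.mk i d w)) :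
    ∃ w' : (TCok h).map i ≫ (TCok h).map d = 0,
      (ShortComplex.mk ((TCok h).map i) ((TCok h).map d) w').ShortExact := by
  have hw := isRegularQuotient_mk hreg h
  have w₁ : (pairOfType h).column1Functor.map i ≫ (pairOfType h).column1Functor.map d = 0 := by
    rw [← Functor.map_comp, w, Functor.map_zero]
  have w₀ : (pairOfType h).column0Functor.map i ≫ (pairOfType h).column0Functor.map d = 0 := by
    rw [← Functor.map_comp, w, Functor.map_zero]
  have h₁ : conflations (shortExact A) (ShortComplex.mk _ _ w₁) := ⟨hid.1.2, hid.2.2⟩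
  have h₀ : conflations (shortExact A) (ShortComplex.mk _ _ w₀) := ⟨hid.1.1, hid.2.1⟩
  obtain ⟨a₁, b₁, wab₁, hab₁, ha₁, hb₁⟩ :=
    hw.exists_shortExact_cokernels h₁ c.exact₁ c'.exact₁ c''.exact₁
  obtain ⟨a₀, b₀, wab₀, hab₀, ha₀, hb₀⟩ :=
    hw.exists_shortExact_cokernels h₀ c.exact₀ c'.exact₀ c''.exact₀
  obtain ⟨e₁, e₂⟩ := comm_of_hom c c' i ha₀ ha₁
  obtain ⟨e₃, e₄⟩ := comm_of_hom c' c'' d hb₀ hb₁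
  obtain ⟨w', hw'⟩ := shortExact_cokernels hab₀ hab₁ c.exact c'.exact c''.exact e₁ e₃ e₂ e₄
  have w'' : (TCok h).map i ≫ (TCok h).map d = 0 := (res₂ ω' ω).map_injective
    (((res₂ ω' ω).map_comp _ _).trans (w'.trans ((res₂ ω' ω).map_zero _ _).symm))
  exact ⟨w'', (shortExact_restrictScalars_iff _ _ _ w'' w').1 hw'⟩

end TCokPresentation

end

/-! ### The stable equivalence given by the total-cokernel -/

section

open Factorization CommutingPair

variable {A : Type u} [Ring A] {ω' ω : A} {σ' σ : A ≃+* A} {ξ : Aˣ} (h : IsOfType ω' ω σ' σ ξ)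
  (hreg : IsRegularSequence ω' ω) {P : ObjectProperty (ModuleCat.{u} A)}
  (hc : (pairOfType h).IsCompatible (shortExact A) P) (hP : P ≤ GProj A)

include hreg hP hc

/-- A factorization whose cokernel is the restriction of a projective `A/(ω')`-module is
a projective object if its component in degree one is projective. -/
lemma isProjIn_of_projective_cokernel {M : Factorization (pairOfType h).T' (pairOfType h).ω'}
    (hM : components P M) (hM₁ : IsProj (shortExact A) M.X1)
    {Q : ModuleCat.{u} (A ⧸ twoSidedSpan {ω'})} (hQ : Projective Q) {p : M.X1 ⟶ (res₁ ω').obj Q}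
    {w : M.d0 ≫ p = 0} (hp : shortExact A (ShortComplex.mk M.d0 p w)) :
    IsProjIn (shortExact A) P M := by
  have hw := isRegularQuotient_mk hreg h
  refine isProjIn_of_cokernel hc.exact hc.autT' (fun X hX => ?_) hM hM₁ hp
    fun {N₁ N₂} δ hδ h₁ h₂ f => ?_
  · obtain ⟨N, q, w, hq⟩ := hw.exists_cokernel_restrictScalars X (hP _ hX.1)
    exact ⟨_, q, w, hq⟩
  · obtain ⟨N₁', ⟨e₁⟩⟩ := hw.exists_restrictScalars_iso h₁
    obtain ⟨N₂', ⟨e₂⟩⟩ := hw.exists_restrictScalars_iso h₂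
    obtain ⟨δ', hδ'⟩ := IsRegularQuotient.exists_hom_of_restrictScalars hw.surjective
      (e₁.hom ≫ δ ≫ e₂.inv)
    obtain ⟨f', hf'⟩ := IsRegularQuotient.exists_hom_of_restrictScalars hw.surjective
      (f ≫ e₂.inv)
    have := (isDeflation_shortExact_iff _).1 hδ
    have : Epi ((res₁ ω').map δ') := by
      rw [hδ']
      infer_instance
    have : Epi δ' := (res₁ ω').epi_of_epi_map this
    obtain ⟨k, hk⟩ := Projective.factors f' δ'
    refine ⟨(res₁ ω').map k ≫ e₁.hom, ?_⟩
    rw [← cancel_mono e₂.inv, ← hf', ← hk, Functor.map_comp, hδ', Category.assoc, Category.assoc]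

/-- A module `N` over `A/(ω, ω')` which is the cokernel of a monomorphism `Q₀ ⟶ Q₁` of
`A/(ω')`-modules with `Q₁` projective is a total-cokernel. The upper row of the factorization is
a projective `ω`-factorization with a deflation to that on `Q₀` and `Q₁`, and the lower row is
the kernel of this deflation. The class `𝒬` restricts the modules over `A/(ω')` to those for which
the components belong to `P`. -/
lemma exists_tcok_iso {𝒬 : ObjectProperty (ModuleCat.{u} (A ⧸ twoSidedSpan {ω'}))}
    (hcov : ∀ Q, 𝒬 Q → ∃ (J : ModuleCat.{u} A) (d : J ⟶ (res₁ ω').obj Q), Epi d ∧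
      IsProjInj (shortExact A) P J)
    (hker : ∀ {K J : ModuleCat.{u} A} {Q : ModuleCat.{u} (A ⧸ twoSidedSpan {ω'})} {i : K ⟶ J}
      {p : J ⟶ (res₁ ω').obj Q} {w : i ≫ p = 0}, (ShortComplex.mk i p w).ShortExact → 𝒬 Q →
      P J → P K)
    {N : ModuleCat.{u} (A ⧸ twoSidedSpan {ω, ω'})}
    {Q₀ Q₁ : ModuleCat.{u} (A ⧸ twoSidedSpan {ω'})} {d : Q₀ ⟶ Q₁}
    {p : Q₁ ⟶ (res₂ ω' ω).obj N} {w : d ≫ p = 0} (hd : (ShortComplex.mk d p w).ShortExact)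
    (h₀ : 𝒬 Q₀) (h₁ : 𝒬 Q₁) (hQ₁ : Projective Q₁) :
    ∃ X, (pairOfType h).zeroZero (shortExact A) P X ∧ Nonempty ((TCok h).obj X ≅ N) := by
  have hE := hc.exact.toIsExactCategory
  have hw := isRegularQuotient_mk hreg h
  have hw₂ := isRegularQuotient_quotientProj hreg h
  obtain ⟨w', hd'⟩ := shortExact_restrictScalars (Ideal.Quotient.mk (twoSidedSpan {ω'})) hd
  obtain ⟨k, hk, hk'⟩ := Factorization.exists_d1 (T := (pairOfType h).T)
    (ω := (pairOfType h).ω) hE hc.autT hd' (ω_app_restrictScalars h N)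
  let C : Factorization (pairOfType h).T (pairOfType h).ω :=
    ⟨(res₁ ω').obj Q₀, (res₁ ω').obj Q₁, (res₁ ω').map d, k, hk, hk'⟩
  obtain ⟨J₀, e₀, he₀, hJ₀⟩ := hcov Q₀ h₀
  obtain ⟨J₁, e₁, he₁, hJ₁⟩ := hcov Q₁ h₁
  obtain ⟨J, e, ⟨L, i, wi, hi⟩, hJ⟩ := exists_isProjInj_deflation (pairOfType h).ω_T hc.exact
    hc.autT hc.frobenius hc.memT C e₀ e₁ ((isDeflation_shortExact_iff _).2 he₀)
    ((isDeflation_shortExact_iff _).2 he₁) hJ₀ hJ₁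
  have hi' := conflations_mk_iff.1 hi
  have hJ' : IsProj (shortExact A) J.X1 := hJ.proj.map_of_adjunction
    (pr1Adjunction (pairOfType h).T (pairOfType h).ω) fun _ hS => ⟨hS, hS⟩
  have hL : components P L := ⟨hker hi'.1 h₀ hJ.mem.1, hker hi'.2 h₁ hJ.mem.2⟩
  obtain ⟨D, hD, hD'⟩ := Factorization.exists_d1 (T := (pairOfType h).liftT')
    (ω := (pairOfType h).liftω') hc.exact_row.toIsExactCategory
    ((pairOfType h).isExactAutoequivalence_liftT' hc.autT') hi
    (hom_ext (ω'_app_restrictScalars h Q₀) (ω'_app_restrictScalars h Q₁))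
  let X : ModFactorization₂ h := ⟨L, J, i, D, hD, hD'⟩
  refine ⟨X, (hc.zeroZero_iff X).2 ⟨⟨hL, hJ.mem⟩, hJ, (hc.frobenius_column.isProjIn_iff _).1
    (isProjIn_of_projective_cokernel h hreg hc hP (M := (pairOfType h).column1 X)
      ⟨hL.2, hJ.mem.2⟩ hJ' hQ₁ hi'.2)⟩, ?_⟩
  have hs := (shortExact_mk_iff _ _ _).1 hd
  have hs₀ := (shortExact_mk_iff _ _ _).1 hi'.1
  have hs₁ := (shortExact_mk_iff _ _ _).1 hi'.2
  have comm : ∀ b, e.f1 (J.d0 b) = d (e.f0 b) := hom_apply_of_comm e.comm0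
  have hpd : ∀ b, p (d b) = 0 := hom_apply_of_comp_eq w
  -- The composite `J^1 ⟶ Q₁ ⟶ N` has the same kernel as the projection to the total-cokernel.
  let π : J.X1 ⟶ (res₁ ω').obj ((res₂ ω' ω).obj N) := e.f1 ≫ (res₁ ω').map p
  have hπ : ∀ x : J.X1, π x = 0 ↔ tcokProj h X x = 0 := fun x => by
    rw [tcokProj_eq_zero_iff]
    constructor
    · intro hx
      obtain ⟨q, hq⟩ := hs.2.2 (e.f1 x) hx
      obtain ⟨b, hb⟩ := hs₀.2.1 q
      obtain ⟨a, ha⟩ := hs₁.2.2 (x - J.d0 b) (by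
        rw [map_sub, comm, hb]
        exact sub_eq_zero.2 hq.symm)
      exact ⟨a, b, by rw [ha, sub_add_cancel]⟩
    · rintro ⟨a, b, rfl⟩
      have h₁ : π (i.f1 a) = 0 :=
        (congrArg ((res₁ ω').map p) (hom_apply_of_comp_eq (congrArg Hom.f1 wi) a)).trans
          (map_zero ((res₁ ω').map p).hom)
      have h₂ : π (J.d0 b) = 0 := (congrArg ((res₁ ω').map p) (comm b)).trans (hpd _)
      exact (map_add π.hom _ _).trans ((congrArg₂ (· + ·) h₁ h₂).trans (add_zero _))
  have ht : (ShortComplex.mk _ _ (kernel.condition (tcokProj h X))).ShortExact :=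
    ⟨ShortComplex.exact_of_f_is_kernel _ (kernelIsKernel _)⟩
  obtain ⟨g, hg⟩ := hE.exists_desc ht π (by
    ext x
    exact (hπ _).2 (hom_apply_of_comp_eq (kernel.condition (tcokProj h X)) x))
  obtain ⟨g, rfl⟩ := IsRegularQuotient.exists_hom_of_restrictScalars hw.surjective g
  obtain ⟨g, rfl⟩ := IsRegularQuotient.exists_hom_of_restrictScalars hw₂.surjective g
  have hg' : ∀ x, g (tcokProj h X x) = π x := hom_apply_of_comp_eq hg
  have hmono : Mono g := (ModuleCat.mono_iff_injective g).2
    ((injective_iff_map_eq_zero _).2 fun y hy => by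
      obtain ⟨x, rfl⟩ := tcokProj_surjective h X y
      exact (hπ x).1 ((hg' x).symm.trans hy))
  have hepi : Epi g := (ModuleCat.epi_iff_surjective g).2 fun z => by
    obtain ⟨y, hy⟩ := hs.2.1 z
    obtain ⟨x, hx⟩ := hs₁.2.1 y
    exact ⟨tcokProj h X x, (hg' x).trans ((congrArg p hx).trans hy)⟩
  have e := @asIso _ _ _ _ g (isIso_of_mono_of_epi g)
  exact ⟨e⟩

lemma exists_tcokPresentation_of_zeroZero {X : ModFactorization₂ h}
    (hX : (pairOfType h).zeroZero (shortExact A) P X) : Nonempty (TCokPresentation h X) :=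
  exists_tcokPresentation h hreg ⟨⟨hP _ hX.1.1.1, hP _ hX.1.1.2⟩, ⟨hP _ hX.1.2.1, hP _ hX.1.2.2⟩⟩
    ((hc.zeroZero_iff X).1 hX).2.2.proj

/-- If the total-cokernel functor is essentially surjective onto a Frobenius class of modules over
`A/(ω, ω')`, then it induces a triangle equivalence. -/
theorem inducesTriangleEquivalence_tcok
    {G : ObjectProperty (ModuleCat.{u} (A ⧸ twoSidedSpan {ω, ω'}))}
    (hG : IsFrobeniusClass (shortExact _) G)
    (hmem : ∀ X : ((pairOfType h).zeroZero (shortExact A) P).FullSubcategory,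
      G ((TCok h).obj X.obj))
    (hdense : ∀ N, G N →
      ∃ X, (pairOfType h).zeroZero (shortExact A) P X ∧ Nonempty ((TCok h).obj X ≅ N)) :
    InducesTriangleEquivalence
      (G.lift (((pairOfType h).zeroZero (shortExact A) P).ι ⋙ TCok h) hmem)
      (restrictConflations ((pairOfType h).conflations₂ (shortExact A))
        ((pairOfType h).zeroZero (shortExact A) P))
      (restrictConflations (shortExact _) G) := by
  have hw := isRegularQuotient_mk hreg h
  have hw₂ := isRegularQuotient_quotientProj hreg h
  have pres : ∀ X : ((pairOfType h).zeroZero (shortExact A) P).FullSubcategory,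
      Nonempty (TCokPresentation h X.obj) := fun X =>
    exists_tcokPresentation_of_zeroZero h hreg hc hP X.property
  have row : ∀ X : ((pairOfType h).zeroZero (shortExact A) P).FullSubcategory,
      IsProjInj (conflations (shortExact A)) (components P) X.obj.X1 := fun X =>
    ((hc.zeroZero_iff X.obj).1 X.property).2.1
  refine inducesTriangleEquivalence_of_full _
    (hc.frobenius_zeroZero.isFrobenius hc.exact₂) (hG.isFrobenius (isWICExactCategory_shortExact _))
    ?_ ?_ ⟨fun {X Y} g => ?_⟩ ⟨fun N => ?_⟩ fun {X Y} f hf => ?_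
  · intro S hS
    obtain ⟨c⟩ := pres S.X₁
    obtain ⟨c'⟩ := pres S.X₂
    obtain ⟨c''⟩ := pres S.X₃
    exact (c.shortExact_tcok hreg c' c'' (w := congrArg (fun k => k.hom) S.zero) hS).2
  · -- Projective objects of the subcategory are projective among all factorizations.
    intro X hX
    have hX' := (hc.frobenius_zeroZero.isProjInj_of_isProj hX).proj
    obtain ⟨c⟩ := pres X
    refine IsFrobeniusClass.isProj_restrict ((isProj_shortExact_iff _).2 ⟨fun {M₁ M₂} f d hd => ?_⟩)
      _
    have hd' : Epi ((res₁ ω').map ((res₂ ω' ω).map d)) := inferInstance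
    obtain ⟨k, hk⟩ := TotalCokernel.exists_lift hc c.totalCokernel hX'
      (ω_app_restrictScalars h M₁) (ω_app_restrictScalars h M₂) (ω'_app_restrictScalars h _)
      (ω'_app_restrictScalars h _) ((isDeflation_shortExact_iff _).2 hd')
      ((res₁ ω').map ((res₂ ω' ω).map f))
    obtain ⟨k, rfl⟩ := IsRegularQuotient.exists_hom_of_restrictScalars hw.surjective k
    obtain ⟨k, rfl⟩ := IsRegularQuotient.exists_hom_of_restrictScalars hw₂.surjective k
    exact ⟨k, (res₂ ω' ω).map_injective ((res₁ ω').map_injective hk)⟩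
  · obtain ⟨c⟩ := pres X
    obtain ⟨c'⟩ := pres Y
    obtain ⟨F, hF⟩ := c.exists_preimage c' hc (row X).proj g.hom
    exact ⟨ObjectProperty.homMk F, G.hom_ext hF⟩
  · obtain ⟨X, hX, ⟨e⟩⟩ := hdense N.obj N.property
    exact ⟨⟨X, hX⟩, ⟨G.isoMk e⟩⟩
  · obtain ⟨c⟩ := pres X
    obtain ⟨c'⟩ := pres Y
    have hf : (TCok h).map f.hom = 0 := congrArg (fun k => k.hom) hf
    have hX₁ : IsProj (shortExact A) X.obj.X1.X1 := (row X).proj.map_of_adjunction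
      (pr1Adjunction (pairOfType h).T (pairOfType h).ω) fun _ hS => ⟨hS, hS⟩
    obtain ⟨a, b, a', b', hab⟩ := exists_factor_of_totalCokernel_eq_zero hc c.totalCokernel
      c'.totalCokernel hX₁ f.hom (by
        rw [TCokPresentation.totalCokernel_π]
        refine ModuleCat.hom_ext (LinearMap.ext fun x => ?_)
        exact congrArg (fun k : (TCok h).obj X.obj ⟶ (TCok h).obj Y.obj =>
          k.hom (tcokProj h X.obj x)) hf)
    obtain ⟨hZ, hZ'⟩ := hc.isProj_disk0 (row X)
    obtain ⟨hW, hW'⟩ := hc.isProj_diskRows ((hc.zeroZero_iff X.obj).1 X.property).2.2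
    have key : f = (ObjectProperty.homMk a : X ⟶ ⟨_, hZ⟩) ≫ (ObjectProperty.homMk b : _ ⟶ Y) +
        (ObjectProperty.homMk a' : X ⟶ ⟨_, hW⟩) ≫ (ObjectProperty.homMk b' : _ ⟶ Y) :=
      ObjectProperty.hom_ext _ hab.symm
    rw [key]
    exact add_mem (mem_projIdeal_of_factor _ _ hZ') (mem_projIdeal_of_factor _ _ hW')

end

/-! ### Gorenstein projective factorizations -/

section

variable {A : Type u} [Ring A] {ω' ω : A} {σ' σ : A ≃+* A} {ξ : Aˣ} (h : IsOfType ω' ω σ' σ ξ)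
  (hreg : IsRegularSequence ω' ω)

include hreg

lemma gproj_tcok {X : ModFactorization₂ h} (hX : GF00 h X) : GProj _ ((TCok h).obj X) := by
  obtain ⟨c⟩ := exists_tcokPresentation_of_zeroZero h hreg (isCompatible_gproj h) le_rfl hX
  exact (isRegularQuotient_quotientProj hreg h).gproj_of_shortExact c.exact c.gproj
    (gproj_of_projective c.projective)

/-- A Gorenstein projective module `N` over `A/(ω, ω')` is a total-cokernel: the kernel over
`A/(ω')` of any epimorphism from a projective module to `N` is Gorenstein projective. -/
lemma exists_gf00 {N : ModuleCat.{u} (A ⧸ twoSidedSpan {ω, ω'})} (hN : GProj _ N) :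
    ∃ X, GF00 h X ∧ Nonempty ((TCok h).obj X ≅ N) := by
  have hw := isRegularQuotient_mk hreg h
  have hQ₁ := Projective.projective_over ((res₂ ω' ω).obj N)
  have hd : (ShortComplex.mk _ _ (kernel.condition (Projective.π ((res₂ ω' ω).obj N)))).ShortExact
    :=
    ⟨ShortComplex.exact_of_f_is_kernel _ (kernelIsKernel _)⟩
  refine exists_tcok_iso h hreg (isCompatible_gproj h) le_rfl (𝒬 := GProj _) (fun Q _ => ?_)
    (fun hs hQ hJ => hw.gproj_kernel hs hJ hQ) hd
    ((isRegularQuotient_quotientProj hreg h).gproj_kernel hd (gproj_of_projective hQ₁) hN)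
    (gproj_of_projective hQ₁) hQ₁
  exact ⟨Projective.over _, Projective.π _, inferInstance,
    GProj.isProjInj (fun _ h => h) inferInstance (gproj_of_projective inferInstance)⟩

end

/-! ### Matrix factorizations -/

section

variable {R : Type u} [Ring R] {S : Type u} [Ring S] {f : R →+* S}

lemma finite_restrictScalars_iff (hf : Function.Surjective f) (M : ModuleCat.{u} S) :
    Module.Finite R ((ModuleCat.restrictScalars f).obj M) ↔ Module.Finite S M := by
  have : RingHomSurjective f := ⟨hf⟩
  constructor
  · intro _
    exact Module.Finite.of_surjective (σ := f) (M := (ModuleCat.restrictScalars f).obj M) (P := M)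
      { toFun := fun m => m
        map_add' := fun _ _ => rfl
        map_smul' := fun _ _ => rfl } Function.surjective_id
  · rintro ⟨s, hs⟩
    let M' := (ModuleCat.restrictScalars f).obj M
    have key : ∀ x ∈ Submodule.span S (s : Set M),
        x ∈ (Submodule.span R (M := M') (SetLike.coe s : Set M) : Set M') := fun x hx => by
      induction hx using Submodule.span_induction with
      | mem x hx => exact Submodule.subset_span (M := M') hx
      | zero => exact zero_mem (Submodule.span R (M := M') (SetLike.coe s : Set M))
      | add x y _ _ hx hy => exact add_mem (S := Submodule R M') hx hy
      | smul r x _ hx =>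
        obtain ⟨r, rfl⟩ := hf r
        exact Submodule.smul_mem (M := M') _ r hx
    exact ⟨s, eq_top_iff.2 fun x _ => key x (hs ▸ Submodule.mem_top)⟩

lemma IsRegularQuotient.finitePd_of_projective {w : R} {τ : R ≃+* R}
    (hw : IsRegularQuotient f w τ) {Q : ModuleCat.{u} S} (hQ : Projective Q) : FinitePd f Q :=
  ⟨2, hw.hasProjectiveDimensionLT_two hQ⟩

variable {A : Type u} [Ring A] {ω' ω : A} {σ' σ : A ≃+* A} {ξ : Aˣ} (h : IsOfType ω' ω σ' σ ξ)
  (hreg : IsRegularSequence ω' ω)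

include h hreg

/-- Projective modules over `A/(ω, ω')` have finite projective dimension over `A`. -/
lemma finitePd_mk_of_projective {Q : ModuleCat.{u} (A ⧸ twoSidedSpan {ω, ω'})}
    (hQ : Projective Q) : FinitePd (Ideal.Quotient.mk (twoSidedSpan {ω, ω'})) Q := by
  have hw := isRegularQuotient_mk hreg h
  obtain ⟨Q', r, F, q, w, hF, -, hq⟩ := (isRegularQuotient_quotientProj hreg h).exists_presentation
    hQ
  obtain ⟨n, hn⟩ := (FinitePd.two_of_three hq).2.2 (hw.finitePd_of_projective hF)
    (hw.finitePd_of_projective (projective_twist _ hF))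
  have hn : HasProjectiveDimensionLT ((ModuleCat.restrictScalars
    (Ideal.Quotient.mk (twoSidedSpan {ω, ω'}))).obj Q') n := hn
  exact ⟨n, (r.map (ModuleCat.restrictScalars
    (Ideal.Quotient.mk (twoSidedSpan {ω, ω'})))).hasProjectiveDimensionLT n⟩

lemma fgGProjFinite_tcok {X : ModFactorization₂ h} (hX : MF00 h X) :
    fgGProjFinite (Ideal.Quotient.mk (twoSidedSpan {ω, ω'})) ((TCok h).obj X) := by
  have hw := isRegularQuotient_mk hreg h
  have hw₂ := isRegularQuotient_quotientProj hreg h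
  have hLT : ∀ {M : ModuleCat.{u} A}, fgProj A M → HasProjectiveDimensionLT M 1 :=
    fun hM => projective_iff_hasProjectiveDimensionLT_one.1 hM.2
  obtain ⟨c⟩ := exists_tcokPresentation_of_zeroZero h hreg (isCompatible_fgProj h)
    (fun _ h => gproj_of_projective h.2) hX
  refine ⟨?_, hw₂.gproj_of_shortExact c.exact c.gproj (gproj_of_projective c.projective),
    (FinitePd.two_of_three c.exact).2.2 ⟨2, ?_⟩ (hw.finitePd_of_projective c.projective)⟩
  · have : Module.Finite A X.X1.X1 := hX.1.2.2.1
    refine (finite_restrictScalars_iff (f := Ideal.Quotient.mk (twoSidedSpan {ω, ω'}))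
      Ideal.Quotient.mk_surjective _).1 ?_
    exact Module.Finite.of_surjective (tcokProj h X).hom (tcokProj_surjective h X)
  · have := hLT hX.1.2.1
    exact c.exact₀.hasProjectiveDimensionLT_X₃ 1 (hLT hX.1.1.1)
      (hasProjectiveDimensionLT_of_ge X.X1.X0 1 _ (by omega))

/-- The finite version of `exists_gf00`. The components of the factorization are Gorenstein
projective and of finite projective dimension over `A`, and hence projective. -/
lemma exists_mf00 [IsNoetherianRing A] {N : ModuleCat.{u} (A ⧸ twoSidedSpan {ω, ω'})}
    (hN : fgGProjFinite (Ideal.Quotient.mk (twoSidedSpan {ω, ω'})) N) :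
    ∃ X, MF00 h X ∧ Nonempty ((TCok h).obj X ≅ N) := by
  have hw := isRegularQuotient_mk hreg h
  have hw₂ := isRegularQuotient_quotientProj hreg h
  have : IsNoetherianRing (A ⧸ twoSidedSpan {ω'}) :=
    isNoetherianRing_of_surjective _ _ _ hw.surjective
  have : Module.Finite _ ((res₂ ω' ω).obj N) := (finite_restrictScalars_iff hw₂.surjective N).2 hN.1
  obtain ⟨n, p, hp⟩ := Module.Finite.exists_fin' (A ⧸ twoSidedSpan {ω'}) ((res₂ ω' ω).obj N)
  have : Epi (ModuleCat.ofHom p) := (ModuleCat.epi_iff_surjective _).2 hp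
  have hd : (ShortComplex.mk _ _ (kernel.condition (ModuleCat.ofHom p))).ShortExact :=
    ⟨ShortComplex.exact_of_f_is_kernel _ (kernelIsKernel _)⟩
  have hQ₁ := projective_pi (R := A ⧸ twoSidedSpan {ω'}) n
  have hQ₁' := hw.finitePd_of_projective hQ₁
  refine exists_tcok_iso h hreg (isCompatible_fgProj h) (fun _ h => gproj_of_projective h.2)
    (𝒬 := fgGProjFinite (Ideal.Quotient.mk (twoSidedSpan {ω'}))) (fun Q hQ => ?_)
    (fun {K J Q i p w} hs hQ hJ => ?_) hd
    ⟨Module.Finite.of_injective (kernel.ι (ModuleCat.ofHom p)).hom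
      ((ModuleCat.mono_iff_injective (kernel.ι (ModuleCat.ofHom p))).1 inferInstance),
      hw₂.gproj_kernel hd (gproj_of_projective hQ₁) hN.2.1,
      (FinitePd.two_of_three hd).2.1 hQ₁' hN.2.2⟩
    ⟨inferInstance, gproj_of_projective hQ₁, hQ₁'⟩ hQ₁
  · have : Module.Finite A ((res₁ ω').obj Q) := (finite_restrictScalars_iff hw.surjective Q).2 hQ.1
    obtain ⟨n, p, hp⟩ := Module.Finite.exists_fin' A ((res₁ ω').obj Q)
    exact ⟨_, ModuleCat.ofHom (Y := (res₁ ω').obj Q) p, (ModuleCat.epi_iff_surjective _).2 hp,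
      GProj.isProjInj (fun _ h => gproj_of_projective h.2) (projective_pi n)
        ⟨inferInstance, projective_pi n⟩⟩
  · -- The kernel is Gorenstein projective of finite projective dimension.
    have : Module.Finite A J := hJ.1
    obtain ⟨n, hn⟩ := hQ.2.2
    have hJ' := projective_iff_hasProjectiveDimensionLT_one.1 hJ.2
    exact ⟨Module.Finite.of_injective i.hom ((shortExact_mk_iff i p w).1 hs).1,
      GProj.projective (hw.gproj_kernel hs (gproj_of_projective hJ.2) hQ.2.1)
        (hs.hasProjectiveDimensionLT_X₁ (n + 1) (hasProjectiveDimensionLT_of_ge J 1 _ (by omega))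
          (hasProjectiveDimensionLT_of_ge _ n _ (by omega)))⟩

end

end ModFac

theorem mainTheorem4 {A : Type u} [Ring A] (ω' ω : A) (σ' σ : A ≃+* A) (ξ : Aˣ)
    (hreg : ModFac.IsRegularSequence ω' ω) (h : ModFac.IsOfType ω' ω σ' σ ξ) :
    (∃ hG : ∀ X : (ModFac.GF00 h).FullSubcategory,
        ModFac.GProj (A ⧸ ModFac.twoSidedSpan {ω, ω'}) ((ModFac.TCok h).obj X.obj),
      ModFac.InducesTriangleEquivalence
        ((ModFac.GProj (A ⧸ ModFac.twoSidedSpan {ω, ω'})).lift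
          ((ModFac.GF00 h).ι ⋙ ModFac.TCok h) hG)
        (ModFac.restrictConflations
          ((ModFac.pairOfType h).conflations₂ (ModFac.shortExact A)) (ModFac.GF00 h))
        (ModFac.restrictConflations
          (ModFac.shortExact (A ⧸ ModFac.twoSidedSpan {ω, ω'})) (ModFac.GProj _))) ∧
    (IsNoetherianRing A →
      ∃ hM : ∀ X : (ModFac.MF00 h).FullSubcategory,
          ModFac.fgGProjFinite (Ideal.Quotient.mk (ModFac.twoSidedSpan {ω, ω'}))
            ((ModFac.TCok h).obj X.obj),
        ModFac.InducesTriangleEquivalence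
          ((ModFac.fgGProjFinite (Ideal.Quotient.mk (ModFac.twoSidedSpan {ω, ω'}))).lift
            ((ModFac.MF00 h).ι ⋙ ModFac.TCok h) hM)
          (ModFac.restrictConflations
            ((ModFac.pairOfType h).conflations₂ (ModFac.shortExact A)) (ModFac.MF00 h))
          (ModFac.restrictConflations
            (ModFac.shortExact (A ⧸ ModFac.twoSidedSpan {ω, ω'}))
            (ModFac.fgGProjFinite (Ideal.Quotient.mk (ModFac.twoSidedSpan {ω, ω'}))))) := by
  refine ⟨⟨fun X => ModFac.gproj_tcok h hreg X.property, ?_⟩, fun hA =>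
    ⟨fun X => ModFac.fgGProjFinite_tcok h hreg X.property, ?_⟩⟩
  · exact ModFac.inducesTriangleEquivalence_tcok h hreg (ModFac.isCompatible_gproj h) le_rfl
      (ModFac.isFrobeniusClass_gproj _) _ fun _ hN => ModFac.exists_gf00 h hreg hN
  · have : IsNoetherianRing (A ⧸ ModFac.twoSidedSpan {ω, ω'}) :=
      isNoetherianRing_of_surjective _ _ _ Ideal.Quotient.mk_surjective
    exact ModFac.inducesTriangleEquivalence_tcok h hreg (ModFac.isCompatible_fgProj h)
      (fun _ h => ModFac.gproj_of_projective h.2) (ModFac.isFrobeniusClass_fgGProjFinite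
        (ModFac.finitePd_mk_of_projective h hreg inferInstance)) _
      fun _ hN => ModFac.exists_mf00 h hreg hN
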